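/- Let $Q$ be a quiver whose underlying undirected graph is a simply laced Dynkin diagram (a finite disjoint union of diagrams of type $A_n$ ($n\ge 1$), $D_n$ ($n\ge 4$), $E_6$, $E_7$, $E_8$; in particular any single such diagram), let $k=\mathbb F_q$ be a finite field with $q$ elements, and let $\mathrm{Rep}(Q)$ be the abelian category of finite-dimensional representations of $Q$ over $k$. The spaces $\mathrm{Ext}^i(M,N)$ in $\mathrm{Rep}(Q)$ are finite-dimensional for all $i$ and vanish for $i\ge 2$. Let $K=K_0(\mathrm{Rep}(Q))$ be the Grothendieck group: the abelian group generated by the isomorphism classes of objects, subject to $[B]=[A]+[C]$ for every short exact sequence $0\to A\to B\to C\to 0$. There is a (necessarily unique) biadditive form $\langle\cdot,\cdot\rangle\colon K\times K\to\mathbb Z$ with \[\langle [M],[N]\rangle=\dim_k\mathrm{Hom}(M,N)-\dim_k\mathrm{Ext}^1(M,N)\] for all objects $M,N$. Let $\mathrm{Vect}^K$ be the category of $K$-graded real vector spaces and grade-preserving linear maps, with the usual tensor product, graded by $(V\otimes W)_d=\bigoplus_{a+b=d}V_a\otimes W_b$, with unit object $\mathbb R$ in degree $0$, and with the braiding \[V\otimes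 W\to W\otimes V,\qquad v\otimes w\mapsto q^{-\langle a,b\rangle}\,w\otimes v\qquad(v\in V_a,\ w\in W_b).\] Let $\mathcal H$ be the real vector space with basis the isomorphism classes $[M]$ of objects of $\mathrm{Rep}(Q)$, where $[M]$ is placed in degree $[M]\in K$. Write $P^E_{MN}$ for the number of pairs $(f,g)$ such that $0\to N\xrightarrow{f}E\xrightarrow{g}M\to 0$ is exact, and $\mathrm{aut}(M)=|\mathrm{Aut}(M)|$. Then the formulas \[m([M]\otimes[N])=\sum_{[E]}\frac{P^E_{MN}}{\mathrm{aut}(M)\,\mathrm{aut}(N)}[E],\qquad \Delta([E])=\sum_{[M],[N]}\frac{P^E_{MN}}{\mathrm{aut}(E)}[N]\otimes[M]\] (all sums are finite), with unit $1\mapsto[0]$ and counit $\varepsilon([M])=1$ if $M\cong0$ and $\varepsilon([M])=0$ otherwise, define morphisms in $\mathrm{Vect}^K$ and make $\mathcal H$ a bialgebra object in the braided monoidal category $\mathrm{Vect}^K$: $(\mathcal H,m)$ is an associative unital algebra object, $(\mathcal H,\Delta)$ is a coassociative counital coalgebra object, $\Delta$ and $\varepsilon$ are compatible with the unit, $\varepsilon$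 is multiplicative, and \[\Delta\circ m=(m\otimes m)\circ(\mathrm{id}\otimes B_{\mathcal H,\mathcal H}\otimes\mathrm{id})\circ(\Delta\otimes\Delta),\] where $B_{\mathcal H,\mathcal H}$ is the braiding above. -/

import Mathlib

open CategoryTheory MonoidalCategory TensorProduct
open scoped MonObj ComonObj ZeroObject

universe v w u

set_option linter.unusedVariables false
set_option linter.unusedSectionVars false

noncomputable section

/-! ### Graded real vector spaces -/

/-- A real vector space graded by `K`: it is the internal direct sum of the pieces `piece d`. -/
structure GrVect (K : Type u) where
  carrier : Type v
  [addCommGroup : AddCommGroup carrier]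
  [module : Module ℝ carrier]
  piece : K → Submodule ℝ carrier
  indep : iSupIndep piece
  iSup_eq_top : ⨆ d, piece d = ⊤

namespace GrVect

attribute [instance] GrVect.addCommGroup GrVect.module

instance {K : Type u} : CoeSort (GrVect.{v} K) (Type v) := ⟨GrVect.carrier⟩

/-- Grade preserving linear maps. -/
@[ext]
structure Hom {K : Type u} (X Y : GrVect.{v} K) where
  toLin : X →ₗ[ℝ] Y
  map_piece : ∀ (d : K) (x : X), x ∈ X.piece d → toLin x ∈ Y.piece d

instance {K : Type u} : Category (GrVect.{v} K) where
  Hom := Hom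
  id X := ⟨LinearMap.id, fun _ _ h => h⟩
  comp f g := ⟨g.toLin ∘ₗ f.toLin, fun d x h => g.map_piece d _ (f.map_piece d x h)⟩

section basic

variable {K : Type u}

@[ext]
theorem hom_ext {X Y : GrVect.{v} K} {f g : X ⟶ Y} (h : f.toLin = g.toLin) : f = g :=
  Hom.ext h

@[simp] theorem id_toLin (X : GrVect.{v} K) : Hom.toLin (𝟙 X) = LinearMap.id := rfl

@[simp] theorem comp_toLin {X Y Z : GrVect.{v} K} (f : X ⟶ Y) (g : Y ⟶ Z) :
    (f ≫ g).toLin = g.toLin ∘ₗ f.toLin := rfl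

/-- An isomorphism from a linear equivalence that preserves the grading in both directions. -/
def mkIso {X Y : GrVect.{v} K} (e : X ≃ₗ[ℝ] Y)
    (h : ∀ (d : K) (x : X), x ∈ X.piece d → e x ∈ Y.piece d)
    (h' : ∀ (d : K) (y : Y), y ∈ Y.piece d → e.symm y ∈ X.piece d) : X ≅ Y where
  hom := ⟨e.toLinearMap, h⟩
  inv := ⟨e.symm.toLinearMap, h'⟩
  hom_inv_id := by ext x; exact e.symm_apply_apply x
  inv_hom_id := by ext x; exact e.apply_symm_apply x

theorem linearMap_ext (X : GrVect.{v} K) {W : Type*} [AddCommGroup W] [Module ℝ W]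
    {f g : X →ₗ[ℝ] W} (h : ∀ (d : K) (x : X), x ∈ X.piece d → f x = g x) : f = g := by
  rw [← LinearMap.eqLocus_eq_top, eq_top_iff, ← X.iSup_eq_top]
  exact iSup_le fun d x hx => h d x hx

/-- A criterion for independence: a linear map that reads off the degree. -/
theorem indep_of_coaction {V : Type*} [AddCommGroup V] [Module ℝ V] (p : K → Submodule ℝ V)
    (D : V →ₗ[ℝ] (K →₀ V)) (hD : ∀ d, ∀ x ∈ p d, D x = Finsupp.single d x) : iSupIndep p := by
  intro d
  rw [Submodule.disjoint_def]
  intro x hx hx'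
  have key : ∀ y ∈ ⨆ j, ⨆ (_ : j ≠ d), p j, D y d = 0 := by
    intro y hy
    have hle : (⨆ j, ⨆ (_ : j ≠ d), p j) ≤ LinearMap.ker ((Finsupp.lapply d) ∘ₗ D) := by
      refine iSup_le fun j => iSup_le fun hj z hz => ?_
      simp [hD j z hz, Finsupp.single_eq_of_ne hj.symm]
    simpa using hle hy
  have := key x hx'
  simpa [hD d x hx] using this

theorem isInternal [DecidableEq K] (X : GrVect.{v} K) : DirectSum.IsInternal X.piece :=
  (DirectSum.isInternal_submodule_iff_iSupIndep_and_iSup_eq_top _).2 ⟨X.indep, X.iSup_eq_top⟩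

open Classical in
/-- A graded vector space is isomorphic to the direct sum of its pieces. -/
def decomp (X : GrVect.{v} K) : X ≃ₗ[ℝ] DirectSum K (fun d => X.piece d) :=
  (LinearEquiv.ofBijective (DirectSum.coeLinearMap X.piece) (by exact X.isInternal)).symm

open Classical in
theorem decomp_of_mem (X : GrVect.{v} K) {d : K} {x : X} (hx : x ∈ X.piece d) :
    X.decomp x = DirectSum.lof ℝ K (fun d => X.piece d) d ⟨x, hx⟩ := by
  refine (LinearEquiv.symm_apply_eq _).2 ?_
  exact (DirectSum.coeLinearMap_lof X.piece d ⟨x, hx⟩).symm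

open Classical in
/-- The linear map `x ↦ ∑ d, single d (x_d)`, where `x_d` is the component of degree `d`. -/
def components (X : GrVect.{v} K) : X →ₗ[ℝ] (K →₀ X) :=
  (DirectSum.toModule ℝ K (K →₀ X) fun d => Finsupp.lsingle d ∘ₗ (X.piece d).subtype) ∘ₗ
    X.decomp.toLinearMap

theorem components_of_mem (X : GrVect.{v} K) {d : K} {x : X} (hx : x ∈ X.piece d) :
    X.components x = Finsupp.single d x := by
  classical
  rw [components, LinearMap.comp_apply, LinearEquiv.coe_coe, decomp_of_mem X hx,
    DirectSum.toModule_lof]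
  simp

end basic

/-! ### Tensor product of graded vector spaces -/

section tensor

variable {K : Type u} [AddCommGroup K]

/-- The degree `d` piece of the tensor product, spanned by all `x ⊗ y` with `x`, `y` homogeneous
and `deg x + deg y = d`. -/
def tensorPiece (X Y : GrVect.{v} K) (d : K) : Submodule ℝ (X ⊗[ℝ] Y) :=
  Submodule.span ℝ {t | ∃ (a b : K) (x : X) (y : Y), a + b = d ∧ x ∈ X.piece a ∧ y ∈ Y.piece b ∧
    t = x ⊗ₜ[ℝ] y}

theorem tmul_mem {X Y : GrVect.{v} K} {a b d : K} (h : a + b = d) {x : X} {y : Y}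
    (hx : x ∈ X.piece a) (hy : y ∈ Y.piece b) : x ⊗ₜ[ℝ] y ∈ tensorPiece X Y d :=
  Submodule.subset_span ⟨a, b, x, y, h, hx, hy, rfl⟩

theorem tensorPiece_le {X Y : GrVect.{v} K} {d : K} {p : Submodule ℝ (X ⊗[ℝ] Y)}
    (h : ∀ a b (x : X) (y : Y), a + b = d → x ∈ X.piece a → y ∈ Y.piece b → x ⊗ₜ[ℝ] y ∈ p) :
    tensorPiece X Y d ≤ p := by
  refine Submodule.span_le.2 ?_
  rintro _ ⟨a, b, x, y, hab, hx, hy, rfl⟩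
  exact h a b x y hab hx hy

theorem tensor_ext (X Y : GrVect.{v} K) {W : Type*} [AddCommGroup W] [Module ℝ W]
    {f g : X ⊗[ℝ] Y →ₗ[ℝ] W}
    (h : ∀ a b (x : X) (y : Y), x ∈ X.piece a → y ∈ Y.piece b →
      f (x ⊗ₜ y) = g (x ⊗ₜ y)) : f = g := by
  refine TensorProduct.ext (X.linearMap_ext fun a x hx => Y.linearMap_ext fun b y hy => ?_)
  exact h a b x y hx hy

/-- The linear map that decomposes `x ⊗ y` into its bihomogeneous components. -/
def bicomponents (X Y : GrVect.{v} K) : X ⊗[ℝ] Y →ₗ[ℝ] (K × K →₀ X ⊗[ℝ] Y) :=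
  (finsuppTensorFinsupp ℝ ℝ X Y K K).toLinearMap ∘ₗ
    TensorProduct.map X.components Y.components

theorem bicomponents_tmul (X Y : GrVect.{v} K) {a b : K} {x : X} {y : Y}
    (hx : x ∈ X.piece a) (hy : y ∈ Y.piece b) :
    bicomponents X Y (x ⊗ₜ y) = Finsupp.single (a, b) (x ⊗ₜ y) := by
  simp [bicomponents, components_of_mem _ hx, components_of_mem _ hy]

/-- The tensor product of graded vector spaces. -/
abbrev tensor (X Y : GrVect.{v} K) : GrVect.{v} K where
  carrier := X ⊗[ℝ] Y
  piece := tensorPiece X Y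
  indep := by
    refine indep_of_coaction _
      (Finsupp.lmapDomain _ ℝ (fun p : K × K => p.1 + p.2) ∘ₗ bicomponents X Y) fun d => ?_
    intro t ht
    have : tensorPiece X Y d ≤ LinearMap.eqLocus
        (Finsupp.lmapDomain _ ℝ (fun p : K × K => p.1 + p.2) ∘ₗ bicomponents X Y)
        (Finsupp.lsingle d) := by
      refine tensorPiece_le fun a b x y hab hx hy => ?_
      simp [bicomponents_tmul X Y hx hy, Finsupp.mapDomain_single, hab]
    exact this ht
  iSup_eq_top := by
    rw [← Submodule.ker_mkQ (⨆ d, tensorPiece X Y d), LinearMap.ker_eq_top]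
    refine tensor_ext X Y fun a b x y hx hy => ?_
    rw [LinearMap.zero_apply, Submodule.mkQ_apply, Submodule.Quotient.mk_eq_zero]
    exact Submodule.mem_iSup_of_mem (a + b) (tmul_mem rfl hx hy)

/-- The tensor unit: the real numbers in degree `0`. -/
abbrev unit : GrVect.{v} K where
  carrier := ULift.{v} ℝ
  piece d := ⨆ (_ : d = 0), ⊤
  indep := by
    refine indep_of_coaction _ (Finsupp.lsingle 0) fun d x hx => ?_
    by_cases h : d = 0
    · simp [h]
    · simp [h] at hx
      simp [hx]
  iSup_eq_top := by simp

theorem unit_piece_induction {d : K} {r : (unit : GrVect.{v} K)}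
    (hr : r ∈ (unit : GrVect.{v} K).piece d) : d = 0 ∨ r = 0 := by
  by_cases h : d = 0
  · exact Or.inl h
  · right
    simpa [unit, h] using hr

theorem mem_unit_zero (r : (unit : GrVect.{v} K)) : r ∈ (unit : GrVect.{v} K).piece 0 := by
  simp [unit]

/-- The tensor product of two grade preserving maps. -/
def tensorHom' {X X' Y Y' : GrVect.{v} K} (f : X ⟶ Y) (g : X' ⟶ Y') :
    tensor X X' ⟶ tensor Y Y' where
  toLin := TensorProduct.map f.toLin g.toLin
  map_piece d := by
    refine tensorPiece_le (p := (tensorPiece Y Y' d).comap _) fun a b x y hab hx hy => ?_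
    exact tmul_mem hab (f.map_piece a x hx) (g.map_piece b y hy)

/-- The associator. -/
def assoc (X Y Z : GrVect.{v} K) : tensor (tensor X Y) Z ≅ tensor X (tensor Y Z) :=
  mkIso (TensorProduct.assoc ℝ X Y Z)
    (by
      intro d
      refine tensorPiece_le (X := tensor X Y) (Y := Z) (p := (tensorPiece X (tensor Y Z) d).comap
        (TensorProduct.assoc ℝ X Y Z).toLinearMap) fun a c t z hac ht hz => ?_
      refine (tensorPiece_le (p := ((tensorPiece X (tensor Y Z) d).comap
        (TensorProduct.assoc ℝ X Y Z).toLinearMap).comap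
          ((TensorProduct.mk ℝ (X ⊗[ℝ] Y) Z).flip z)) fun a' b x y hab hx hy => ?_) ht
      exact tmul_mem (Y := tensor Y Z) (b := b + c) (by rw [← hac, ← hab, add_assoc]) hx
        (tmul_mem rfl hy hz))
    (by
      intro d
      refine tensorPiece_le (X := X) (Y := tensor Y Z) (p := (tensorPiece (tensor X Y) Z d).comap
        (TensorProduct.assoc ℝ X Y Z).symm.toLinearMap) fun a c x t hac hx ht => ?_
      refine (tensorPiece_le (p := ((tensorPiece (tensor X Y) Z d).comap
        (TensorProduct.assoc ℝ X Y Z).symm.toLinearMap).comap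
          (TensorProduct.mk ℝ X (Y ⊗[ℝ] Z) x)) fun b c' y z hbc hy hz => ?_) ht
      exact tmul_mem (X := tensor X Y) (a := a + b) (by rw [← hac, ← hbc, add_assoc])
        (tmul_mem rfl hx hy) hz)

/-- The left unitor. -/
def leftUnit (X : GrVect.{v} K) : tensor unit X ≅ X :=
  mkIso (X := tensor unit X)
    (TensorProduct.congr ULift.moduleEquiv (LinearEquiv.refl ℝ X) ≪≫ₗ TensorProduct.lid ℝ X)
    (by
      intro d
      refine tensorPiece_le (X := unit) (Y := X) (p := (X.piece d).comap (TensorProduct.congr ULift.moduleEquiv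
        (LinearEquiv.refl ℝ X) ≪≫ₗ TensorProduct.lid ℝ X).toLinearMap)
        fun a b r x hab hr hx => ?_
      rcases unit_piece_induction hr with rfl | rfl
      · rw [zero_add] at hab
        subst hab
        exact (X.piece b).smul_mem _ hx
      · rw [TensorProduct.zero_tmul]
        exact Submodule.zero_mem _)
    (fun d x hx => tmul_mem (X := unit) (zero_add d) (mem_unit_zero _) hx)

/-- The right unitor. -/
def rightUnit (X : GrVect.{v} K) : tensor X unit ≅ X :=
  mkIso (X := tensor X unit)
    (TensorProduct.congr (LinearEquiv.refl ℝ X) ULift.moduleEquiv ≪≫ₗ TensorProduct.rid ℝ X)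
    (by
      intro d
      refine tensorPiece_le (X := X) (Y := unit) (p := (X.piece d).comap (TensorProduct.congr (LinearEquiv.refl ℝ X)
        ULift.moduleEquiv ≪≫ₗ TensorProduct.rid ℝ X).toLinearMap)
        fun a b x r hab hx hr => ?_
      rcases unit_piece_induction hr with rfl | rfl
      · rw [add_zero] at hab
        subst hab
        exact (X.piece a).smul_mem _ hx
      · rw [TensorProduct.tmul_zero]
        exact Submodule.zero_mem _)
    (fun d x hx => tmul_mem (Y := unit) (add_zero d) hx (mem_unit_zero _))

instance : MonoidalCategoryStruct (GrVect.{v} K) where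
  tensorObj := tensor
  tensorHom f g := tensorHom' f g
  whiskerLeft X _ _ f := tensorHom' (𝟙 X) f
  whiskerRight f Y := tensorHom' f (𝟙 Y)
  tensorUnit := unit
  associator := assoc
  leftUnitor := leftUnit
  rightUnitor := rightUnit

instance : MonoidalCategory (GrVect.{v} K) :=
  MonoidalCategory.ofTensorHom
    (id_tensorHom_id := fun X Y => hom_ext (TensorProduct.ext' fun x y => rfl))
    (id_tensorHom := fun _ _ _ _ => rfl)
    (tensorHom_id := fun _ _ => rfl)
    (tensorHom_comp_tensorHom := fun f₁ f₂ g₁ g₂ =>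
      hom_ext (TensorProduct.ext' fun x y => rfl))
    (associator_naturality := fun f₁ f₂ f₃ =>
      hom_ext (TensorProduct.ext_threefold fun x y z => rfl))
    (leftUnitor_naturality := fun f => hom_ext (TensorProduct.ext' fun r x =>
      (f.toLin.map_smul r.down x).symm))
    (rightUnitor_naturality := fun f => hom_ext (TensorProduct.ext' fun x r =>
      (f.toLin.map_smul r.down x).symm))
    (pentagon := fun W X Y Z =>
      hom_ext (TensorProduct.ext_fourfold fun w x y z => rfl))
    (triangle := fun X Y => hom_ext (TensorProduct.ext_threefold fun x r y =>
      (TensorProduct.smul_tmul r.down x y).symm))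

end tensor

/-! ### The braiding -/

section braiding

variable {K : Type u} [AddCommGroup K]

/-- The linear map with `x ⊗ y ↦ q ^ (-⟨a, b⟩) • (y ⊗ x)` for `x` of degree `a` and `y` of
degree `b`. -/
def braidLin (χ : K →+ K →+ ℤ) (q : ℝ) (X Y : GrVect.{v} K) : X ⊗[ℝ] Y →ₗ[ℝ] Y ⊗[ℝ] X :=
  Finsupp.lsum ℝ (fun p : K × K =>
    (q ^ (-χ p.1 p.2)) • (TensorProduct.comm ℝ X Y).toLinearMap) ∘ₗ bicomponents X Y

theorem braidLin_tmul (χ : K →+ K →+ ℤ) (q : ℝ) {X Y : GrVect.{v} K} {a b : K} {x : X} {y : Y}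
    (hx : x ∈ X.piece a) (hy : y ∈ Y.piece b) :
    braidLin χ q X Y (x ⊗ₜ y) = q ^ (-χ a b) • (y ⊗ₜ[ℝ] x) := by
  simp [braidLin, bicomponents_tmul X Y hx hy]

/-- The inverse of `braidLin`. -/
def braidInvLin (χ : K →+ K →+ ℤ) (q : ℝ) (X Y : GrVect.{v} K) : Y ⊗[ℝ] X →ₗ[ℝ] X ⊗[ℝ] Y :=
  Finsupp.lsum ℝ (fun p : K × K =>
    (q ^ (χ p.2 p.1)) • (TensorProduct.comm ℝ Y X).toLinearMap) ∘ₗ bicomponents Y X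

theorem braidInvLin_tmul (χ : K →+ K →+ ℤ) (q : ℝ) {X Y : GrVect.{v} K} {a b : K} {x : X} {y : Y}
    (hx : x ∈ X.piece a) (hy : y ∈ Y.piece b) :
    braidInvLin χ q X Y (y ⊗ₜ x) = q ^ (χ a b) • (x ⊗ₜ[ℝ] y) := by
  simp [braidInvLin, bicomponents_tmul Y X hy hx]

/-- The braiding as an isomorphism of graded vector spaces. -/
def braidIso (χ : K →+ K →+ ℤ) (q : ℝ) (hq : q ≠ 0) (X Y : GrVect.{v} K) :
    tensor X Y ≅ tensor Y X :=
  mkIso (X := tensor X Y) (Y := tensor Y X)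
    (LinearEquiv.ofLinearMap (braidLin χ q X Y) (braidInvLin χ q X Y)
      (tensor_ext Y X fun b a y x hy hx => by
        rw [LinearMap.comp_apply, braidInvLin_tmul χ q hx hy, map_smul, braidLin_tmul χ q hx hy,
          smul_smul, ← zpow_add₀ hq]
        simp)
      (tensor_ext X Y fun a b x y hx hy => by
        rw [LinearMap.comp_apply, braidLin_tmul χ q hx hy, map_smul, braidInvLin_tmul χ q hx hy,
          smul_smul, ← zpow_add₀ hq]
        simp))
    (by
      intro d
      refine tensorPiece_le (p := (tensorPiece Y X d).comap (braidLin χ q X Y))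
        fun a b x y hab hx hy => ?_
      rw [Submodule.mem_comap, braidLin_tmul χ q hx hy]
      exact Submodule.smul_mem _ _ (tmul_mem (by rw [add_comm, hab]) hy hx))
    (by
      intro d
      refine tensorPiece_le (p := (tensorPiece X Y d).comap (braidInvLin χ q X Y))
        fun b a y x hab hy hx => ?_
      rw [Submodule.mem_comap, braidInvLin_tmul χ q hx hy]
      exact Submodule.smul_mem _ _ (tmul_mem (by rw [add_comm, hab]) hx hy))

theorem tensor_ext₃ (X Y Z : GrVect.{v} K) {W : Type*} [AddCommGroup W] [Module ℝ W]
    {f g : (X ⊗[ℝ] Y) ⊗[ℝ] Z →ₗ[ℝ] W}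
    (h : ∀ a b c (x : X) (y : Y) (z : Z), x ∈ X.piece a → y ∈ Y.piece b → z ∈ Z.piece c →
      f ((x ⊗ₜ y) ⊗ₜ z) = g ((x ⊗ₜ y) ⊗ₜ z)) : f = g := by
  refine TensorProduct.ext (tensor_ext X Y fun a b x y hx hy => Z.linearMap_ext fun c z hz => ?_)
  exact h a b c x y z hx hy hz

theorem tensor_ext₃' (X Y Z : GrVect.{v} K) {W : Type*} [AddCommGroup W] [Module ℝ W]
    {f g : X ⊗[ℝ] (Y ⊗[ℝ] Z) →ₗ[ℝ] W}
    (h : ∀ a b c (x : X) (y : Y) (z : Z), x ∈ X.piece a → y ∈ Y.piece b → z ∈ Z.piece c →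
      f (x ⊗ₜ (y ⊗ₜ z)) = g (x ⊗ₜ (y ⊗ₜ z))) : f = g := by
  refine TensorProduct.ext (X.linearMap_ext fun a x hx => tensor_ext Y Z fun b c y z hy hz => ?_)
  exact h a b c x y z hx hy hz

/-- The braided monoidal category of `K`-graded vector spaces, with the braiding
`x ⊗ y ↦ q ^ (-⟨a, b⟩) y ⊗ x` for `x` of degree `a` and `y` of degree `b`. -/
@[reducible]
def braided (χ : K →+ K →+ ℤ) (q : ℝ) (hq : q ≠ 0) : BraidedCategory (GrVect.{v} K) where
  braiding X Y := braidIso χ q hq X Y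
  braiding_naturality_right X Y Z f := hom_ext <| tensor_ext X Y fun a b x y hx hy => by
    change braidLin χ q X Z (x ⊗ₜ f.toLin y) =
      TensorProduct.map f.toLin LinearMap.id (braidLin χ q X Y (x ⊗ₜ y))
    rw [braidLin_tmul χ q hx hy, braidLin_tmul χ q hx (f.map_piece b y hy), map_smul]
    rfl
  braiding_naturality_left {X Y} f Z := hom_ext <| tensor_ext X Z fun a b x z hx hz => by
    change braidLin χ q Y Z (f.toLin x ⊗ₜ z) =
      TensorProduct.map LinearMap.id f.toLin (braidLin χ q X Z (x ⊗ₜ z))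
    rw [braidLin_tmul χ q hx hz, braidLin_tmul χ q (f.map_piece a x hx) hz, map_smul]
    rfl
  hexagon_forward X Y Z := hom_ext <| tensor_ext₃ X Y Z fun a b c x y z hx hy hz => by
    change TensorProduct.assoc ℝ Y Z X (braidLin χ q X (tensor Y Z) (x ⊗ₜ (y ⊗ₜ z))) =
      TensorProduct.map LinearMap.id (braidLin χ q X Z) (TensorProduct.assoc ℝ Y X Z
        (TensorProduct.map (braidLin χ q X Y) LinearMap.id ((x ⊗ₜ y) ⊗ₜ z)))
    rw [braidLin_tmul χ q hx (tmul_mem (X := Y) (Y := Z) rfl hy hz), TensorProduct.map_tmul,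
      braidLin_tmul χ q hx hy, ← TensorProduct.smul_tmul', map_smul, map_smul, map_smul,
      LinearMap.id_apply, TensorProduct.assoc_tmul, TensorProduct.assoc_tmul,
      TensorProduct.map_tmul, braidLin_tmul χ q hx hz,
      TensorProduct.tmul_smul, smul_smul, ← zpow_add₀ hq, map_add, neg_add]
    rfl
  hexagon_reverse X Y Z := hom_ext <| tensor_ext₃' X Y Z fun a b c x y z hx hy hz => by
    change (TensorProduct.assoc ℝ Z X Y).symm (braidLin χ q (tensor X Y) Z ((x ⊗ₜ y) ⊗ₜ z)) =
      TensorProduct.map (braidLin χ q X Z) LinearMap.id ((TensorProduct.assoc ℝ X Z Y).symm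
        (TensorProduct.map LinearMap.id (braidLin χ q Y Z) (x ⊗ₜ (y ⊗ₜ z))))
    rw [braidLin_tmul χ q (tmul_mem (X := X) (Y := Y) rfl hx hy) hz, TensorProduct.map_tmul,
      braidLin_tmul χ q hy hz, TensorProduct.tmul_smul, map_smul, map_smul, map_smul,
      LinearMap.id_apply, TensorProduct.assoc_symm_tmul, TensorProduct.assoc_symm_tmul,
      TensorProduct.map_tmul, braidLin_tmul χ q hx hz,
      ← TensorProduct.smul_tmul', smul_smul, ← zpow_add₀ hq, map_add, AddMonoidHom.add_apply,
      neg_add_rev]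
    rfl

end braiding

/-- The free vector space on a set `S`, each basis element `s` placed in degree `deg s`. -/
def free {K : Type u} {S : Type v} (deg : S → K) : GrVect.{v} K where
  carrier := S →₀ ℝ
  piece d := Finsupp.supported ℝ ℝ (deg ⁻¹' {d})
  indep := by
    refine indep_of_coaction _
      (Finsupp.lsum ℝ fun s => Finsupp.lsingle (deg s) ∘ₗ Finsupp.lsingle s) fun d => ?_
    have : Finsupp.supported ℝ ℝ (deg ⁻¹' {d}) ≤ LinearMap.eqLocus
        (Finsupp.lsum ℝ fun s => Finsupp.lsingle (deg s) ∘ₗ Finsupp.lsingle s)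
        (Finsupp.lsingle d : (S →₀ ℝ) →ₗ[ℝ] K →₀ (S →₀ ℝ)) := by
      rw [Finsupp.supported_eq_span_single, Submodule.span_le]
      rintro _ ⟨s, rfl, rfl⟩
      simp
    exact fun x hx => this hx
  iSup_eq_top := by
    rw [← Finsupp.supported_iUnion, eq_top_iff]
    intro x _
    rw [Finsupp.mem_supported]
    intro s _
    simp

end GrVect

/-! ### Isomorphism classes, the Grothendieck group and Hall numbers -/

/-- Isomorphism classes of objects. -/
abbrev IsoClass (C : Type u) [Category.{v} C] : Type u := Quotient (isIsomorphicSetoid C)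

/-- The isomorphism class of an object. -/
def isoClass {C : Type u} [Category.{v} C] (M : C) : IsoClass C := Quotient.mk _ M

section abelian

variable (C : Type u) [Category.{v} C] [Abelian C]

/-- The relations `[B] = [A] + [C]` for short exact sequences `0 → A → B → C → 0`. -/
def K₀Relations : AddSubgroup (FreeAbelianGroup (IsoClass C)) :=
  AddSubgroup.closure {x | ∃ S : ShortComplex C, S.ShortExact ∧
    x = FreeAbelianGroup.of (isoClass S.X₂) -
      (FreeAbelianGroup.of (isoClass S.X₁) + FreeAbelianGroup.of (isoClass S.X₃))}

/-- The Grothendieck group of an abelian category. -/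
abbrev K₀ : Type u := FreeAbelianGroup (IsoClass C) ⧸ K₀Relations C

variable {C}

/-- The image in the Grothendieck group of an isomorphism class. -/
def K₀.ofClass (x : IsoClass C) : K₀ C := QuotientAddGroup.mk (FreeAbelianGroup.of x)

/-- The image in the Grothendieck group of an object. -/
def K₀.of (M : C) : K₀ C := K₀.ofClass (isoClass M)

/-- The number of pairs `(f, g)` such that `0 → N → E → M → 0` is short exact. -/
def hallP (M N E : C) : ℕ :=
  Nat.card {p : (N ⟶ E) × (E ⟶ M) //
    ∃ w : p.1 ≫ p.2 = 0, (ShortComplex.mk p.1 p.2 w).ShortExact}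

/-- The number of automorphisms. -/
def aut (M : C) : ℕ := Nat.card (Aut M)

variable (C) in
/-- The underlying graded vector space of the Hall algebra: the real vector space on the isomorphism
classes of objects, graded by the Grothendieck group. -/
def hall : GrVect.{u} (K₀ C) := GrVect.free (K₀.ofClass (C := C))

/-- The basis element `[M]` of the Hall algebra. -/
def hallBasis (M : C) : hall C := (Finsupp.single (isoClass M) 1 : IsoClass C →₀ ℝ)

/-- The coefficient of `[E]` in an element of the Hall algebra. -/
def hallCoeff (E : C) : hall C →ₗ[ℝ] ℝ :=
  (Finsupp.lapply (isoClass E) : (IsoClass C →₀ ℝ) →ₗ[ℝ] ℝ)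

/-- The coefficient of `[N] ⊗ [M]` in an element of the tensor square of the Hall algebra. -/
def hallCoeff₂ (N M : C) : (hall C ⊗ hall C : GrVect (K₀ C)) →ₗ[ℝ] ℝ :=
  LinearMap.mul' ℝ ℝ ∘ₗ TensorProduct.map (hallCoeff N) (hallCoeff M)

end abelian

/-! ### Representations of quivers -/

/-- The category of finite-dimensional representations of a quiver over a field `k`: functors from
the free category on the quiver to finite-dimensional vector spaces. -/
abbrev QuiverRep (V : Type v) [Quiver.{w} V] (k : Type u) [Field k] :=
  Paths V ⥤ FGModuleCat.{u} k

instance (V : Type v) [Quiver.{w} V] (k : Type u) [Field k] :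
    HasExt.{max (u + 1) v w} (QuiverRep V k) :=
  HasExt.standard _

/-- The vector space `Ext ^ i (M, N)`, computed in the category of finite-dimensional
representations. -/
abbrev repExt {V : Type v} [Quiver.{w} V] {k : Type u} [Field k] (M N : QuiverRep V k) (i : ℕ) :
    Type (max (u + 1) v w) :=
  Abelian.Ext.{max (u + 1) v w} M N i

/-- The Euler characteristic `dim Hom(M, N) - dim Ext¹(M, N)` of a pair of representations. -/
def eulerChar {V : Type v} [Quiver.{w} V] {k : Type u} [Field k] (M N : QuiverRep V k) : ℤ :=
  ∑ i ∈ Finset.range 2, (-1) ^ i * (Module.finrank k (repExt M N i) : ℤ)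

/-- The connected simply laced Dynkin diagrams: `A n` stands for the diagram with `n + 1` vertices
and `D n` for the one with `n + 4` vertices. -/
inductive ADEType
  | A (n : ℕ)
  | D (n : ℕ)
  | E₆
  | E₇
  | E₈

/-- The number of vertices of the diagram. -/
def ADEType.rank : ADEType → ℕ
  | A n => n + 1
  | D n => n + 4
  | E₆ => 6
  | E₇ => 7
  | E₈ => 8

/-- The Cartan matrix. Distinct vertices `i`, `j` of the diagram are joined by `-cartan i j`
edges. -/
def ADEType.cartan : (t : ADEType) → Matrix (Fin t.rank) (Fin t.rank) ℤ
  | A n => CartanMatrix.A (n + 1)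
  | D n => CartanMatrix.D (n + 4)
  | E₆ => CartanMatrix.E₆
  | E₇ => CartanMatrix.E₇
  | E₈ => CartanMatrix.E₈

/-- The underlying graph of the quiver is a simply laced Dynkin diagram, i.e. a finite disjoint
union of diagrams of type `A`, `D` and `E`. -/
def IsSimplyLacedDynkin (V : Type v) [Quiver.{w} V] : Prop :=
  (∀ a b : V, Finite (a ⟶ b)) ∧ (∀ a : V, IsEmpty (a ⟶ a)) ∧
    ∃ (r : ℕ) (t : Fin r → ADEType) (e : V ≃ Σ i, Fin (t i).rank),
      ∀ a b : V, a ≠ b → (Nat.card (a ⟶ b) + Nat.card (b ⟶ a) : ℤ) =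
        -Matrix.blockDiagonal' (fun i => (t i).cartan) (e a) (e b)

end

noncomputable section

open scoped ENNReal

/-! ### Sums over isomorphism classes, weighted by automorphism groups -/

/-! The substantial axiom is the compatibility of `Δ` with `m`, which in coefficients is Green's
formula. Both of its sides count `3 × 3` diagrams of short exact sequences. A cross is a row `N → E
→ M` and a column `N' → E → M'` through one centre `E`. It determines an outer frame with corners `D
= N ∩ N'`, `X = N / D`, `B = N' / D`, `A = E / (N + N')`, uniquely up to isomorphism of the corners
(`Cross.exists_frame`, `Cross.card_frame`). With isomorphism classes weighted by `1 / |Aut|`, it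
remains to see that the crosses over a fixed frame have total weight `q ^ (-⟨A, D⟩)`, the scalar of
the braiding.

That weight (`QRep.tsum_cross_fits`) is found vertex by vertex. Vector spaces form a semisimple
category, so at a vertex `i` the frame can be filled, the centre is `N_i ⊕ M_i`, and a filling has
`|Hom(A_i, D_i)|` automorphisms fixing the ends (`Frame.card_cross_mul`). Once the fillings are
fixed, the maps `E_i → E_j` allowed along an arrow `i → j` form a torsor under `Hom(A_i, D_j)`
(`Cross.Fits.card_crossMap`). The weight is therefore the product over the arrows of `|Hom(A_i,
D_j)|` divided by the product over the vertices of `|Hom(A_i, D_i)|`, a power of `q` whose exponent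
is bilinear in dimension vectors.

That exponent is minus the Euler form because of the exact sequence `0 → Hom(M, N) → ∏ Hom(M_i, N_i)
→ ∏ Hom(M_i, N_j) → Ext¹(M, N) → 0`: families of maps along the arrows are cocycles of extensions
(`QRep.finrank_hom_sub_finrank_ext`). The same cocycles show that the higher `Ext` vanish
(`QRep.ext_eq_zero`).

Associativity and coassociativity are one count of two-step filtrations (`tsum_hallP_mul_hallP`).
`StructConst` translates all these numerical identities into a bialgebra object. -/

/-- Double counting along a relation between two weighted families of finite types. -/
theorem tsum_card_mul_eq_of_rel {I J : Type*} {Φ : I → Type*} {Ψ : J → Type*}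
    [∀ i, Finite (Φ i)] [∀ j, Finite (Ψ j)] (u : I → ℝ≥0∞) (v c : J → ℝ≥0∞)
    (R : ∀ {i j}, Φ i → Ψ j → Prop)
    (h₁ : ∀ i (φ : Φ i), ∑' j, (Nat.card {ψ : Ψ j // R φ ψ} : ℝ≥0∞) * v j = 1)
    (h₂ : ∀ j (ψ : Ψ j), ∑' i, (Nat.card {φ : Φ i // R φ ψ} : ℝ≥0∞) * u i = c j) :
    ∑' i, (Nat.card (Φ i) : ℝ≥0∞) * u i = ∑' j, (Nat.card (Ψ j) : ℝ≥0∞) * c j * v j := by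
  classical
  have := fun i => Fintype.ofFinite (Φ i)
  have := fun j => Fintype.ofFinite (Ψ j)
  -- For fixed `i`, `j`, both sides count the related pairs.
  have key : ∀ i j, ∑ φ : Φ i, (Nat.card {ψ : Ψ j // R φ ψ} : ℝ≥0∞) =
      ∑ ψ : Ψ j, (Nat.card {φ : Φ i // R φ ψ} : ℝ≥0∞) := by
    intro i j
    simp only [Nat.card_eq_fintype_card, Fintype.card_subtype]
    exact_mod_cast Finset.sum_card_bipartiteAbove_eq_sum_card_bipartiteBelow
      (s := Finset.univ) (t := Finset.univ) (fun (φ : Φ i) (ψ : Ψ j) => R φ ψ)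
  calc ∑' i, (Nat.card (Φ i) : ℝ≥0∞) * u i
      = ∑' i, ∑ φ : Φ i, ∑' j, (Nat.card {ψ : Ψ j // R φ ψ} : ℝ≥0∞) * v j * u i := by
        refine tsum_congr fun i => ?_
        simp only [ENNReal.tsum_mul_right, h₁]
        simp
    _ = ∑' i, ∑' j, (∑ ψ : Ψ j, (Nat.card {φ : Φ i // R φ ψ} : ℝ≥0∞)) * v j * u i := by
        refine tsum_congr fun i => ?_
        rw [← Summable.tsum_finsetSum fun _ _ => ENNReal.summable]
        refine tsum_congr fun j => ?_
        rw [← Finset.sum_mul, ← Finset.sum_mul, key]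
    _ = ∑' j, ∑' i, ∑ ψ : Ψ j, (Nat.card {φ : Φ i // R φ ψ} : ℝ≥0∞) * u i * v j := by
        rw [ENNReal.tsum_comm]
        refine tsum_congr fun j => tsum_congr fun i => ?_
        rw [Finset.sum_mul, Finset.sum_mul]
        exact Finset.sum_congr rfl fun _ _ => mul_right_comm _ _ _
    _ = ∑' j, (Nat.card (Ψ j) : ℝ≥0∞) * c j * v j := by
        refine tsum_congr fun j => ?_
        rw [Summable.tsum_finsetSum fun _ _ => ENNReal.summable]
        simp only [ENNReal.tsum_mul_right, h₂]
        simp [mul_assoc]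

section isoSum

variable {C : Type u} [Category.{v} C]

theorem isoClass_out (x : IsoClass C) : isoClass x.out = x := Quotient.out_eq x

theorem isoClass_eq_iff {X Y : C} : isoClass X = isoClass Y ↔ Nonempty (X ≅ Y) := Quotient.eq

theorem nonempty_iso_out (X : C) : Nonempty ((isoClass X).out ≅ X) :=
  isoClass_eq_iff.1 (isoClass_out _)

/-- The weight `1 / |Aut X|` of an isomorphism class. -/
def autWeight (x : IsoClass C) : ℝ≥0∞ := (aut x.out : ℝ≥0∞)⁻¹

theorem card_iso_congr {X Y Z : C} (e : X ≅ Y) : Nat.card (Z ≅ X) = Nat.card (Z ≅ Y) :=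
  Nat.card_congr ⟨fun f => f ≪≫ e, fun f => f ≪≫ e.symm, fun f => by simp, fun f => by simp⟩

theorem aut_congr {X Y : C} (e : X ≅ Y) : aut X = aut Y :=
  Nat.card_congr (Aut.autMulEquivOfIso e).toEquiv

theorem card_iso_eq_aut {X Y : C} (e : X ≅ Y) : Nat.card (X ≅ Y) = aut X :=
  (card_iso_congr e).symm

variable [∀ X Y : C, Finite (X ⟶ Y)]

instance (X Y : C) : Finite (X ≅ Y) :=
  Finite.of_injective (fun e : X ≅ Y => e.hom) fun _ _ h => Iso.ext h

theorem aut_pos (X : C) : 0 < aut X := by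
  have : Finite (Aut X) := inferInstanceAs (Finite (X ≅ X))
  exact Nat.card_pos

/-- Only the class of `X` contributes, and there the number of isomorphisms cancels the weight.
Hence a structure that is unique up to a torsor of isomorphisms has total weight one, which is how
all choices of middle terms are summed below. With values in `ℝ≥0∞`, sums can be interchanged
without summability conditions. -/
theorem tsum_card_iso_mul (X : C) (F : IsoClass C → ℝ≥0∞) :
    ∑' y : IsoClass C, (Nat.card (X ≅ y.out) : ℝ≥0∞) * F y * autWeight y = F (isoClass X) := by
  rw [tsum_eq_single (isoClass X)]
  · obtain ⟨e⟩ := nonempty_iso_out X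
    rw [card_iso_eq_aut e.symm, aut_congr e.symm, autWeight, mul_right_comm,
      ENNReal.mul_inv_cancel (by exact_mod_cast (aut_pos _).ne') (ENNReal.natCast_ne_top _),
      one_mul]
  · intro y hy
    have : IsEmpty (X ≅ y.out) :=
      ⟨fun e => hy (by rw [isoClass_eq_iff.2 ⟨e⟩, isoClass_out])⟩
    simp

theorem tsum_card_iso (X : C) :
    ∑' y : IsoClass C, (Nat.card (X ≅ y.out) : ℝ≥0∞) * autWeight y = 1 := by
  simpa using tsum_card_iso_mul X (fun _ => 1)

end isoSum

end

noncomputable section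

open scoped ENNReal
open Limits

/-! ### Short exact pairs of morphisms -/

section abelian

variable {C : Type u} [Category.{v} C] [Abelian C]

/-- The pair `0 → N → E → M → 0` is short exact. -/
def IsSes {N E M : C} (f : N ⟶ E) (g : E ⟶ M) : Prop :=
  ∃ w : f ≫ g = 0, (ShortComplex.mk f g w).ShortExact

namespace IsSes

variable {N E M : C} {f : N ⟶ E} {g : E ⟶ M}

theorem zero (h : IsSes f g) : f ≫ g = 0 := h.1

theorem mono (h : IsSes f g) : Mono f := h.2.mono_f

theorem epi (h : IsSes f g) : Epi g := h.2.epi_g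

theorem exists_lift (h : IsSes f g) {T : C} (t : T ⟶ E) (ht : t ≫ g = 0) : ∃ u, u ≫ f = t :=
  have := h.mono
  ⟨h.2.exact.lift t ht, h.2.exact.lift_f t ht⟩

theorem exists_desc (h : IsSes f g) {T : C} (t : E ⟶ T) (ht : f ≫ t = 0) : ∃ u, g ≫ u = t :=
  have := h.epi
  ⟨h.2.exact.desc t ht, h.2.exact.g_desc t ht⟩

/-- Lifts along a mono are unique, so their existence already makes `f` a kernel of `g`. Together
with the dual `of_desc`, this lets each exactness proof use the more convenient universal property.
-/
theorem of_lift (w : f ≫ g = 0) (hf : Mono f) (hg : Epi g)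
    (h : ∀ {T : C} (t : T ⟶ E), t ≫ g = 0 → ∃ u, u ≫ f = t) : IsSes f g :=
  ⟨w, { exact := ShortComplex.exact_of_f_is_kernel _
          (KernelFork.IsLimit.ofι' f w fun t ht => ⟨(h t ht).choose, (h t ht).choose_spec⟩)
        mono_f := hf
        epi_g := hg }⟩

theorem of_desc (w : f ≫ g = 0) (hf : Mono f) (hg : Epi g)
    (h : ∀ {T : C} (t : E ⟶ T), f ≫ t = 0 → ∃ u, g ≫ u = t) : IsSes f g :=
  ⟨w, { exact := ShortComplex.exact_of_g_is_cokernel _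
          (CokernelCofork.IsColimit.ofπ' g w fun t ht => ⟨(h t ht).choose, (h t ht).choose_spec⟩)
        mono_f := hf
        epi_g := hg }⟩

theorem kernel (g : E ⟶ M) [Epi g] : IsSes (kernel.ι g) g :=
  of_lift (kernel.condition g) inferInstance inferInstance
    fun t ht => ⟨kernel.lift g t ht, kernel.lift_ι g t ht⟩

theorem cokernel (f : N ⟶ E) [Mono f] : IsSes f (cokernel.π f) :=
  of_desc (cokernel.condition f) inferInstance inferInstance
    fun t ht => ⟨cokernel.desc f t ht, cokernel.π_desc f t ht⟩

theorem iso_left (h : IsSes f g) {N' : C} (e : N' ≅ N) : IsSes (e.hom ≫ f) g :=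
  have := h.mono
  of_lift (by simp [h.zero]) inferInstance h.epi fun t ht => by
    obtain ⟨u, rfl⟩ := h.exists_lift t ht
    exact ⟨u ≫ e.inv, by simp⟩

theorem iso_right (h : IsSes f g) {M' : C} (e : M ≅ M') : IsSes f (g ≫ e.hom) :=
  have := h.epi
  of_desc (by simp [reassoc_of% h.zero]) h.mono inferInstance fun t ht => by
    obtain ⟨u, rfl⟩ := h.exists_desc t ht
    exact ⟨e.inv ≫ u, by simp⟩

theorem iso_mid (h : IsSes f g) {E' : C} (e : E ≅ E') : IsSes (f ≫ e.hom) (e.inv ≫ g) :=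
  have := h.mono
  have := h.epi
  of_lift (by simp [h.zero]) inferInstance inferInstance fun t ht => by
    obtain ⟨u, hu⟩ := h.exists_lift (t ≫ e.inv) (by simpa using ht)
    exact ⟨u, by simp [reassoc_of% hu]⟩

theorem exists_iso_left (h : IsSes f g) {N' : C} {f' : N' ⟶ E} (h' : IsSes f' g) :
    ∃ e : N ≅ N', e.hom ≫ f' = f := by
  have := h.mono
  have := h'.mono
  obtain ⟨u, hu⟩ := h'.exists_lift f h.zero
  obtain ⟨u', hu'⟩ := h.exists_lift f' h'.zero
  exact ⟨⟨u, u', by simp [← cancel_mono f, hu', hu], by simp [← cancel_mono f', hu', hu]⟩, hu⟩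

theorem exists_iso_right (h : IsSes f g) {M' : C} {g' : E ⟶ M'} (h' : IsSes f g') :
    ∃ e : M ≅ M', g ≫ e.hom = g' := by
  have := h.epi
  have := h'.epi
  obtain ⟨u, hu⟩ := h.exists_desc g' h'.zero
  obtain ⟨u', hu'⟩ := h'.exists_desc g h.zero
  exact ⟨⟨u, u', by simp [← cancel_epi g, reassoc_of% hu, hu'],
    by simp [← cancel_epi g', reassoc_of% hu', hu]⟩, hu⟩

end IsSes

/-- The type of short exact pairs `0 → N → E → M → 0`. -/
abbrev Ses (N E M : C) := {p : (N ⟶ E) × (E ⟶ M) // IsSes p.1 p.2}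

theorem hallP_eq (M N E : C) : hallP M N E = Nat.card (Ses N E M) := rfl

theorem card_ses_congr {N N' E E' M M' : C} (a : N ≅ N') (b : E ≅ E') (c : M ≅ M') :
    Nat.card (Ses N E M) = Nat.card (Ses N' E' M') :=
  Nat.card_congr
    { toFun := fun s => ⟨(a.inv ≫ s.1.1 ≫ b.hom, b.inv ≫ s.1.2 ≫ c.hom), by
        simpa using ((s.2.iso_mid b).iso_left a.symm).iso_right c⟩
      invFun := fun s => ⟨(a.hom ≫ s.1.1 ≫ b.inv, b.hom ≫ s.1.2 ≫ c.inv), by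
        simpa using ((s.2.iso_mid b.symm).iso_left a).iso_right c.symm⟩
      left_inv := fun s => by ext <;> simp
      right_inv := fun s => by ext <;> simp }

theorem hallP_congr {N N' E E' M M' : C} (c : M ≅ M') (a : N ≅ N') (b : E ≅ E') :
    hallP M N E = hallP M' N' E' :=
  card_ses_congr a b c

/-! ### Associativity -/

section assoc

variable {L M N E : C}

/-- A filtration of `E` with quotients `L`, `M`, `N`, seen from the quotient `X` and from the
subobject `Y`. -/
def FiltRel {X Y : C} (φ : Ses M X L × Ses N E X) (ψ : Ses N Y M × Ses Y E L) : Prop :=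
  ψ.1.1.1 ≫ ψ.2.1.1 = φ.2.1.1 ∧ φ.2.1.2 ≫ φ.1.1.2 = ψ.2.1.2 ∧
    ψ.1.1.2 ≫ φ.1.1.1 = ψ.2.1.1 ≫ φ.2.1.2

/-- `Y` is the preimage in `E` of the subobject `M` of `X`, constructed as the kernel of `E → X →
L`. -/
theorem exists_filtRel_right {X : C} (φ : Ses M X L × Ses N E X) :
    ∃ (Y : C) (ψ : Ses N Y M × Ses Y E L), FiltRel φ ψ := by
  obtain ⟨⟨⟨i, p⟩, h₁⟩, ⟨⟨n, π⟩, h₂⟩⟩ := φ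
  dsimp only at h₁ h₂
  have := h₁.mono
  have := h₁.epi
  have := h₂.mono
  have := h₂.epi
  have hj := IsSes.kernel (π ≫ p)
  set j := kernel.ι (π ≫ p)
  have := hj.mono
  obtain ⟨n', hn⟩ := hj.exists_lift n (by simp [reassoc_of% h₂.zero])
  obtain ⟨s, hs⟩ := h₁.exists_lift (j ≫ π) (by simpa using hj.zero)
  refine ⟨_, (⟨(n', s), IsSes.of_lift ?_ ?_ ?_ ?_⟩, ⟨(j, π ≫ p), hj⟩), hn, rfl, hs⟩
  · rw [← cancel_mono i, Category.assoc, hs, reassoc_of% hn, h₂.zero, zero_comp]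
  · exact mono_of_mono_fac hn
  · rw [epi_iff_surjective_up_to_refinements]
    intro A y
    -- A generalized element of `M`, seen in `X`, lifts to `E` after a refinement. The lift dies in
    -- `L`, hence lies in `Y`.
    obtain ⟨A', a, ha, x, hx⟩ := surjective_up_to_refinements_of_epi π (y ≫ i)
    obtain ⟨x', hx'⟩ := hj.exists_lift x (by simp [← reassoc_of% hx, h₁.zero])
    refine ⟨A', a, ha, x', ?_⟩
    rw [← cancel_mono i, Category.assoc, Category.assoc, hs, reassoc_of% hx', hx]
  · intro T t ht
    obtain ⟨u, hu⟩ := h₂.exists_lift (t ≫ j) (by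
      rw [Category.assoc, ← hs, reassoc_of% ht, zero_comp])
    exact ⟨u, by rw [← cancel_mono j, Category.assoc, hn, hu]⟩

/-- `X` is the quotient of `E` by `N`, embedded through `Y`. -/
theorem exists_filtRel_left {Y : C} (ψ : Ses N Y M × Ses Y E L) :
    ∃ (X : C) (φ : Ses M X L × Ses N E X), FiltRel φ ψ := by
  obtain ⟨⟨⟨n', s⟩, h₁⟩, ⟨⟨j, l⟩, h₂⟩⟩ := ψ
  dsimp only at h₁ h₂
  have := h₁.mono
  have := h₁.epi
  have := h₂.mono
  have := h₂.epi
  have hπ := IsSes.cokernel (n' ≫ j)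
  set π := cokernel.π (n' ≫ j)
  have := hπ.epi
  obtain ⟨p, hp⟩ := hπ.exists_desc l (by simp [h₂.zero])
  obtain ⟨i, hi⟩ := h₁.exists_desc (j ≫ π) (by simpa using hπ.zero)
  refine ⟨_, (⟨(i, p), IsSes.of_desc ?_ ?_ ?_ ?_⟩, ⟨(n' ≫ j, π), hπ⟩), rfl, hp, hi⟩
  · rw [← cancel_epi s, reassoc_of% hi, hp, h₂.zero, comp_zero]
  · refine Preadditive.mono_of_cancel_zero _ fun t ht => ?_
    obtain ⟨A', a, ha, y, hy⟩ := surjective_up_to_refinements_of_epi s t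
    obtain ⟨u, hu⟩ := hπ.exists_lift (y ≫ j) (by
      rw [Category.assoc, ← hi, ← reassoc_of% hy, ht, comp_zero])
    have hu' : u ≫ n' = y := by rw [← cancel_mono j, Category.assoc, hu]
    rw [← cancel_epi a, hy, ← hu', Category.assoc, h₁.zero, comp_zero, comp_zero]
  · exact epi_of_epi_fac hp
  · intro T t ht
    obtain ⟨u, hu⟩ := h₂.exists_desc (π ≫ t) (by
      rw [← reassoc_of% hi, ht, comp_zero])
    exact ⟨u, by rw [← cancel_epi π, reassoc_of% hp, hu]⟩

/-- The relation forces `Y → E` to be a kernel of `E → X → L`, and the two maps of `N → Y → M` are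
then determined by cancelling the monos `Y → E` and `M → X`. So the only freedom is an isomorphism
from `Y₀` to `Y`. -/
theorem card_filtRel_right {X Y₀ : C} (φ : Ses M X L × Ses N E X) (ψ₀ : Ses N Y₀ M × Ses Y₀ E L)
    (h₀ : FiltRel φ ψ₀) (Y : C) :
    Nat.card {ψ : Ses N Y M × Ses Y E L // FiltRel φ ψ} = Nat.card (Y₀ ≅ Y) := by
  obtain ⟨⟨⟨i, p⟩, h₁⟩, ⟨⟨n, π⟩, h₂⟩⟩ := φ
  obtain ⟨⟨⟨n', s⟩, h₁'⟩, ⟨⟨j, l⟩, h₂'⟩⟩ := ψ₀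
  obtain ⟨e₁, e₂, e₃⟩ := h₀
  dsimp only at h₁ h₂ h₁' h₂' e₁ e₂ e₃
  have := h₁.mono
  have := h₂'.mono
  refine (Nat.card_congr (Equiv.ofBijective (fun e : Y₀ ≅ Y =>
    ⟨(⟨(n' ≫ e.hom, e.inv ≫ s), h₁'.iso_mid e⟩, ⟨(e.inv ≫ j, l), h₂'.iso_left e.symm⟩),
      by simp [e₁], e₂, by simp [e₃]⟩) ⟨fun e e' hee => ?_, ?_⟩)).symm
  · have : e.inv ≫ j = e'.inv ≫ j := congrArg (fun x => x.1.2.1.1) hee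
    rw [cancel_mono] at this
    exact (Iso.symm_eq_iff).1 (Iso.ext this)
  · rintro ⟨⟨⟨⟨n'', s'⟩, h₁''⟩, ⟨⟨j', l'⟩, h₂''⟩⟩, e₁', e₂', e₃'⟩
    dsimp only at h₁'' h₂'' e₁' e₂' e₃'
    obtain rfl : l = l' := e₂.symm.trans e₂'
    obtain ⟨e, he⟩ := h₂''.exists_iso_left h₂'
    have := h₂''.mono
    refine ⟨e.symm, ?_⟩
    have a₁ : n' ≫ e.inv = n'' := by
      rw [← cancel_mono j', Category.assoc, ← he, e.inv_hom_id_assoc, e₁, he, e₁']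
    have a₂ : e.hom ≫ s = s' := by
      rw [← cancel_mono i, Category.assoc, e₃, reassoc_of% he, e₃']
    ext <;> simp [a₁, a₂, he]

/-- Dually, `E → X` must be a cokernel of `N → E`, and the maps `M → X → L` follow by cancelling
epis. -/
theorem card_filtRel_left {Y X₀ : C} (ψ : Ses N Y M × Ses Y E L) (φ₀ : Ses M X₀ L × Ses N E X₀)
    (h₀ : FiltRel φ₀ ψ) (X : C) :
    Nat.card {φ : Ses M X L × Ses N E X // FiltRel φ ψ} = Nat.card (X₀ ≅ X) := by
  obtain ⟨⟨⟨n', s⟩, h₁'⟩, ⟨⟨j, l⟩, h₂'⟩⟩ := ψ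
  obtain ⟨⟨⟨i, p⟩, h₁⟩, ⟨⟨n, π⟩, h₂⟩⟩ := φ₀
  obtain ⟨e₁, e₂, e₃⟩ := h₀
  dsimp only at h₁ h₂ h₁' h₂' e₁ e₂ e₃
  have := h₂.epi
  have := h₁'.epi
  refine (Nat.card_congr (Equiv.ofBijective (fun e : X₀ ≅ X =>
    ⟨(⟨(i ≫ e.hom, e.inv ≫ p), h₁.iso_mid e⟩, ⟨(n, π ≫ e.hom), h₂.iso_right e⟩),
      e₁, by simp [e₂], by simp [reassoc_of% e₃]⟩) ⟨fun e e' hee => ?_, ?_⟩)).symm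
  · have : π ≫ e.hom = π ≫ e'.hom := congrArg (fun x => x.1.2.1.2) hee
    rw [cancel_epi] at this
    exact Iso.ext this
  · rintro ⟨⟨⟨⟨i', p'⟩, h₁''⟩, ⟨⟨n'', π'⟩, h₂''⟩⟩, e₁', e₂', e₃'⟩
    dsimp only at h₁'' h₂'' e₁' e₂' e₃'
    obtain rfl : n = n'' := e₁.symm.trans e₁'
    obtain ⟨e, he⟩ := h₂.exists_iso_right h₂''
    have := h₂''.epi
    refine ⟨e, ?_⟩
    have a₁ : i ≫ e.hom = i' := by
      rw [← cancel_epi s, reassoc_of% e₃, he, e₃']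
    have a₂ : e.inv ≫ p = p' := by
      rw [← cancel_epi π', e₂', ← he, Category.assoc, e.hom_inv_id_assoc, e₂]
    ext <;> simp [a₁, a₂, he]

variable [∀ X Y : C, Finite (X ⟶ Y)]

variable (L M N E) in
-- Both sides are the weighted count of two-step filtrations of `E` with quotients `N`, `M`, `L`
-- from the bottom up. The left side records the quotient `X = E / N`, the right side the subobject
-- `Y`, and each determines the other up to isomorphism.
theorem tsum_hallP_mul_hallP :
    ∑' x : IsoClass C, ((hallP L M x.out * hallP x.out N E : ℕ) : ℝ≥0∞) * autWeight x =
      ∑' y : IsoClass C, ((hallP M N y.out * hallP L y.out E : ℕ) : ℝ≥0∞) * autWeight y := by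
  simp only [hallP_eq, ← Nat.card_prod]
  rw [tsum_card_mul_eq_of_rel (I := IsoClass C) (J := IsoClass C)
    (Φ := fun x => Ses M x.out L × Ses N E x.out) (Ψ := fun y => Ses N y.out M × Ses y.out E L)
    autWeight autWeight (fun _ => 1) FiltRel]
  · simp
  · intro x φ
    obtain ⟨Y, ψ, h⟩ := exists_filtRel_right φ
    simp only [card_filtRel_right φ ψ h, tsum_card_iso]
  · intro x φ
    obtain ⟨Y, ψ, h⟩ := exists_filtRel_left φ
    simp only [card_filtRel_left φ ψ h, tsum_card_iso]

end assoc

end abelian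

end

noncomputable section

open scoped ENNReal
open Limits

/-! ### Crosses of short exact sequences and their frames -/

section frames

variable {C : Type u} [Category.{v} C] [Abelian C]

/-- The outer square of a `3 × 3` diagram of short exact sequences whose middle row has end terms
`N`, `M` and whose middle column has end terms `N'`, `M'`. -/
structure Frame (M N M' N' A B X D : C) where
  b : B ⟶ M
  a : M ⟶ A
  d : D ⟶ N
  c : N ⟶ X
  d' : D ⟶ N'
  b' : N' ⟶ B
  c' : X ⟶ M'
  a' : M' ⟶ A
  ba : IsSes b a
  dc : IsSes d c
  db' : IsSes d' b'
  ca' : IsSes c' a'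

attribute [ext] Frame

/-- The middle row and the middle column of a `3 × 3` diagram of short exact sequences. -/
structure Cross (M N M' N' E : C) where
  f : N ⟶ E
  g : E ⟶ M
  f' : N' ⟶ E
  g' : E ⟶ M'
  fg : IsSes f g
  fg' : IsSes f' g'

attribute [ext] Cross

variable {M N M' N' : C}

/-- The frame `F` and the cross `K` fit into a `3 × 3` diagram. -/
structure Cross.Fits {E A B X D : C} (K : Cross M N M' N' E) (F : Frame M N M' N' A B X D) :
    Prop where
  dd : F.d ≫ K.f = F.d' ≫ K.f'
  aa : K.g ≫ F.a = K.g' ≫ F.a'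
  cc : K.f ≫ K.g' = F.c ≫ F.c'
  bb : K.f' ≫ K.g = F.b' ≫ F.b

/-- Frames as quadruples of short exact pairs. -/
def frameEquiv (M N M' N' A B X D : C) :
    Frame M N M' N' A B X D ≃ (Ses B M A × Ses D N X) × (Ses D N' B × Ses X M' A) where
  toFun F := ((⟨(F.b, F.a), F.ba⟩, ⟨(F.d, F.c), F.dc⟩), (⟨(F.d', F.b'), F.db'⟩,
    ⟨(F.c', F.a'), F.ca'⟩))
  invFun p := ⟨p.1.1.1.1, p.1.1.1.2, p.1.2.1.1, p.1.2.1.2, p.2.1.1.1, p.2.1.1.2, p.2.2.1.1,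
    p.2.2.1.2, p.1.1.2, p.1.2.2, p.2.1.2, p.2.2.2⟩
  left_inv _ := rfl
  right_inv _ := rfl

/-- Crosses as pairs of short exact pairs. -/
def crossEquiv (M N M' N' E : C) : Cross M N M' N' E ≃ Ses N E M × Ses N' E M' where
  toFun K := (⟨(K.f, K.g), K.fg⟩, ⟨(K.f', K.g'), K.fg'⟩)
  invFun p := ⟨p.1.1.1, p.1.1.2, p.2.1.1, p.2.1.2, p.1.2, p.2.2⟩
  left_inv _ := rfl
  right_inv _ := rfl

/-- `X` is the image of `N → M'` and `B` the image of `N' → M`. `D`, the kernel of `N → X`, is the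
intersection of `N` and `N'`; `A`, the cokernel of `X → M'`, is `E / (N + N')`. -/
theorem Cross.exists_frame {E : C} (K : Cross M N M' N' E) :
    ∃ (A B X D : C) (F : Frame M N M' N' A B X D), K.Fits F := by
  obtain ⟨f, g, f', g', h, h'⟩ := K
  have := h.mono
  have := h.epi
  have := h'.mono
  have := h'.epi
  obtain ⟨X, c, c', hc, hc', e⟩ : ∃ (X : C) (c : N ⟶ X) (c' : X ⟶ M'), Epi c ∧ Mono c' ∧
      c ≫ c' = f ≫ g' :=
    ⟨_, factorThruImage (f ≫ g'), image.ι (f ≫ g'), inferInstance, inferInstance,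
      image.fac (f ≫ g')⟩
  obtain ⟨B, b', b, hb', hb, e'⟩ : ∃ (B : C) (b' : N' ⟶ B) (b : B ⟶ M), Epi b' ∧ Mono b ∧
      b' ≫ b = f' ≫ g :=
    ⟨_, factorThruImage (f' ≫ g), image.ι (f' ≫ g), inferInstance, inferInstance,
      image.fac (f' ≫ g)⟩
  have hdc := IsSes.kernel c
  set d := kernel.ι c
  have hca := IsSes.cokernel c'
  set a' := cokernel.π c'
  have := hdc.mono
  have := hca.epi
  obtain ⟨d', hd'⟩ := h'.exists_lift (d ≫ f) (by
    rw [Category.assoc, ← e, reassoc_of% hdc.zero, zero_comp])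
  obtain ⟨a, ha⟩ := h.exists_desc (g' ≫ a') (by
    rw [← reassoc_of% e, hca.zero, comp_zero])
  refine ⟨_, _, _, _, ⟨b, a, d, c, d', b', c', a', IsSes.of_desc ?_ hb ?_ ?_, hdc,
    IsSes.of_lift ?_ ?_ hb' ?_, hca⟩, ⟨hd'.symm, ha, e.symm, e'.symm⟩⟩
  · rw [← cancel_epi b', reassoc_of% e', ha, reassoc_of% h'.zero, zero_comp, comp_zero]
  · have : Epi (g ≫ a) := ha ▸ inferInstance
    exact epi_of_epi g a
  · intro T t ht
    obtain ⟨u, hu⟩ := h'.exists_desc (g ≫ t) (by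
      rw [← reassoc_of% e', ht, comp_zero])
    obtain ⟨z, hz⟩ := hca.exists_desc u (by
      rw [← cancel_epi c, reassoc_of% e, hu, reassoc_of% h.zero, zero_comp, comp_zero])
    exact ⟨z, by rw [← cancel_epi g, reassoc_of% ha, hz, hu]⟩
  · rw [← cancel_mono b, Category.assoc, e', reassoc_of% hd', h.zero, comp_zero, zero_comp]
  · have : Mono (d' ≫ f') := hd' ▸ inferInstance
    exact mono_of_mono d' f'
  · intro T t ht
    obtain ⟨u, hu⟩ := h.exists_lift (t ≫ f') (by
      rw [Category.assoc, ← e', reassoc_of% ht, zero_comp])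
    obtain ⟨z, hz⟩ := hdc.exists_lift u (by
      rw [← cancel_mono c', Category.assoc, e, reassoc_of% hu, h'.zero, comp_zero, zero_comp])
    exact ⟨z, by rw [← cancel_mono f', Category.assoc, hd', reassoc_of% hz, hu]⟩

/-- The corners are images, a kernel and a cokernel attached to the cross, so two frames differ by a
unique quadruple of isomorphisms of corners. -/
theorem Cross.card_frame {E A₀ B₀ X₀ D₀ : C} (K : Cross M N M' N' E)
    (F₀ : Frame M N M' N' A₀ B₀ X₀ D₀) (h₀ : K.Fits F₀) (A B X D : C) :
    Nat.card {F : Frame M N M' N' A B X D // K.Fits F} =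
      Nat.card (A₀ ≅ A) * Nat.card (B₀ ≅ B) * Nat.card (X₀ ≅ X) * Nat.card (D₀ ≅ D) := by
  simp only [← Nat.card_prod]
  have := F₀.ba.mono
  have := F₀.dc.epi
  have := F₀.dc.mono
  have := F₀.db'.epi
  have := F₀.ca'.mono
  have := F₀.ca'.epi
  have := K.fg'.mono
  have := K.fg.epi
  refine (Nat.card_congr (Equiv.ofBijective
    (fun e : (((A₀ ≅ A) × (B₀ ≅ B)) × (X₀ ≅ X)) × (D₀ ≅ D) =>
    ⟨⟨e.1.1.2.inv ≫ F₀.b, F₀.a ≫ e.1.1.1.hom, e.2.inv ≫ F₀.d, F₀.c ≫ e.1.2.hom,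
      e.2.inv ≫ F₀.d', F₀.b' ≫ e.1.1.2.hom, e.1.2.inv ≫ F₀.c', F₀.a' ≫ e.1.1.1.hom,
      (F₀.ba.iso_left e.1.1.2.symm).iso_right e.1.1.1,
      (F₀.dc.iso_left e.2.symm).iso_right e.1.2,
      (F₀.db'.iso_left e.2.symm).iso_right e.1.1.2,
      (F₀.ca'.iso_left e.1.2.symm).iso_right e.1.1.1⟩,
      by simp [h₀.dd], by simp [reassoc_of% h₀.aa], by simp [h₀.cc], by simp [h₀.bb]⟩)
    ⟨fun e e' hee => ?_, ?_⟩)).symm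
  · have h₁ := congrArg (fun F => F.1.a') hee
    have h₂ := congrArg (fun F => F.1.b') hee
    have h₃ := congrArg (fun F => F.1.c) hee
    have h₄ := congrArg (fun F => F.1.d) hee
    dsimp only at h₁ h₂ h₃ h₄
    rw [cancel_epi] at h₁ h₂ h₃
    rw [cancel_mono] at h₄
    exact Prod.ext (Prod.ext (Prod.ext (Iso.ext h₁) (Iso.ext h₂)) (Iso.ext h₃))
      ((Iso.symm_eq_iff).1 (Iso.ext h₄))
  · rintro ⟨F, h⟩
    have := F.ca'.mono
    have := F.dc.epi
    -- Both `c ≫ c'` equal the map `N → E → M'`. Since each `c'` is mono, the two maps `c` have the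
    -- same kernel; since each `c` is epi, the two maps `c'` have the same cokernel.
    have hk : IsSes F.d F₀.c := by
      have e : F.c ≫ F.c' = F₀.c ≫ F₀.c' := h.cc.symm.trans h₀.cc
      refine IsSes.of_lift ?_ F.dc.mono inferInstance fun t ht => F.dc.exists_lift t ?_
      · rw [← cancel_mono F₀.c', Category.assoc, ← e, reassoc_of% F.dc.zero, zero_comp, zero_comp]
      · rw [← cancel_mono F.c', Category.assoc, e, reassoc_of% ht, zero_comp, zero_comp]
    have hk' : IsSes F₀.c' F.a' := by
      have e : F.c ≫ F.c' = F₀.c ≫ F₀.c' := h.cc.symm.trans h₀.cc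
      refine IsSes.of_desc ?_ inferInstance F.ca'.epi fun t ht => F.ca'.exists_desc t ?_
      · rw [← cancel_epi F₀.c, ← reassoc_of% e, F.ca'.zero, comp_zero, comp_zero]
      · rw [← cancel_epi F.c, reassoc_of% e, ht, comp_zero, comp_zero]
    obtain ⟨eD, hD⟩ := F₀.dc.exists_iso_left hk
    obtain ⟨eA, hA⟩ := F₀.ca'.exists_iso_right hk'
    have hD' : eD.hom ≫ F.d' = F₀.d' := by
      rw [← cancel_mono K.f', Category.assoc, ← h.dd, reassoc_of% hD, h₀.dd]
    have hA' : F₀.a ≫ eA.hom = F.a := by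
      rw [← cancel_epi K.g, reassoc_of% h₀.aa, hA, h.aa]
    -- After identifying the corners `D`, the objects `X` and `B` are cokernels of the same maps out
    -- of `D`.
    have hc : IsSes F₀.d F.c := hD ▸ F.dc.iso_left eD
    have hb : IsSes F₀.d' F.b' := hD' ▸ F.db'.iso_left eD
    obtain ⟨eX, hX⟩ := F₀.dc.exists_iso_right hc
    obtain ⟨eB, hB⟩ := F₀.db'.exists_iso_right hb
    have hX' : eX.inv ≫ F₀.c' = F.c' := by
      rw [← cancel_epi F.c, ← h.cc, h₀.cc, ← hX, Category.assoc, eX.hom_inv_id_assoc]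
    have := F.db'.epi
    have hB' : eB.inv ≫ F₀.b = F.b := by
      rw [← cancel_epi F.b', ← h.bb, h₀.bb, ← hB, Category.assoc, eB.hom_inv_id_assoc]
    refine ⟨(((eA, eB), eX), eD), ?_⟩
    apply Subtype.ext
    ext <;> simp [hA, hA', hX, hX', hB, hB', ← hD, ← hD']

variable [∀ X Y : C, Finite (X ⟶ Y)]

instance (M N M' N' A B X D : C) : Finite (Frame M N M' N' A B X D) :=
  Finite.of_equiv _ (frameEquiv M N M' N' A B X D).symm

instance (M N M' N' E : C) : Finite (Cross M N M' N' E) :=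
  Finite.of_equiv _ (crossEquiv M N M' N' E).symm

theorem Cross.tsum_frame {E : C} (K : Cross M N M' N' E) :
    ∑' p : ((IsoClass C × IsoClass C) × IsoClass C) × IsoClass C,
      (Nat.card {F : Frame M N M' N' p.1.1.1.out p.1.1.2.out p.1.2.out p.2.out // K.Fits F} :
        ℝ≥0∞) * (autWeight p.1.1.1 * autWeight p.1.1.2 * autWeight p.1.2 * autWeight p.2) = 1 := by
  obtain ⟨A, B, X, D, F, h⟩ := K.exists_frame
  simp only [K.card_frame F h]
  have key : ∀ {α β : Type u} (s : α → ℝ≥0∞) (t : β → ℝ≥0∞), ∑' a, s a = 1 → ∑' b, t b = 1 →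
      ∑' p : α × β, s p.1 * t p.2 = 1 := by
    intro α β s t hs ht
    rw [ENNReal.tsum_prod (f := fun a b => s a * t b)]
    simp [ENNReal.tsum_mul_left, hs, ht]
  rw [← key _ _ (key _ _ (key _ _ (tsum_card_iso A) (tsum_card_iso B)) (tsum_card_iso X))
    (tsum_card_iso D)]
  refine tsum_congr fun p => ?_
  push_cast
  ring

/-- If the weighted number of crosses that fit a frame depends only on the terms `A`, `D` of the
frame, the crosses can be counted by frames. -/
theorem tsum_cross (c : C → C → ℝ≥0∞)
    (hc : ∀ {A B X D : C} (F : Frame M N M' N' A B X D),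
      ∑' e : IsoClass C, (Nat.card {K : Cross M N M' N' e.out // K.Fits F} : ℝ≥0∞) * autWeight e =
        c A D) :
    ∑' e : IsoClass C, ((hallP M N e.out * hallP M' N' e.out : ℕ) : ℝ≥0∞) * autWeight e =
      ∑' p : ((IsoClass C × IsoClass C) × IsoClass C) × IsoClass C,
        ((hallP p.1.1.1.out p.1.1.2.out M * hallP p.1.2.out p.2.out N *
          (hallP p.1.1.2.out p.2.out N' * hallP p.1.1.1.out p.1.2.out M') : ℕ) : ℝ≥0∞) *
          c p.1.1.1.out p.2.out *
          (autWeight p.1.1.1 * autWeight p.1.1.2 * autWeight p.1.2 * autWeight p.2) := by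
  simp only [hallP_eq, ← Nat.card_prod, ← Nat.card_congr (crossEquiv _ _ _ _ _),
    ← Nat.card_congr (frameEquiv _ _ _ _ _ _ _ _)]
  exact tsum_card_mul_eq_of_rel (I := IsoClass C)
    (J := ((IsoClass C × IsoClass C) × IsoClass C) × IsoClass C)
    (Φ := fun e => Cross M N M' N' e.out)
    (Ψ := fun p => Frame M N M' N' p.1.1.1.out p.1.1.2.out p.1.2.out p.2.out)
    autWeight (fun p => autWeight p.1.1.1 * autWeight p.1.1.2 * autWeight p.1.2 * autWeight p.2)
    (fun p => c p.1.1.1.out p.2.out) (fun K F => K.Fits F) (fun _ K => K.tsum_frame)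
    (fun _ F => hc F)

end frames

end

noncomputable section

open Limits

/-! ### Filling frames in semisimple categories -/

section fill

variable {C : Type u} [Category.{v} C] [Abelian C]

/-- A morphism between the corners and the sides `M`, `N`, `M'`, `N'` of two frames. -/
structure Frame.Morphism {M₁ N₁ M₁' N₁' A₁ B₁ X₁ D₁ M₂ N₂ M₂' N₂' A₂ B₂ X₂ D₂ : C}
    (F₁ : Frame M₁ N₁ M₁' N₁' A₁ B₁ X₁ D₁) (F₂ : Frame M₂ N₂ M₂' N₂' A₂ B₂ X₂ D₂) where
  m : M₁ ⟶ M₂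
  n : N₁ ⟶ N₂
  m' : M₁' ⟶ M₂'
  n' : N₁' ⟶ N₂'
  α : A₁ ⟶ A₂
  δ : D₁ ⟶ D₂
  hd : F₁.d ≫ n = δ ≫ F₂.d
  hd' : F₁.d' ≫ n' = δ ≫ F₂.d'
  ha : m ≫ F₂.a = F₁.a ≫ α
  ha' : m' ≫ F₂.a' = F₁.a' ≫ α
  hc : n ≫ F₂.c ≫ F₂.c' = F₁.c ≫ F₁.c' ≫ m'
  hb : n' ≫ F₂.b' ≫ F₂.b = F₁.b' ≫ F₁.b ≫ m

/-- The identity of a frame. -/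
def Frame.Morphism.id {M N M' N' A B X D : C} (F : Frame M N M' N' A B X D) : Frame.Morphism F F :=
  ⟨𝟙 _, 𝟙 _, 𝟙 _, 𝟙 _, 𝟙 _, 𝟙 _, by simp, by simp, by simp, by simp, by simp, by simp⟩

/-- A morphism between the centres of two crosses that is compatible with given morphisms between
their ends. -/
structure CrossMap {M₁ N₁ M₁' N₁' E₁ M₂ N₂ M₂' N₂' E₂ : C}
    (K₁ : Cross M₁ N₁ M₁' N₁' E₁) (K₂ : Cross M₂ N₂ M₂' N₂' E₂)
    (m : M₁ ⟶ M₂) (n : N₁ ⟶ N₂) (m' : M₁' ⟶ M₂') (n' : N₁' ⟶ N₂') (x : E₁ ⟶ E₂) : Prop where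
  f : K₁.f ≫ x = n ≫ K₂.f
  f' : K₁.f' ≫ x = n' ≫ K₂.f'
  g : x ≫ K₂.g = K₁.g ≫ m
  g' : x ≫ K₂.g' = K₁.g' ≫ m'

section maps

variable {M₁ N₁ M₁' N₁' A₁ B₁ X₁ D₁ M₂ N₂ M₂' N₂' A₂ B₂ X₂ D₂ E₁ E₂ : C}
  {F₁ : Frame M₁ N₁ M₁' N₁' A₁ B₁ X₁ D₁} {F₂ : Frame M₂ N₂ M₂' N₂' A₂ B₂ X₂ D₂}
  {K₁ : Cross M₁ N₁ M₁' N₁' E₁} {K₂ : Cross M₂ N₂ M₂' N₂' E₂}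

/-- `A₁` is the quotient of `E₁` by `N₁ + N₁'`. Dually, `D₂` is the intersection of the kernels of
`E₂ → M₂` and `E₂ → M₂'`, as `exists_lift` expresses. -/
theorem Cross.Fits.exists_desc (h₁ : K₁.Fits F₁) {T : C} (t : E₁ ⟶ T) (h : K₁.f ≫ t = 0)
    (h' : K₁.f' ≫ t = 0) : ∃ u, K₁.g ≫ F₁.a ≫ u = t := by
  have := F₁.db'.epi
  obtain ⟨z, hz⟩ := K₁.fg.exists_desc t h
  obtain ⟨u, hu⟩ := F₁.ba.exists_desc z (by
    rw [← cancel_epi F₁.b', ← reassoc_of% h₁.bb, hz, h', comp_zero])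
  exact ⟨u, by rw [hu, hz]⟩

theorem Cross.Fits.exists_lift (h₂ : K₂.Fits F₂) {T : C} (t : T ⟶ E₂) (h : t ≫ K₂.g = 0)
    (h' : t ≫ K₂.g' = 0) : ∃ u, u ≫ F₂.d ≫ K₂.f = t := by
  have := F₂.ca'.mono
  obtain ⟨z, hz⟩ := K₂.fg.exists_lift t h
  obtain ⟨u, hu⟩ := F₂.dc.exists_lift z (by
    rw [← cancel_mono F₂.c', Category.assoc, ← h₂.cc, reassoc_of% hz, h', zero_comp])
  exact ⟨u, by rw [reassoc_of% hu, hz]⟩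

/-- Injectivity first produces a map with the prescribed restrictions to `N₁` and `N₁'`. Its errors
after projection to `M₂` and `M₂'` then factor through `A₁`, and projectivity provides one map `A₁ →
E₂` that corrects both without changing the restrictions. -/
theorem Cross.Fits.exists_crossMap [∀ X : C, Projective X] [∀ X : C, Injective X]
    (h₁ : K₁.Fits F₁) (h₂ : K₂.Fits F₂) (φ : Frame.Morphism F₁ F₂) :
    ∃ x, CrossMap K₁ K₂ φ.m φ.n φ.m' φ.n' x := by
  have := K₁.fg.mono
  have := K₁.fg.epi
  have := K₂.fg.epi
  have := F₁.ba.mono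
  have := F₁.ba.epi
  have := F₂.dc.epi
  obtain ⟨y, hy⟩ : ∃ y, K₁.f ≫ y = φ.n ≫ K₂.f :=
    ⟨Injective.factorThru _ K₁.f, Injective.comp_factorThru _ _⟩
  -- The error of `y` on `N₁'` vanishes on `D₁`, so it comes from `B₁`. Extended from `B₁` to `M₁`,
  -- it can be subtracted without affecting the restriction to `N₁`.
  obtain ⟨z, hz⟩ := F₁.db'.exists_desc (K₁.f' ≫ y - φ.n' ≫ K₂.f') (by
    rw [Preadditive.comp_sub, ← reassoc_of% h₁.dd, hy, reassoc_of% φ.hd, reassoc_of% φ.hd', h₂.dd,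
      sub_self])
  obtain ⟨z', hz'⟩ : ∃ z', F₁.b ≫ z' = z :=
    ⟨Injective.factorThru _ F₁.b, Injective.comp_factorThru _ _⟩
  obtain ⟨x, hxf, hxf'⟩ : ∃ x, K₁.f ≫ x = φ.n ≫ K₂.f ∧ K₁.f' ≫ x = φ.n' ≫ K₂.f' := by
    refine ⟨y - K₁.g ≫ z', ?_, ?_⟩
    · rw [Preadditive.comp_sub, hy, reassoc_of% K₁.fg.zero, zero_comp, sub_zero]
    · rw [Preadditive.comp_sub, reassoc_of% h₁.bb, hz', hz, sub_sub_cancel]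
  obtain ⟨e, he⟩ := h₁.exists_desc (x ≫ K₂.g - K₁.g ≫ φ.m)
    (by rw [Preadditive.comp_sub, reassoc_of% hxf, K₂.fg.zero, reassoc_of% K₁.fg.zero, zero_comp,
      comp_zero, sub_zero])
    (by rw [Preadditive.comp_sub, reassoc_of% hxf', h₂.bb, φ.hb, reassoc_of% h₁.bb, sub_self])
  obtain ⟨e', he'⟩ := h₁.exists_desc (x ≫ K₂.g' - K₁.g' ≫ φ.m')
    (by rw [Preadditive.comp_sub, reassoc_of% hxf, h₂.cc, φ.hc, reassoc_of% h₁.cc, sub_self])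
    (by rw [Preadditive.comp_sub, reassoc_of% hxf', K₂.fg'.zero, reassoc_of% K₁.fg'.zero,
      zero_comp, comp_zero, sub_zero])
  -- The two errors agree in `A₂`, which is the condition for lifting them simultaneously to `E₂`.
  have hee : e ≫ F₂.a = e' ≫ F₂.a' := by
    rw [← cancel_epi F₁.a, ← cancel_epi K₁.g, reassoc_of% he, reassoc_of% he',
      Preadditive.sub_comp, Preadditive.sub_comp, Category.assoc, Category.assoc, Category.assoc,
      Category.assoc, h₂.aa, φ.ha, φ.ha', reassoc_of% h₁.aa]
  obtain ⟨u, hu⟩ : ∃ u, u ≫ K₂.g = e := ⟨Projective.factorThru e K₂.g, by simp⟩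
  -- The lift `u` is right in `M₂`. Its defect in `M₂'` dies in `A₂`, so it lies in `X₂` and lifts
  -- to `N₂`; adding an element of `N₂` does not change the image in `M₂`.
  obtain ⟨r, hr⟩ := F₂.ca'.exists_lift (e' - u ≫ K₂.g') (by
    rw [Preadditive.sub_comp, Category.assoc, ← h₂.aa, reassoc_of% hu, hee, sub_self])
  obtain ⟨r', hr'⟩ : ∃ r', r' ≫ F₂.c = r := ⟨Projective.factorThru r F₂.c, by simp⟩
  have hug : (u + r' ≫ K₂.f) ≫ K₂.g = e := by
    rw [Preadditive.add_comp, hu, Category.assoc, K₂.fg.zero, comp_zero, add_zero]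
  have hug' : (u + r' ≫ K₂.f) ≫ K₂.g' = e' := by
    rw [Preadditive.add_comp, Category.assoc, h₂.cc, reassoc_of% hr', hr, add_sub_cancel]
  refine ⟨x - K₁.g ≫ F₁.a ≫ (u + r' ≫ K₂.f), ?_, ?_, ?_, ?_⟩
  · rw [Preadditive.comp_sub, hxf, reassoc_of% K₁.fg.zero, zero_comp, sub_zero]
  · rw [Preadditive.comp_sub, hxf', reassoc_of% h₁.aa, reassoc_of% K₁.fg'.zero, zero_comp,
      sub_zero]
  · rw [Preadditive.sub_comp, Category.assoc, Category.assoc, hug, he, sub_sub_cancel]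
  · rw [Preadditive.sub_comp, Category.assoc, Category.assoc, hug', he', sub_sub_cancel]

/-- The difference of two solutions kills `N₁` and `N₁'` and dies in `M₂` and `M₂'`. It is therefore
a map `E₁ → A₁ → D₂ → E₂`, and every map `A₁ → D₂` occurs exactly once. -/
theorem Cross.Fits.card_crossMap [∀ X : C, Projective X] [∀ X : C, Injective X]
    (h₁ : K₁.Fits F₁) (h₂ : K₂.Fits F₂) (φ : Frame.Morphism F₁ F₂) :
    Nat.card {x // CrossMap K₁ K₂ φ.m φ.n φ.m' φ.n' x} = Nat.card (A₁ ⟶ D₂) := by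
  obtain ⟨x₀, h₀⟩ := h₁.exists_crossMap h₂ φ
  have := K₁.fg.epi
  have := F₁.ba.epi
  have := F₂.dc.mono
  have := K₂.fg.mono
  have zf : K₁.f ≫ K₁.g ≫ F₁.a = 0 := by rw [reassoc_of% K₁.fg.zero, zero_comp]
  have zf' : K₁.f' ≫ K₁.g ≫ F₁.a = 0 := by rw [h₁.aa, reassoc_of% K₁.fg'.zero, zero_comp]
  have zg : F₂.d ≫ K₂.f ≫ K₂.g = 0 := by rw [K₂.fg.zero, comp_zero]
  have zg' : F₂.d ≫ K₂.f ≫ K₂.g' = 0 := by rw [reassoc_of% h₂.dd, K₂.fg'.zero, comp_zero]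
  refine (Nat.card_congr (Equiv.ofBijective (fun h : A₁ ⟶ D₂ =>
    ⟨x₀ + K₁.g ≫ F₁.a ≫ h ≫ F₂.d ≫ K₂.f, by simp [h₀.f, reassoc_of% zf],
      by simp [h₀.f', reassoc_of% zf'], by simp [h₀.g, zg], by simp [h₀.g', zg']⟩)
    ⟨fun h h' hh => ?_, ?_⟩)).symm
  · have := congrArg Subtype.val hh
    simpa [cancel_epi, cancel_mono] using this
  · rintro ⟨x, h⟩
    obtain ⟨u, hu⟩ := h₁.exists_desc (x - x₀) (by simp [h.f, h₀.f]) (by simp [h.f', h₀.f'])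
    obtain ⟨z, hz⟩ := h₂.exists_lift u
      (by rw [← cancel_epi F₁.a, ← cancel_epi K₁.g, reassoc_of% hu]; simp [h.g, h₀.g])
      (by rw [← cancel_epi F₁.a, ← cancel_epi K₁.g, reassoc_of% hu]; simp [h.g', h₀.g'])
    exact ⟨z, Subtype.ext (by simp [hz, hu])⟩

end maps

section objects

variable {M N M' N' A B X D E E' : C} {F : Frame M N M' N' A B X D}

/-- This is the short five lemma for the rows of the two crosses. -/
theorem CrossMap.isIso {K : Cross M N M' N' E} {K' : Cross M N M' N' E'} {x : E ⟶ E'}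
    (h : CrossMap K K' (𝟙 _) (𝟙 _) (𝟙 _) (𝟙 _) x) : IsIso x := by
  have hf := h.f
  have hg := h.g
  rw [Category.id_comp] at hf
  rw [Category.comp_id] at hg
  have := K'.fg.mono
  have := K.fg.epi
  have : Mono x := Preadditive.mono_of_cancel_zero _ fun t ht => by
    obtain ⟨u, rfl⟩ := K.fg.exists_lift t (by rw [← hg, reassoc_of% ht, zero_comp])
    rw [Category.assoc, hf] at ht
    rw [zero_of_comp_mono _ ht, zero_comp]
  have : Epi x := Preadditive.epi_of_cancel_zero _ fun t ht => by
    obtain ⟨u, rfl⟩ := K'.fg.exists_desc t (by rw [← hf, Category.assoc, ht, comp_zero])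
    rw [reassoc_of% hg] at ht
    rw [zero_of_epi_comp _ ht, comp_zero]
  exact isIso_of_mono_of_epi x

/-- Transport of a cross along an isomorphism of its centre. -/
@[simps]
def Cross.map (K : Cross M N M' N' E) (e : E ≅ E') : Cross M N M' N' E' where
  f := K.f ≫ e.hom
  g := e.inv ≫ K.g
  f' := K.f' ≫ e.hom
  g' := e.inv ≫ K.g'
  fg := K.fg.iso_mid e
  fg' := K.fg'.iso_mid e

theorem Cross.Fits.map {K : Cross M N M' N' E} (h : K.Fits F) (e : E ≅ E') : (K.map e).Fits F :=
  ⟨by simp [reassoc_of% h.dd], by simp [h.aa], by simp [h.cc], by simp [h.bb]⟩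

theorem Cross.card_fits_congr (F : Frame M N M' N' A B X D) (e : E ≅ E') :
    Nat.card {K : Cross M N M' N' E // K.Fits F} = Nat.card {K : Cross M N M' N' E' // K.Fits F} :=
  Nat.card_congr
    { toFun := fun K => ⟨K.1.map e, K.2.map e⟩
      invFun := fun K => ⟨K.1.map e.symm, K.2.map e.symm⟩
      left_inv := fun K => by ext <;> simp
      right_inv := fun K => by ext <;> simp }

variable [∀ X : C, Projective X] [∀ X : C, Injective X]

variable (F) in
-- The row is taken split, with centre `N ⊞ M`, and the column is sought in matrix form.
-- Commutativity with the frame leaves only two entries to choose: `r : N' ⟶ N` and `s : M ⟶ M'`.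
theorem Frame.exists_cross : ∃ K : Cross M N M' N' (N ⊞ M), K.Fits F := by
  obtain ⟨b, a, d, c, d', b', c', a', hba, hdc, hdb, hca⟩ := F
  have := hba.mono
  have := hdc.epi
  have := hdc.mono
  have := hdb.mono
  have := hdb.epi
  have := hca.mono
  have := hca.epi
  have := hba.epi
  -- This condition on `r` is the commutativity at the corner `D`.
  obtain ⟨r, hr⟩ : ∃ r, d' ≫ r = d := ⟨Injective.factorThru _ d', Injective.comp_factorThru _ _⟩
  obtain ⟨t, ht⟩ := hdb.exists_desc (r ≫ c ≫ c') (by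
    rw [reassoc_of% hr, reassoc_of% hdc.zero, zero_comp])
  have hta : t ≫ a' = 0 := by
    rw [← cancel_epi b', reassoc_of% ht, hca.zero, comp_zero, comp_zero, comp_zero]
  obtain ⟨p, hp⟩ : ∃ p, p ≫ a' = a := ⟨Projective.factorThru a a', by simp⟩
  obtain ⟨y, hy⟩ := hca.exists_lift (-t - b ≫ p) (by
    rw [Preadditive.sub_comp, Preadditive.neg_comp, hta, Category.assoc, hp, hba.zero, neg_zero,
      sub_zero])
  obtain ⟨y', hy'⟩ : ∃ y', b ≫ y' = y := ⟨Injective.factorThru _ b, Injective.comp_factorThru _ _⟩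
  -- The first condition makes the column compose to zero; the second is the commutativity at the
  -- corner `A`. They are compatible because `t` dies in `A`: a lift `p` of `a` is corrected by an
  -- extension to `M` of the discrepancy on `B`, which takes values in `X`.
  obtain ⟨s, hbs, hsa⟩ : ∃ s : M ⟶ M', b ≫ s = -t ∧ s ≫ a' = a := by
    refine ⟨p + y' ≫ c', ?_, ?_⟩
    · rw [Preadditive.comp_add, reassoc_of% hy', hy, add_sub_cancel]
    · rw [Preadditive.add_comp, Category.assoc, hca.zero, hp, comp_zero, add_zero]
  have hfg' : biprod.lift r (b' ≫ b) ≫ biprod.desc (c ≫ c') s = 0 := by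
    rw [biprod.lift_desc, Category.assoc, hbs, Preadditive.comp_neg, ht, add_neg_cancel]
  refine ⟨⟨biprod.inl, biprod.snd, biprod.lift r (b' ≫ b), biprod.desc (c ≫ c') s,
    IsSes.of_lift (by simp) inferInstance inferInstance ?_,
    IsSes.of_lift hfg' ?_ ?_ ?_⟩, ⟨?_, ?_, ?_, ?_⟩⟩
  · intro T u hu
    exact ⟨u ≫ biprod.fst, by ext <;> simp [hu]⟩
  · refine Preadditive.mono_of_cancel_zero _ fun u hu => ?_
    have hu₁ : u ≫ r = 0 := by simpa using congrArg (· ≫ biprod.fst) hu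
    have hu₂ : u ≫ b' ≫ b = 0 := by simpa using congrArg (· ≫ biprod.snd) hu
    obtain ⟨z, rfl⟩ := hdb.exists_lift u (by rw [← cancel_mono b, Category.assoc, hu₂, zero_comp])
    rw [Category.assoc, hr] at hu₁
    rw [zero_of_comp_mono _ hu₁, zero_comp]
  · refine Preadditive.epi_of_cancel_zero _ fun u hu => ?_
    have hu₁ : c ≫ c' ≫ u = 0 := by simpa using congrArg (biprod.inl ≫ ·) hu
    have hu₂ : s ≫ u = 0 := by simpa using congrArg (biprod.inr ≫ ·) hu
    obtain ⟨z, rfl⟩ := hca.exists_desc u (zero_of_epi_comp _ hu₁)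
    rw [reassoc_of% hsa] at hu₂
    rw [zero_of_epi_comp _ hu₂, comp_zero]
  · intro T z hz
    have hz' : (z ≫ biprod.fst) ≫ c ≫ c' + (z ≫ biprod.snd) ≫ s = 0 := by
      rw [← biprod.lift_desc, ← hz]
      congr 1
      ext <;> simp
    -- The `M`-component of `z` dies in `A`, so it comes from `B` and lifts to `N'`. What then
    -- remains in the `N`-component is killed by `c`, so it comes from `D`.
    obtain ⟨y, hy⟩ := hba.exists_lift (z ≫ biprod.snd) (by
      have := congrArg (· ≫ a') hz'
      simpa [hca.zero, hsa] using this)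
    obtain ⟨w, hw⟩ : ∃ w, w ≫ b' = y := ⟨Projective.factorThru y b', by simp⟩
    obtain ⟨x, hx⟩ := hdc.exists_lift (z ≫ biprod.fst - w ≫ r) (by
      rw [← cancel_mono c', zero_comp, Category.assoc, Preadditive.sub_comp,
        eq_neg_of_add_eq_zero_left hz', ← hy, Category.assoc, hbs, Category.assoc, ← ht, ← hw]
      simp)
    refine ⟨w + x ≫ d', ?_⟩
    ext
    · simp [hr, hx]
    · simp [reassoc_of% hdb.zero, reassoc_of% hw, hy]
  · ext
    · simp [hr]
    · simp [reassoc_of% hdb.zero]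
  · ext
    · simp [hca.zero]
    · simp [hsa]
  · simp
  · simp

theorem Cross.Fits.nonempty_iso {K : Cross M N M' N' E} (h : K.Fits F) : Nonempty (N ⊞ M ≅ E) := by
  obtain ⟨K₀, h₀⟩ := F.exists_cross
  obtain ⟨x, hx⟩ := h₀.exists_crossMap h (Frame.Morphism.id F)
  have := CrossMap.isIso hx
  exact ⟨asIso x⟩

variable (F) in
-- Orbit and stabilizer: `Aut (N ⊞ M)` acts transitively on the crosses filling `F`, and the
-- automorphisms carrying `K₀` to a given cross are the maps counted by `Cross.Fits.card_crossMap`.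
theorem Frame.card_cross_mul [∀ X Y : C, Finite (X ⟶ Y)] :
    Nat.card {K : Cross M N M' N' (N ⊞ M) // K.Fits F} * Nat.card (A ⟶ D) =
      Nat.card (N ⊞ M ≅ N ⊞ M) := by
  obtain ⟨K₀, h₀⟩ := F.exists_cross
  have := Fintype.ofFinite {K : Cross M N M' N' (N ⊞ M) // K.Fits F}
  have e : (N ⊞ M ≅ N ⊞ M) ≃ Σ K : {K : Cross M N M' N' (N ⊞ M) // K.Fits F},
      {x // CrossMap K₀ K.1 (𝟙 _) (𝟙 _) (𝟙 _) (𝟙 _) x} :=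
    { toFun := fun e => ⟨⟨K₀.map e, h₀.map e⟩, ⟨e.hom, by simp, by simp, by simp, by simp⟩⟩
      invFun := fun p => have := p.2.2.isIso; asIso p.2.1
      left_inv := fun e => Iso.ext rfl
      right_inv := fun ⟨⟨K, hK⟩, ⟨x, hx⟩⟩ => by
        have := hx.isIso
        have e : K = K₀.map (asIso x) := by
          apply Cross.ext
          · simp [hx.f]
          · simpa using hx.g
          · simp [hx.f']
          · simpa using hx.g'
        subst e
        rfl }
  rw [Nat.card_congr e, Nat.card_sigma]
  have hcard : ∀ K : {K : Cross M N M' N' (N ⊞ M) // K.Fits F},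
      Nat.card {x // CrossMap K₀ K.1 (𝟙 _) (𝟙 _) (𝟙 _) (𝟙 _) x} = Nat.card (A ⟶ D) :=
    fun K => h₀.card_crossMap K.2 (Frame.Morphism.id F)
  simp only [hcard]
  simp

end objects

end fill

end

noncomputable section

open scoped ENNReal
open Limits

/-! ### Representations of quivers in a semisimple category -/

theorem sum_card_subtype_comm {α β : Type*} [Fintype α] [Fintype β] (R : α → β → Prop) :
    ∑ a, Nat.card {b // R a b} = ∑ b, Nat.card {a // R a b} := by
  classical
  simp only [Nat.card_eq_fintype_card, Fintype.card_subtype]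
  exact Finset.sum_card_bipartiteAbove_eq_sum_card_bipartiteBelow
    (s := Finset.univ) (t := Finset.univ) R

/-- The arrows of a quiver. -/
abbrev QArrow (V : Type*) [Quiver V] := Σ (i j : V), (i ⟶ j)

namespace QRep

section basic

variable {V : Type w} [Quiver V] {𝒜 : Type u} [Category.{v} 𝒜]

/-- The object at a vertex. -/
abbrev at' (F : Paths V ⥤ 𝒜) (i : V) : 𝒜 := F.obj ((Paths.of V).obj i)

/-- The morphism at an arrow. -/
abbrev act (F : Paths V ⥤ 𝒜) {i j : V} (a : i ⟶ j) : at' F i ⟶ at' F j :=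
  F.map ((Paths.of V).map a)

/-- The component at a vertex. -/
abbrev app {F G : Paths V ⥤ 𝒜} (f : F ⟶ G) (i : V) : at' F i ⟶ at' G i :=
  f.app ((Paths.of V).obj i)

theorem act_app {F G : Paths V ⥤ 𝒜} (f : F ⟶ G) {i j : V} (a : i ⟶ j) :
    act F a ≫ app f j = app f i ≫ act G a := f.naturality _

theorem naturality_of_arrows {F G : Paths V ⥤ 𝒜} (φ : ∀ X : Paths V, F.obj X ⟶ G.obj X)
    (h : ∀ {i j : V} (a : i ⟶ j), act F a ≫ φ ((Paths.of V).obj j) =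
      φ ((Paths.of V).obj i) ≫ act G a) {X Y : Paths V} (p : X ⟶ Y) :
    F.map p ≫ φ Y = φ X ≫ G.map p := by
  induction p using Paths.induction with
  | id => simp
  | comp p q hp => rw [F.map_comp, G.map_comp, Category.assoc, h q, reassoc_of% hp]

/-- A morphism of representations, from its components at the vertices. -/
def homMk {F G : Paths V ⥤ 𝒜} (φ : ∀ i : V, at' F i ⟶ at' G i)
    (h : ∀ {i j : V} (a : i ⟶ j), act F a ≫ φ j = φ i ≫ act G a) : F ⟶ G where
  app := φ
  naturality _ _ p := naturality_of_arrows φ h p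

@[simp] theorem homMk_app {F G : Paths V ⥤ 𝒜} (φ : ∀ i : V, at' F i ⟶ at' G i)
    (h : ∀ {i j : V} (a : i ⟶ j), act F a ≫ φ j = φ i ≫ act G a) (i : V) :
    app (homMk φ h) i = φ i := rfl

theorem hom_ext {F G : Paths V ⥤ 𝒜} {f g : F ⟶ G} (h : ∀ i : V, app f i = app g i) : f = g :=
  NatTrans.ext (funext h)

/-- The representation with given objects at the vertices and given morphisms at the arrows. -/
def mk (W : V → 𝒜) (x : ∀ p : QArrow V, W p.1 ⟶ W p.2.1) : Paths V ⥤ 𝒜 :=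
  Paths.lift { obj := W, map := fun {i j} a => x ⟨i, j, a⟩ }

theorem act_mk (W : V → 𝒜) (x : ∀ p : QArrow V, W p.1 ⟶ W p.2.1) {i j : V} (a : i ⟶ j) :
    act (mk W x) a = x ⟨i, j, a⟩ :=
  Paths.lift_toPath _ a

instance [Finite V] [∀ X Y : 𝒜, Finite (X ⟶ Y)] (F G : Paths V ⥤ 𝒜) : Finite (F ⟶ G) :=
  Finite.of_injective (fun (f : F ⟶ G) (i : V) => app f i) fun _ _ h => hom_ext (congrFun h)

/-- An isomorphism of representations, from its components at the vertices. -/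
def isoMk {F G : Paths V ⥤ 𝒜} (φ : ∀ i : V, at' F i ≅ at' G i)
    (h : ∀ {i j : V} (a : i ⟶ j), act F a ≫ (φ j).hom = (φ i).hom ≫ act G a) : F ≅ G where
  hom := homMk (fun i => (φ i).hom) h
  inv := homMk (fun i => (φ i).inv) fun {i j} a => by
    rw [Iso.eq_inv_comp, ← Category.assoc, ← h, Category.assoc, Iso.hom_inv_id, Category.comp_id]
  hom_inv_id := hom_ext fun i => (φ i).hom_inv_id
  inv_hom_id := hom_ext fun i => (φ i).inv_hom_id

variable [Abelian 𝒜]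

theorem isSes_iff {N E M : Paths V ⥤ 𝒜} {f : N ⟶ E} {g : E ⟶ M} :
    IsSes f g ↔ ∀ i : V, IsSes (app f i) (app g i) := by
  refine ⟨fun h i => ?_, fun h => ?_⟩
  · exact ⟨congrArg (fun t => app t i) h.zero,
      h.2.map_of_exact ((evaluation _ _).obj ((Paths.of V).obj i))⟩
  · have (i : V) := (h i).mono
    have : Mono f := (NatTrans.mono_iff_mono_app f).2 fun i => (h i).mono
    have : Epi g := (NatTrans.epi_iff_epi_app g).2 fun i => (h i).epi
    refine IsSes.of_lift (hom_ext fun i => (h i).zero) inferInstance inferInstance fun t ht => ?_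
    choose u hu using fun i => (h i).exists_lift (app t i) (congrArg (fun t => app t i) ht)
    -- The lifts at the vertices commute with the arrows automatically, because `app f j` is mono.
    refine ⟨homMk u fun {i j} a => ?_, hom_ext hu⟩
    rw [← cancel_mono (app f j), Category.assoc, hu, Category.assoc, act_app, act_app,
      reassoc_of% hu]

end basic

section fill

variable {V : Type w} [Quiver V] {𝒜 : Type u} [Category.{v} 𝒜] [Abelian 𝒜]

variable {M N M' N' A B X D : Paths V ⥤ 𝒜}

/-- The value of a frame at a vertex. -/
def frameAt (F : Frame M N M' N' A B X D) (i : V) :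
    Frame (at' M i) (at' N i) (at' M' i) (at' N' i) (at' A i) (at' B i) (at' X i) (at' D i) :=
  ⟨app F.b i, app F.a i, app F.d i, app F.c i, app F.d' i, app F.b' i, app F.c' i, app F.a' i,
    isSes_iff.1 F.ba i, isSes_iff.1 F.dc i, isSes_iff.1 F.db' i, isSes_iff.1 F.ca' i⟩

/-- The action of an arrow on the values of a frame. -/
def frameAct (F : Frame M N M' N' A B X D) {i j : V} (a : i ⟶ j) :
    (frameAt F i).Morphism (frameAt F j) where
  m := act M a
  n := act N a
  m' := act M' a
  n' := act N' a
  α := act A a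
  δ := act D a
  hd := (act_app F.d a).symm
  hd' := (act_app F.d' a).symm
  ha := act_app F.a a
  ha' := act_app F.a' a
  hc := by
    have := act_app (F.c ≫ F.c') a
    simpa [frameAt] using this
  hb := by
    have := act_app (F.b' ≫ F.b) a
    simpa [frameAt] using this

/-- The value of a cross at a vertex. -/
def crossAt {E : Paths V ⥤ 𝒜} (K : Cross M N M' N' E) (i : V) :
    Cross (at' M i) (at' N i) (at' M' i) (at' N' i) (at' E i) :=
  ⟨app K.f i, app K.g i, app K.f' i, app K.g' i, isSes_iff.1 K.fg i, isSes_iff.1 K.fg' i⟩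

theorem fits_crossAt {E : Paths V ⥤ 𝒜} {K : Cross M N M' N' E} {F : Frame M N M' N' A B X D}
    (h : K.Fits F) (i : V) : (crossAt K i).Fits (frameAt F i) :=
  ⟨congrArg (fun t => app t i) h.dd, congrArg (fun t => app t i) h.aa,
    congrArg (fun t => app t i) h.cc, congrArg (fun t => app t i) h.bb⟩

/-- A cross of representations consists of crosses at the vertices which are compatible with the
arrows. -/
def crossEquiv (F : Frame M N M' N' A B X D) (E : Paths V ⥤ 𝒜) :
    {K : Cross M N M' N' E // K.Fits F} ≃
      {κ : ∀ i : V, {K : Cross (at' M i) (at' N i) (at' M' i) (at' N' i) (at' E i) //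
        K.Fits (frameAt F i)} // ∀ p : QArrow V, CrossMap (κ p.1).1 (κ p.2.1).1
          (act M p.2.2) (act N p.2.2) (act M' p.2.2) (act N' p.2.2) (act E p.2.2)} where
  toFun K := ⟨fun i => ⟨crossAt K.1 i, fits_crossAt K.2 i⟩, fun p =>
    ⟨(act_app K.1.f _).symm, (act_app K.1.f' _).symm, act_app K.1.g _, act_app K.1.g' _⟩⟩
  invFun κ :=
    ⟨⟨homMk (fun i => (κ.1 i).1.f) fun {i j} a => (κ.2 ⟨i, j, a⟩).f.symm,
      homMk (fun i => (κ.1 i).1.g) fun {i j} a => (κ.2 ⟨i, j, a⟩).g,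
      homMk (fun i => (κ.1 i).1.f') fun {i j} a => (κ.2 ⟨i, j, a⟩).f'.symm,
      homMk (fun i => (κ.1 i).1.g') fun {i j} a => (κ.2 ⟨i, j, a⟩).g',
      isSes_iff.2 fun i => (κ.1 i).1.fg, isSes_iff.2 fun i => (κ.1 i).1.fg'⟩,
      hom_ext fun i => (κ.1 i).2.dd, hom_ext fun i => (κ.1 i).2.aa,
      hom_ext fun i => (κ.1 i).2.cc, hom_ext fun i => (κ.1 i).2.bb⟩
  left_inv _ := rfl
  right_inv _ := rfl

variable [Finite V] [∀ i j : V, Finite (i ⟶ j)] [∀ X Y : 𝒜, Finite (X ⟶ Y)]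

/-- The representations isomorphic to `E` with given objects at the vertices correspond to
isomorphisms of the objects at the vertices. -/
theorem sum_card_iso_mk (W : V → 𝒜) [Fintype (∀ p : QArrow V, W p.1 ⟶ W p.2.1)]
    (E : Paths V ⥤ 𝒜) :
    ∑ x, Nat.card (mk W x ≅ E) = Nat.card (∀ i, W i ≅ at' E i) := by
  have := Fintype.ofFinite (∀ i, W i ≅ at' E i)
  have h₁ : ∀ x, Nat.card (mk W x ≅ E) = Nat.card {s : ∀ i, W i ≅ at' E i //
      ∀ p : QArrow V, x p ≫ (s p.2.1).hom = (s p.1).hom ≫ act E p.2.2} := by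
    intro x
    refine Nat.card_congr
      { toFun := fun e => ⟨fun i => e.app ((Paths.of V).obj i), fun p => ?_⟩
        invFun := fun s => isoMk s.1 fun {i j} a => ?_
        left_inv := fun e => Iso.ext rfl
        right_inv := fun s => rfl }
    · have := act_app e.hom p.2.2
      rwa [act_mk] at this
    · rw [act_mk]
      exact s.2 ⟨i, j, a⟩
  -- Isomorphisms at the vertices carry the action of `E` back to exactly one action on `W`.
  have h₂ : ∀ s : ∀ i, W i ≅ at' E i, Nat.card {x : ∀ p : QArrow V, W p.1 ⟶ W p.2.1 //
      ∀ p : QArrow V, x p ≫ (s p.2.1).hom = (s p.1).hom ≫ act E p.2.2} = 1 := by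
    intro s
    rw [Nat.card_eq_one_iff_exists]
    refine ⟨⟨fun p => (s p.1).hom ≫ act E p.2.2 ≫ (s p.2.1).inv, by simp⟩, fun x => ?_⟩
    refine Subtype.ext (funext fun p => ?_)
    rw [← cancel_mono (s p.2.1).hom, x.2 p]
    simp
  simp only [h₁]
  rw [sum_card_subtype_comm]
  simp only [h₂]
  simp

variable [∀ X : 𝒜, Projective X] [∀ X : 𝒜, Injective X]

/-- Pairs consisting of an action `x` and a cross are counted with the crosses at the vertices
chosen first. The entries of `x` can then be chosen independently on each arrow. -/
theorem sum_card_cross_mk [Fintype V] [Fintype (QArrow V)] (F : Frame M N M' N' A B X D)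
    [Fintype (∀ p : QArrow V, at' N p.1 ⊞ at' M p.1 ⟶ at' N p.2.1 ⊞ at' M p.2.1)] :
    ∑ x : ∀ p : QArrow V, at' N p.1 ⊞ at' M p.1 ⟶ at' N p.2.1 ⊞ at' M p.2.1,
        Nat.card {K : Cross M N M' N' (mk (fun i => at' N i ⊞ at' M i) x) // K.Fits F} =
      (∏ i : V, Nat.card {K : Cross (at' M i) (at' N i) (at' M' i) (at' N' i) (at' N i ⊞ at' M i) //
        K.Fits (frameAt F i)}) * ∏ p : QArrow V, Nat.card (at' A p.1 ⟶ at' D p.2.1) := by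
  set Κ := ∀ i : V, {K : Cross (at' M i) (at' N i) (at' M' i) (at' N' i) (at' N i ⊞ at' M i) //
        K.Fits (frameAt F i)} with hΚ
  have : Finite Κ := Pi.finite
  have := Fintype.ofFinite Κ
  have h₁ : ∀ x, Nat.card {K : Cross M N M' N' (mk (fun i => at' N i ⊞ at' M i) x) // K.Fits F} =
      Nat.card {κ : Κ // ∀ p : QArrow V, CrossMap (κ p.1).1 (κ p.2.1).1
          (act M p.2.2) (act N p.2.2) (act M' p.2.2) (act N' p.2.2) (x p)} := by
    intro x
    rw [Nat.card_congr (crossEquiv F _)]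
    simp only [act_mk]
    rfl
  have h₂ : ∀ κ : Κ, Nat.card {x : ∀ p : QArrow V, at' N p.1 ⊞ at' M p.1 ⟶
      at' N p.2.1 ⊞ at' M p.2.1 // ∀ p : QArrow V, CrossMap (κ p.1).1 (κ p.2.1).1
          (act M p.2.2) (act N p.2.2) (act M' p.2.2) (act N' p.2.2) (x p)} =
      ∏ p : QArrow V, Nat.card (at' A p.1 ⟶ at' D p.2.1) := by
    intro κ
    rw [Nat.card_congr (Equiv.subtypePiEquivPi (p := fun (p : QArrow V) x => CrossMap (κ p.1).1
      (κ p.2.1).1 (act M p.2.2) (act N p.2.2) (act M' p.2.2) (act N' p.2.2) x)), Nat.card_pi]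
    exact Finset.prod_congr rfl fun p _ =>
      (κ p.1).2.card_crossMap (κ p.2.1).2 (frameAct F p.2.2)
  simp only [h₁]
  rw [sum_card_subtype_comm]
  simp only [h₂]
  rw [Finset.sum_const, Finset.card_univ, smul_eq_mul, ← Nat.card_eq_fintype_card, hΚ, Nat.card_pi]

/-- The actions `x` on the fixed objects `W i = N_i ⊞ M_i`, each with its crosses, are counted
twice. Among all actions, an isomorphism class `e` that can carry a cross occurs `|∏ Aut (W i)| /
|Aut e|` times, so the total is the wanted sum times `|∏ Aut (W i)|`. The other count is
`sum_card_cross_mk`, evaluated at the vertices by `Frame.card_cross_mul`. -/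
theorem tsum_cross_fits [Fintype V] [Fintype (QArrow V)] (F : Frame M N M' N' A B X D) :
    ∑' e : IsoClass (Paths V ⥤ 𝒜),
        (Nat.card {K : Cross M N M' N' e.out // K.Fits F} : ℝ≥0∞) * autWeight e =
      (∏ p : QArrow V, (Nat.card (at' A p.1 ⟶ at' D p.2.1) : ℝ≥0∞)) /
        ∏ i : V, (Nat.card (at' A i ⟶ at' D i) : ℝ≥0∞) := by
  let W : V → 𝒜 := fun i => at' N i ⊞ at' M i
  have := Fintype.ofFinite (∀ p : QArrow V, W p.1 ⟶ W p.2.1)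
  set S := ∑' e : IsoClass (Paths V ⥤ 𝒜),
        (Nat.card {K : Cross M N M' N' e.out // K.Fits F} : ℝ≥0∞) * autWeight e with hS
  have hG : (∑ x, Nat.card {K : Cross M N M' N' (mk W x) // K.Fits F} : ℕ) =
      ((Nat.card (∀ i, W i ≅ W i) : ℕ) : ℝ≥0∞) * S := by
    push_cast
    calc ∑ x, (Nat.card {K : Cross M N M' N' (mk W x) // K.Fits F} : ℝ≥0∞)
        = ∑ x, ∑' e : IsoClass (Paths V ⥤ 𝒜), (Nat.card (mk W x ≅ e.out) : ℝ≥0∞) *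
            (Nat.card {K : Cross M N M' N' e.out // K.Fits F} : ℝ≥0∞) * autWeight e := by
          refine Finset.sum_congr rfl fun x _ => ?_
          rw [tsum_card_iso_mul (mk W x)
            (fun e => (Nat.card {K : Cross M N M' N' e.out // K.Fits F} : ℝ≥0∞))]
          rw [Cross.card_fits_congr F (nonempty_iso_out (mk W x)).some]
      _ = ∑' e : IsoClass (Paths V ⥤ 𝒜), (Nat.card (∀ i, W i ≅ at' e.out i) : ℝ≥0∞) *
            (Nat.card {K : Cross M N M' N' e.out // K.Fits F} : ℝ≥0∞) * autWeight e := by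
          rw [← Summable.tsum_finsetSum fun _ _ => ENNReal.summable]
          refine tsum_congr fun e => ?_
          rw [← Finset.sum_mul, ← Finset.sum_mul, ← sum_card_iso_mk]
          push_cast
          rfl
      _ = _ := by
          rw [hS, ← ENNReal.tsum_mul_left]
          refine tsum_congr fun e => ?_
          rw [mul_assoc]
          -- A representation carrying a cross over `F` has `W i` at each vertex up to isomorphism;
          -- the other classes contribute zero.
          by_cases he : Nonempty {K : Cross M N M' N' e.out // K.Fits F}
          · obtain ⟨K, hK⟩ := he
            have (i : V) : Nonempty (W i ≅ at' e.out i) := (fits_crossAt hK i).nonempty_iso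
            rw [Nat.card_pi, Nat.card_pi,
              Finset.prod_congr rfl fun i _ => card_iso_congr (this i).some.symm]
          · rw [not_nonempty_iff] at he
            simp
  have hC : (∑ x, Nat.card {K : Cross M N M' N' (mk W x) // K.Fits F}) *
      ∏ i : V, Nat.card (at' A i ⟶ at' D i) =
      Nat.card (∀ i, W i ≅ W i) * ∏ p : QArrow V, Nat.card (at' A p.1 ⟶ at' D p.2.1) := by
    rw [sum_card_cross_mk F, mul_right_comm, ← Finset.prod_mul_distrib,
      Finset.prod_congr rfl fun i _ => (frameAt F i).card_cross_mul, Nat.card_pi]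
  have hG0 : (Nat.card (∀ i, W i ≅ W i) : ℝ≥0∞) ≠ 0 := by
    have : Nonempty (∀ i, W i ≅ W i) := ⟨fun i => Iso.refl _⟩
    exact_mod_cast Nat.card_pos.ne'
  have hC' := congrArg (Nat.cast : ℕ → ℝ≥0∞) hC
  rw [Nat.cast_mul, hG, mul_assoc, Nat.cast_mul,
    ENNReal.mul_right_inj hG0 (ENNReal.natCast_ne_top _)] at hC'
  push_cast at hC'
  refine (ENNReal.eq_div_iff ?_ ?_).2 (by rw [mul_comm, hC'])
  · exact Finset.prod_ne_zero_iff.2 fun i _ => by exact_mod_cast Nat.card_pos.ne'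
  · exact ENNReal.prod_ne_top fun i _ => ENNReal.natCast_ne_top _

end fill

end QRep

end

/-! ### Finiteness of the sums defining `m` and `Δ` -/

noncomputable section

open Limits

namespace QRep

variable {V : Type w} [Quiver V] {𝒜 : Type u} [Category.{v} 𝒜] [Abelian 𝒜]

variable [Finite V] [∀ i j : V, Finite (i ⟶ j)] [∀ X Y : 𝒜, Finite (X ⟶ Y)]
  [∀ X : 𝒜, Projective X] [∀ X : 𝒜, Injective X]

/-- Every extension of `M` by `N` splits at the vertices, so it is given by one of finitely many
actions on the objects `N_i ⊞ M_i`. -/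
theorem finite_hallP_ne_zero (M N : Paths V ⥤ 𝒜) :
    {x : IsoClass (Paths V ⥤ 𝒜) | hallP M N x.out ≠ 0}.Finite := by
  refine (Set.finite_range fun x : (∀ p : QArrow V, at' N p.1 ⊞ at' M p.1 ⟶
    at' N p.2.1 ⊞ at' M p.2.1) => isoClass (mk (fun i => at' N i ⊞ at' M i) x)).subset ?_
  intro e he
  have : Nonempty (Ses N e.out M) := (Nat.card_ne_zero.1 he).1
  obtain ⟨⟨⟨f, g⟩, h⟩⟩ := this
  have h' (i : V) := isSes_iff.1 h i
  let s (i : V) : at' e.out i ≅ at' N i ⊞ at' M i :=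
    (h' i).2.splittingOfProjective.isoBinaryBiproduct
  refine ⟨fun p => (s p.1).inv ≫ act e.out p.2.2 ≫ (s p.2.1).hom, ?_⟩
  dsimp only
  conv_rhs => rw [← isoClass_out e]
  refine isoClass_eq_iff.2 ⟨isoMk (fun i => (s i).symm) fun {i j} a => ?_⟩
  rw [act_mk]
  change ((s i).inv ≫ act e.out a ≫ (s j).hom) ≫ (s j).inv = (s i).inv ≫ act e.out a
  rw [Category.assoc, Category.assoc, Iso.hom_inv_id, Category.comp_id]

/-- For each pair, choose a short exact sequence and retractions `r` of its inclusion at the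
vertices. The idempotents `r ≫ f` of the objects `E_i` determine the subobject, hence the pair, and
`E_i` has finitely many endomorphisms. -/
theorem finite_hallP_out_ne_zero (E : Paths V ⥤ 𝒜) :
    {p : IsoClass (Paths V ⥤ 𝒜) × IsoClass (Paths V ⥤ 𝒜) |
      hallP p.1.out p.2.out E ≠ 0}.Finite := by
  have hs : ∀ p : {p : IsoClass (Paths V ⥤ 𝒜) × IsoClass (Paths V ⥤ 𝒜) |
      hallP p.1.out p.2.out E ≠ 0}, Nonempty (Ses p.1.2.out E p.1.1.out) :=
    fun p => (Nat.card_ne_zero.1 p.2).1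
  let s := fun p => (hs p).some
  have hmono (p) (i : V) : Mono (app (s p).1.1 i) := (isSes_iff.1 (s p).2 i).mono
  have hr : ∀ p (i : V), ∃ r, app (s p).1.1 i ≫ r = 𝟙 _ := fun p i =>
    ⟨Injective.factorThru (𝟙 _) (app (s p).1.1 i), Injective.comp_factorThru _ _⟩
  choose r hr using hr
  have key : ∀ p p', (∀ i, r p i ≫ app (s p).1.1 i = r p' i ≫ app (s p').1.1 i) →
      ∃ u, u ≫ (s p').1.1 = (s p).1.1 := by
    intro p p' h
    refine (s p').2.exists_lift _ (hom_ext fun i => ?_)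
    change app (s p).1.1 i ≫ app (s p').1.2 i = 0
    rw [← Category.id_comp (app (s p).1.1 i), ← hr p i, Category.assoc, Category.assoc,
      reassoc_of% (h i), (isSes_iff.1 (s p').2 i).zero, comp_zero, comp_zero]
  rw [← Set.finite_coe_iff]
  refine Finite.of_injective (fun p (i : V) => (r p i ≫ app (s p).1.1 i : at' E i ⟶ at' E i))
    fun p p' h => ?_
  have := (s p).2.mono
  have := (s p').2.mono
  obtain ⟨u, hu⟩ := key p p' (congrFun h)
  obtain ⟨u', hu'⟩ := key p' p (congrFun h.symm)
  let e : p.1.2.out ≅ p'.1.2.out := ⟨u, u', by simp [← cancel_mono (s p).1.1, hu', hu],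
    by simp [← cancel_mono (s p').1.1, hu', hu]⟩
  obtain ⟨e', -⟩ := (s p).2.exists_iso_right (hu ▸ (s p').2.iso_left e)
  refine Subtype.ext (Prod.ext ?_ ?_)
  · rw [← isoClass_out p.1.1, ← isoClass_out p'.1.1]
    exact isoClass_eq_iff.2 ⟨e'⟩
  · rw [← isoClass_out p.1.2, ← isoClass_out p'.1.2]
    exact isoClass_eq_iff.2 ⟨e⟩

end QRep

end

noncomputable section

open Limits

/-! ### Ext groups of representations of quivers -/

section effaceable

variable {C : Type u} [Category.{v} C] [Abelian C]

open HomologicalComplex in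
-- `P` is the top term `K.X i`. It consists of cycles, so it surjects onto the homology in degree
-- `i`, which is `X`; its inclusion into `K` is a chain map since the outgoing differential is zero.
theorem exists_epi_of_quasiIsoAt_single
    {X : C} {K : CochainComplex C ℤ} {i : ℤ}
    (π : K ⟶ (single C (ComplexShape.up ℤ) i).obj X) [K.IsStrictlyLE i]
    (hπ : QuasiIsoAt π i) :
    ∃ (P : C) (p : P ⟶ X) (s : (single C (ComplexShape.up ℤ) i).obj P ⟶ K), Epi p ∧
      s ≫ π = (single C (ComplexShape.up ℤ) i).map p := by
  have hK : ∀ j, (ComplexShape.up ℤ).Rel i j → K.d i j = 0 := fun j hj =>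
    (K.isZero_of_isStrictlyLE i j (by
      have : i + 1 = j := hj
      lia)).eq_of_tgt _ _
  let e := K.iCyclesIso i (i + 1) (by simp) (hK _ (by simp))
  let α : K.X i ⟶ X :=
    e.inv ≫ K.homologyπ i ≫ homologyMap π i ≫ (singleObjHomologySelfIso _ _ _).hom
  have hα : Epi α := by
    have : IsIso (homologyMap π i) := inferInstance
    dsimp only [α]
    infer_instance
  have : π.f i = α ≫ (singleObjXSelf (ComplexShape.up ℤ) i X).inv := by
    rw [← cancel_epi e.hom]
    dsimp only [α, e]
    rw [Category.assoc, Category.assoc, Category.assoc, Iso.hom_inv_id_assoc,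
      homologyπ_naturality_assoc, homologyπ_singleObjHomologySelfIso_hom_assoc,
      ← singleObjCyclesSelfIso_inv_iCycles, Iso.hom_inv_id_assoc]
    exact (cyclesMap_i π i).symm
  refine ⟨K.X i, α, mkHomFromSingle (𝟙 _) fun j hj => by rw [hK j hj, comp_zero], hα, ?_⟩
  apply HomologicalComplex.from_single_hom_ext
  rw [comp_f, mkHomFromSingle_f, Category.assoc, this]
  simp [single_map_f_self]

open DerivedCategory in
-- `φ` is a fraction `π⁻¹ g` whose roof `K` vanishes above degree `i`. After pullback to `P` it
-- becomes a chain map concentrated in degree `i`, where `L` is zero.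
theorem exists_epi_comp_eq_zero [HasDerivedCategory.{w} C] {X : C}
    {L : CochainComplex C ℤ} {i : ℤ}
    (φ : Q.obj ((CochainComplex.singleFunctor C i).obj X) ⟶ Q.obj L)
    (n : ℤ) (hn : n < i) [L.IsStrictlyLE n] :
    ∃ (P : C) (p : P ⟶ X), Epi p ∧ Q.map ((CochainComplex.singleFunctor C i).map p) ≫ φ = 0 := by
  obtain ⟨K, _, π, h, g, rfl⟩ := right_fac_of_isStrictlyLE φ i
  obtain ⟨P, p, s, hp, hs⟩ : ∃ (P : C) (p : P ⟶ X)
      (s : (CochainComplex.singleFunctor C i).obj P ⟶ K),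
      Epi p ∧ s ≫ π = (CochainComplex.singleFunctor C i).map p := by
    have := (isIso_Q_map_iff_quasiIso C π).1 h
    exact exists_epi_of_quasiIsoAt_single (X := X) (i := i) π (this.quasiIsoAt i)
  have h₂ : s ≫ g = 0 := by
    apply HomologicalComplex.from_single_hom_ext
    apply (L.isZero_of_isStrictlyLE n i hn).eq_of_tgt
  refine ⟨P, p, hp, ?_⟩
  rw [← hs, Functor.map_comp, Category.assoc, IsIso.hom_inv_id_assoc, ← Functor.map_comp,
    h₂, Functor.map_zero]

open DerivedCategory in
-- Positive `Ext` groups are effaceable. This substitutes for projective resolutions in describing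
-- `Ext¹` and in killing the higher groups.
theorem CategoryTheory.Abelian.Ext.exists_epi_mk₀_comp_eq_zero [HasExt.{w} C] {X Y : C} {n : ℕ}
    (e : Ext X Y (n + 1)) : ∃ (P : C) (p : P ⟶ X), Epi p ∧ (Ext.mk₀ p).comp e (zero_add _) = 0 := by
  let := HasDerivedCategory.standard C
  obtain ⟨P, p, hp, h⟩ := exists_epi_comp_eq_zero (X := X)
    (L := (CochainComplex.singleFunctor C (-(n + 1))).obj Y) (i := 0)
    (e.hom ≫ ((singleFunctors C).shiftIso (n + 1) (-(n + 1)) 0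
    (by lia)).hom.app _) (-(n + 1)) (by lia)
  refine ⟨P, p, hp, ?_⟩
  ext
  rw [zero_hom, ← cancel_mono (((singleFunctors C).shiftIso (n + 1) (-(n + 1)) 0
    (by lia)).hom.app _), comp_hom, mk₀_hom]
  rw [ShiftedHom.mk₀_comp]
  rw [Category.assoc]
  exact h.trans Limits.zero_comp.symm

end effaceable

/-! ### Extensions of representations as cocycles on the arrows -/

namespace QRep

open Abelian

section

variable {V : Type*} [Quiver V] {𝒜 : Type u} [Category.{v} 𝒜] [Abelian 𝒜]

/-- Families of morphisms along the arrows. -/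
abbrev Cocycle (M N : Paths V ⥤ 𝒜) := ∀ p : QArrow V, at' M p.1 ⟶ at' N p.2.1

variable {M N M' N' : Paths V ⥤ 𝒜}

/-- The action of an arrow on an extension of `M` by `N` with off-diagonal entries `φ`. -/
def extMat (φ : Cocycle M N) (p : QArrow V) :
    at' N p.1 ⊞ at' M p.1 ⟶ at' N p.2.1 ⊞ at' M p.2.1 :=
  biprod.desc (act N p.2.2 ≫ biprod.inl) (φ p ≫ biprod.inl + act M p.2.2 ≫ biprod.inr)

/-- The extension of `M` by `N` with off-diagonal entries `φ`. -/
def extObj (φ : Cocycle M N) : Paths V ⥤ 𝒜 :=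
  mk (fun i => at' N i ⊞ at' M i) (extMat φ)

theorem act_extObj (φ : Cocycle M N) (p : QArrow V) : act (extObj φ) p.2.2 = extMat φ p :=
  act_mk _ _ p.2.2

/-- A morphism into an extension. -/
def homToExt (φ : Cocycle M N) {E : Paths V ⥤ 𝒜} (s : ∀ i : V, at' E i ⟶ at' N i ⊞ at' M i)
    (h : ∀ p : QArrow V, act E p.2.2 ≫ s p.2.1 = s p.1 ≫ extMat φ p) : E ⟶ extObj φ :=
  homMk (G := extObj φ) s fun {i j} a => by
    rw [act_extObj φ ⟨i, j, a⟩]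
    exact h ⟨i, j, a⟩

/-- A morphism out of an extension. -/
def homFromExt (φ : Cocycle M N) {E : Paths V ⥤ 𝒜} (s : ∀ i : V, at' N i ⊞ at' M i ⟶ at' E i)
    (h : ∀ p : QArrow V, extMat φ p ≫ s p.2.1 = s p.1 ≫ act E p.2.2) : extObj φ ⟶ E :=
  homMk (F := extObj φ) s fun {i j} a => by
    rw [act_extObj φ ⟨i, j, a⟩]
    exact h ⟨i, j, a⟩

/-- The inclusion of `N` into an extension. -/
def extι (φ : Cocycle M N) : N ⟶ extObj φ :=
  homToExt φ (fun i => biprod.inl) fun p => by simp [extMat]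

/-- The projection of an extension to `M`. -/
def extπ (φ : Cocycle M N) : extObj φ ⟶ M :=
  homFromExt φ (fun i => biprod.snd) fun p => by
    rw [extMat]
    ext <;> simp

theorem isSes_ext (φ : Cocycle M N) : IsSes (extι φ) (extπ φ) :=
  isSes_iff.2 fun i =>
    show IsSes (biprod.inl : at' N i ⟶ at' N i ⊞ at' M i) biprod.snd from
    IsSes.of_lift (by simp) inferInstance inferInstance fun u hu =>
      ⟨u ≫ biprod.fst, by ext <;> simp [hu]⟩

variable [HasExt.{w} (Paths V ⥤ 𝒜)]

/-- The class of an extension. -/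
def extCls (φ : Cocycle M N) : Ext M N 1 := (isSes_ext φ).2.extClass

theorem extClass_eq_of_hom {E E' : Paths V ⥤ 𝒜} {f : N ⟶ E} {g : E ⟶ M} {f' : N' ⟶ E'}
    {g' : E' ⟶ M'} (h : IsSes f g) (h' : IsSes f' g') (l : N ⟶ N') (m : M ⟶ M') (e : E ⟶ E')
    (hl : f ≫ e = l ≫ f') (hm : e ≫ g' = g ≫ m) :
    h.2.extClass.comp (Ext.mk₀ l) (add_zero 1) = (Ext.mk₀ m).comp h'.2.extClass (zero_add 1) :=
  ShortComplex.ShortExact.extClass_naturality h.2 h'.2 ⟨l, e, m, hl.symm, hm⟩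

/-- The diagonal maps with entries `l` and `m` form a morphism of extensions exactly under the
hypothesis `h`. -/
theorem extCls_naturality (φ : Cocycle M N) (φ' : Cocycle M' N') (l : N ⟶ N') (m : M ⟶ M')
    (h : ∀ p, φ p ≫ app l p.2.1 = app m p.1 ≫ φ' p) :
    (extCls φ).comp (Ext.mk₀ l) (add_zero 1) = (Ext.mk₀ m).comp (extCls φ') (zero_add 1) := by
  refine extClass_eq_of_hom (isSes_ext φ) (isSes_ext φ') l m
    (homToExt φ' (E := extObj φ) (fun i => biprod.map (app l i) (app m i)) fun p => ?_)
    (hom_ext fun i => ?_) (hom_ext fun i => ?_)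
  · rw [act_extObj φ p]
    have key : extMat φ p ≫ biprod.map (app l p.2.1) (app m p.2.1) =
        biprod.map (app l p.1) (app m p.1) ≫ extMat φ' p := by
      rw [extMat, extMat]
      ext <;> simp [-Paths.of_map, h]
    exact key
  · change biprod.inl ≫ biprod.map (app l i) (app m i) = app l i ≫ biprod.inl
    simp
  · change biprod.map (app l i) (app m i) ≫ biprod.snd = biprod.snd ≫ app m i
    simp

theorem extCls_comp (φ : Cocycle M N) (l : N ⟶ N') :
    (extCls φ).comp (Ext.mk₀ l) (add_zero 1) = extCls (fun p => φ p ≫ app l p.2.1) := by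
  rw [extCls_naturality φ (fun p => φ p ≫ app l p.2.1) l (𝟙 M) (by simp), Ext.mk₀_id_comp]

theorem comp_extCls (φ : Cocycle M N) (m : M' ⟶ M) :
    (Ext.mk₀ m).comp (extCls φ) (zero_add 1) = extCls (fun p => app m p.1 ≫ φ p) := by
  rw [← extCls_naturality (fun p => app m p.1 ≫ φ p) φ (𝟙 N) m (by simp), Ext.comp_mk₀_id]

/-- A single cocycle `χ` on `M ⊞ M` restricts to `φ`, `ψ` and `φ + ψ` along the two inclusions and
their sum. Additivity of composition in `Ext` then suffices, and no Baer sum has to be computed. -/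
theorem extCls_add (φ ψ : Cocycle M N) : extCls (φ + ψ) = extCls φ + extCls ψ := by
  let χ : Cocycle (M ⊞ M) N := fun p =>
    app (biprod.fst : M ⊞ M ⟶ M) p.1 ≫ φ p + app (biprod.snd : M ⊞ M ⟶ M) p.1 ≫ ψ p
  have h₁ (i : V) : app (biprod.inl : M ⟶ M ⊞ M) i ≫ app (biprod.fst : M ⊞ M ⟶ M) i = 𝟙 _ :=
    congrArg (fun t => app t i) (biprod.inl_fst : (biprod.inl : M ⟶ M ⊞ M) ≫ biprod.fst = 𝟙 M)
  have h₂ (i : V) : app (biprod.inl : M ⟶ M ⊞ M) i ≫ app (biprod.snd : M ⊞ M ⟶ M) i = 0 :=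
    congrArg (fun t => app t i) (biprod.inl_snd : (biprod.inl : M ⟶ M ⊞ M) ≫ biprod.snd = 0)
  have h₃ (i : V) : app (biprod.inr : M ⟶ M ⊞ M) i ≫ app (biprod.fst : M ⊞ M ⟶ M) i = 0 :=
    congrArg (fun t => app t i) (biprod.inr_fst : (biprod.inr : M ⟶ M ⊞ M) ≫ biprod.fst = 0)
  have h₄ (i : V) : app (biprod.inr : M ⟶ M ⊞ M) i ≫ app (biprod.snd : M ⊞ M ⟶ M) i = 𝟙 _ :=
    congrArg (fun t => app t i) (biprod.inr_snd : (biprod.inr : M ⟶ M ⊞ M) ≫ biprod.snd = 𝟙 M)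
  have e₁ : (Ext.mk₀ biprod.inl).comp (extCls χ) (zero_add 1) = extCls φ := by
    rw [comp_extCls]
    congr 1
    funext p
    simp [χ, reassoc_of% h₁, reassoc_of% h₂]
  have e₂ : (Ext.mk₀ biprod.inr).comp (extCls χ) (zero_add 1) = extCls ψ := by
    rw [comp_extCls]
    congr 1
    funext p
    simp [χ, reassoc_of% h₃, reassoc_of% h₄]
  have e₃ : (Ext.mk₀ (biprod.inl + biprod.inr)).comp (extCls χ) (zero_add 1) =
      extCls (φ + ψ) := by
    rw [comp_extCls]
    congr 1
    funext p
    simp [χ, reassoc_of% h₁, reassoc_of% h₂, reassoc_of% h₃, reassoc_of% h₄]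
  rw [← e₁, ← e₂, ← e₃, Ext.mk₀_add, Ext.add_comp]

section linear

variable {k : Type*} [Field k] [Linear k 𝒜]

theorem extCls_smul (c : k) (φ : Cocycle M N) : extCls (c • φ) = c • extCls φ := by
  have := comp_extCls φ (c • 𝟙 M)
  rw [Ext.mk₀_smul, Ext.smul_comp, Ext.mk₀_id_comp] at this
  rw [this]
  congr 1
  funext p
  simp

variable (k M N) in
/-- The class of an extension, as a linear map. -/
def extClsLin : Cocycle M N →ₗ[k] Ext M N 1 where
  toFun := extCls
  map_add' := extCls_add
  map_smul' := extCls_smul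

variable (k M N) in
/-- The coboundary of a family of morphisms at the vertices. -/
def coboundary : (∀ i : V, at' M i ⟶ at' N i) →ₗ[k] Cocycle M N where
  toFun ψ p := ψ p.1 ≫ act N p.2.2 - act M p.2.2 ≫ ψ p.2.1
  map_add' ψ ψ' := by
    funext p
    simp
    abel
  map_smul' c ψ := by
    funext p
    simp [smul_sub]

/-- The class vanishes exactly when the extension has a retraction onto `N`. Such a retraction is
`(1, ψ)` at the vertices, and its compatibility with the arrows says that `φ` is the coboundary of
`ψ`. -/
theorem extCls_eq_zero_iff (φ : Cocycle M N) :
    extCls φ = 0 ↔ ∃ ψ, coboundary M N k ψ = φ := by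
  constructor
  · intro h
    obtain ⟨r, hr⟩ := Ext.contravariant_sequence_exact₁ (isSes_ext φ).2 _ (Ext.mk₀ (𝟙 N))
      (add_zero 1) (by
        rw [Ext.comp_mk₀_id]
        exact h)
    obtain ⟨ρ, rfl⟩ := (Ext.mk₀_bijective _ _).2 r
    dsimp only at hr
    rw [Ext.mk₀_comp_mk₀] at hr
    have hρ := (Ext.mk₀_bijective _ _).1 hr
    obtain ⟨r, h₁, h₂⟩ : ∃ r : ∀ i : V, at' N i ⊞ at' M i ⟶ at' N i,
        (∀ p : QArrow V, extMat φ p ≫ r p.2.1 = r p.1 ≫ act N p.2.2) ∧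
          ∀ i, biprod.inl ≫ r i = 𝟙 _ :=
      ⟨fun i => app ρ i, fun p => by
        rw [← act_extObj φ p]
        exact act_app ρ p.2.2, fun i => congrArg (fun t => app t i) hρ⟩
    refine ⟨fun i => biprod.inr ≫ r i, funext fun p => ?_⟩
    have h₃ := congrArg (biprod.inr ≫ ·) (h₁ p)
    dsimp only [extMat] at h₃
    rw [biprod.inr_desc_assoc, Preadditive.add_comp, Category.assoc, Category.assoc, h₂,
      Category.comp_id] at h₃
    exact sub_eq_of_eq_add ((Category.assoc _ _ _).trans h₃.symm)
  · rintro ⟨ψ, rfl⟩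
    let ρ : extObj (coboundary M N k ψ) ⟶ N :=
      homFromExt _ (fun i => biprod.desc (𝟙 (at' N i)) (ψ i)) fun p => by
        rw [extMat]
        ext <;> simp [coboundary]
    have hρ : extι _ ≫ ρ = 𝟙 N := hom_ext fun i => by
      change (biprod.inl : at' N i ⟶ at' N i ⊞ at' M i) ≫ biprod.desc (𝟙 (at' N i)) (ψ i) = 𝟙 _
      simp
    rw [← Ext.comp_mk₀_id (extCls _), ← hρ, ← Ext.mk₀_comp_mk₀]
    exact (isSes_ext _).2.extClass_comp_assoc _

end linear

variable [∀ X : 𝒜, Projective X]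

/-- Sections `s` of `g` exist at the vertices. Their failure to commute with an arrow dies in `M`,
so it factors through `N` and gives the cocycle. -/
theorem exists_extCls_eq {E : Paths V ⥤ 𝒜} {f : N ⟶ E} {g : E ⟶ M} (h : IsSes f g) :
    ∃ φ : Cocycle M N, extCls φ = h.2.extClass := by
  have hi (i : V) := isSes_iff.1 h i
  have (i : V) := (hi i).epi
  have (i : V) := (hi i).mono
  have hs : ∀ i : V, ∃ s, s ≫ app g i = 𝟙 _ := fun i =>
    ⟨Projective.factorThru (𝟙 _) (app g i), by simp⟩
  choose s hs using hs
  have hφ : ∀ p : QArrow V, ∃ φ, φ ≫ app f p.2.1 =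
      s p.1 ≫ act E p.2.2 - act M p.2.2 ≫ s p.2.1 := fun p =>
    (hi p.2.1).exists_lift _ (by
      rw [Preadditive.sub_comp, Category.assoc, Category.assoc, hs, act_app, reassoc_of% hs,
        Category.comp_id, sub_self])
  choose φ hφ using hφ
  refine ⟨φ, ?_⟩
  have := extClass_eq_of_hom (isSes_ext φ) h (𝟙 N) (𝟙 M)
    (homFromExt φ (fun i => biprod.desc (app f i) (s i)) fun p => ?_)
    (hom_ext fun i => ?_) (hom_ext fun i => ?_)
  · rwa [Ext.mk₀_id_comp, Ext.comp_mk₀_id] at this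
  · rw [extMat]
    ext
    · simp [-Paths.of_map]
    · simp [hφ p]
  · change biprod.inl ≫ biprod.desc (app f i) (s i) = 𝟙 _ ≫ app f i
    simp
  · change biprod.desc (app f i) (s i) ≫ app g i = biprod.snd ≫ 𝟙 _
    ext <;> simp [hs, (hi i).zero]

/-- A class killed by an epimorphism `p` is the class of the kernel sequence of `p` followed by a
morphism `l`. Pushing the cocycle of that sequence along `l` gives the required cocycle. -/
theorem extCls_surjective (ζ : Ext M N 1) : ∃ φ : Cocycle M N, extCls φ = ζ := by
  obtain ⟨P, p, hp, h⟩ := Ext.exists_epi_mk₀_comp_eq_zero ζ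
  have hk := IsSes.kernel p
  obtain ⟨r, rfl⟩ := Ext.contravariant_sequence_exact₃ hk.2 _ ζ h (add_zero 1)
  obtain ⟨l, rfl⟩ := (Ext.mk₀_bijective _ _).2 r
  obtain ⟨φ, hφ⟩ := exists_extCls_eq hk
  exact ⟨_, by rw [← hφ]; exact (extCls_comp φ l).symm⟩

/-- By effaceability and dimension shifting it suffices to treat degree two. There `ζ` is the image
under the connecting map of a class on the kernel of `p`, and that class extends to `P`, so its
image is zero. -/
theorem ext_eq_zero [∀ X : 𝒜, Injective X] (n : ℕ) (ζ : Ext M N (n + 2)) : ζ = 0 := by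
  induction n generalizing M with
  | zero =>
    obtain ⟨P, p, hp, h⟩ := Ext.exists_epi_mk₀_comp_eq_zero ζ
    have hk := IsSes.kernel p
    obtain ⟨r, rfl⟩ := Ext.contravariant_sequence_exact₃ hk.2 _ ζ h (n₀ := 1) rfl
    obtain ⟨φ, rfl⟩ := extCls_surjective r
    have hi (i : V) := (isSes_iff.1 hk i).mono
    -- A cocycle need not satisfy any compatibility, so it is extended arrow by arrow using
    -- injectivity.
    have hψ : ∀ p' : QArrow V, ∃ ψ, app (kernel.ι p) p'.1 ≫ ψ = φ p' := fun p' =>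
      ⟨Injective.factorThru _ (app (kernel.ι p) p'.1), Injective.comp_factorThru _ _⟩
    choose ψ hψ using hψ
    obtain rfl : (fun p' => app (kernel.ι p) p'.1 ≫ ψ p') = φ := funext hψ
    rw [← comp_extCls]
    exact hk.2.extClass_comp_assoc _
  | succ n ih =>
    obtain ⟨P, p, hp, h⟩ := Ext.exists_epi_mk₀_comp_eq_zero ζ
    obtain ⟨r, rfl⟩ := Ext.contravariant_sequence_exact₃ (IsSes.kernel p).2 _ ζ h
      (n₀ := n + 2) (by lia)
    rw [ih r, Ext.comp_zero]

end

section dimension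

variable {V : Type*} [Quiver V] [Fintype V] [Fintype (QArrow V)]
  {𝒜 : Type u} [Category.{v} 𝒜] [Abelian 𝒜] {k : Type*} [Field k] [Linear k 𝒜]
  [∀ X Y : 𝒜, Module.Finite k (X ⟶ Y)] (M N : Paths V ⥤ 𝒜)

variable (k) in
/-- Morphisms of representations are the kernel of the coboundary. -/
def homEquivKer : (M ⟶ N) ≃ₗ[k] LinearMap.ker (coboundary M N k) where
  toFun f := ⟨fun i => app f i, by
    rw [LinearMap.mem_ker]
    funext p
    exact sub_eq_zero.2 (act_app f p.2.2).symm⟩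
  map_add' _ _ := rfl
  map_smul' _ _ := rfl
  invFun ψ := homMk ψ.1 fun {i j} a => (sub_eq_zero.1 (congrFun (LinearMap.mem_ker.1 ψ.2)
    ⟨i, j, a⟩)).symm
  left_inv _ := rfl
  right_inv _ := rfl

variable (k) in
theorem finite_hom : Module.Finite k (M ⟶ N) :=
  Module.Finite.equiv (homEquivKer k M N).symm

variable [HasExt.{w} (Paths V ⥤ 𝒜)] [∀ X : 𝒜, Projective X]

theorem range_extClsLin : LinearMap.range (extClsLin M N k) = ⊤ :=
  LinearMap.range_eq_top.2 extCls_surjective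

variable (k) in
theorem finite_ext_one : Module.Finite k (Ext M N 1) :=
  Module.Finite.of_surjective (extClsLin M N k) extCls_surjective

theorem ker_extClsLin :
    LinearMap.ker (extClsLin M N k) = LinearMap.range (coboundary M N k) := by
  ext φ
  exact extCls_eq_zero_iff φ

variable (k) in
-- Rank-nullity for `coboundary` and `extClsLin`: `Hom` is the kernel of the former and `Ext¹` its
-- cokernel.
theorem finrank_hom_sub_finrank_ext :
    (Module.finrank k (M ⟶ N) : ℤ) - Module.finrank k (Ext M N 1) =
      ∑ i : V, (Module.finrank k (at' M i ⟶ at' N i) : ℤ) -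
        ∑ p : QArrow V, (Module.finrank k (at' M p.1 ⟶ at' N p.2.1) : ℤ) := by
  have h₁ := LinearMap.finrank_range_add_finrank_ker (coboundary M N k)
  have h₂ := LinearMap.finrank_range_add_finrank_ker (extClsLin M N k)
  rw [ker_extClsLin, range_extClsLin, finrank_top, Module.finrank_pi_fintype] at h₂
  rw [← (homEquivKer k M N).finrank_eq, Module.finrank_pi_fintype] at h₁
  zify at h₁ h₂
  linarith

end dimension

end QRep

end

noncomputable section

/-! ### Bialgebras in graded vector spaces from structure constants -/

/-- Structure constants of a bialgebra with basis `S` in the category of `K`-graded vector spaces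
with the braiding given by `χ` and `q`. -/
structure StructConst {S : Type v} {K : Type u} [AddCommGroup K] (deg : S → K) (χ : K →+ K →+ ℤ)
    (q : ℝ) where
  m : S → S → (S →₀ ℝ)
  d : S → (S × S →₀ ℝ)
  e : S
  deg_m : ∀ x y z, m x y z ≠ 0 → deg z = deg x + deg y
  deg_d : ∀ z x y, d z (x, y) ≠ 0 → deg x + deg y = deg z
  deg_e : deg e = 0
  one_mul : ∀ x, m e x = Finsupp.single x 1
  mul_one : ∀ x, m x e = Finsupp.single x 1
  -- These sums have finite support, since `m` and `d` take finitely supported values.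
  mul_assoc : ∀ x y z w, ∑' t, m x y t * m t z w = ∑' t, m y z t * m x t w
  counit_comul : ∀ z y, d z (e, y) = Finsupp.single z 1 y
  comul_counit : ∀ z y, d z (y, e) = Finsupp.single z 1 y
  comul_assoc : ∀ z x y w, ∑' t, d z (x, t) * d t (y, w) = ∑' t, d z (t, w) * d t (x, y)
  one_comul : d e = Finsupp.single (e, e) 1
  mul_counit : ∀ x y, m x y e = Finsupp.single e 1 x * Finsupp.single e 1 y
  mul_comul : ∀ x y u v, ∑' t, m x y t * d t (u, v) =
    ∑' p : (S × S) × (S × S), d x p.1 * d y p.2 *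
      (q ^ (-χ (deg p.1.2) (deg p.2.1)) * (m p.1.1 p.2.1 u * m p.1.2 p.2.2 v))

section linear

variable {S T : Type*}

/-- This and its two tensor versions reduce equalities of linear maps to the coefficient identities
in `StructConst`. -/
theorem Finsupp.linearMap_apply_eq_tsum (l : (S →₀ ℝ) →ₗ[ℝ] ℝ) (f : S →₀ ℝ) :
    l f = ∑' s, f s * l (Finsupp.single s 1) := by
  rw [tsum_eq_sum (s := f.support) fun s hs => by rw [Finsupp.notMem_support_iff.1 hs, zero_mul]]
  conv_lhs => rw [← Finsupp.sum_single f, Finsupp.sum, map_sum]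
  refine Finset.sum_congr rfl fun s _ => ?_
  rw [← smul_eq_mul, ← map_smul, Finsupp.smul_single, smul_eq_mul, _root_.mul_one]

theorem Finsupp.linearMap_tmul_eq_tsum (l : (S →₀ ℝ) ⊗[ℝ] (T →₀ ℝ) →ₗ[ℝ] ℝ) (f : S →₀ ℝ)
    (g : T →₀ ℝ) : l (f ⊗ₜ g) =
      ∑' p : S × T, f p.1 * g p.2 * l (Finsupp.single p.1 1 ⊗ₜ Finsupp.single p.2 1) := by
  have h := Finsupp.linearMap_apply_eq_tsum
    (l ∘ₗ (finsuppTensorFinsupp' ℝ S T).symm.toLinearMap) (finsuppTensorFinsupp' ℝ S T (f ⊗ₜ g))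
  simp only [LinearMap.comp_apply, LinearEquiv.coe_coe, LinearEquiv.symm_apply_apply] at h
  rw [h]
  refine tsum_congr fun p => ?_
  rw [finsuppTensorFinsupp'_apply_apply,
    finsuppTensorFinsupp'_symm_single_eq_single_one_tmul]

theorem Finsupp.linearMap_symm_eq_tsum (l : (S →₀ ℝ) ⊗[ℝ] (T →₀ ℝ) →ₗ[ℝ] ℝ) (f : S × T →₀ ℝ) :
    l ((finsuppTensorFinsupp' ℝ S T).symm f) =
      ∑' p : S × T, f p * l (Finsupp.single p.1 1 ⊗ₜ Finsupp.single p.2 1) := by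
  have h := Finsupp.linearMap_apply_eq_tsum
    (l ∘ₗ (finsuppTensorFinsupp' ℝ S T).symm.toLinearMap) f
  simp only [LinearMap.comp_apply, LinearEquiv.coe_coe] at h
  rw [h]
  refine tsum_congr fun p => ?_
  rw [finsuppTensorFinsupp'_symm_single_eq_single_one_tmul]

/-- The coefficient at a pair of basis elements. -/
def coeff₂ (x : S) (y : T) : (S →₀ ℝ) ⊗[ℝ] (T →₀ ℝ) →ₗ[ℝ] ℝ :=
  LinearMap.mul' ℝ ℝ ∘ₗ TensorProduct.map (Finsupp.lapply x) (Finsupp.lapply y)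

@[simp] theorem coeff₂_tmul (x : S) (y : T) (f : S →₀ ℝ) (g : T →₀ ℝ) :
    coeff₂ x y (f ⊗ₜ g) = f x * g y := rfl

theorem coeff₂_eq (x : S) (y : T) (t : (S →₀ ℝ) ⊗[ℝ] (T →₀ ℝ)) :
    coeff₂ x y t = finsuppTensorFinsupp' ℝ S T t (x, y) := by
  have : coeff₂ x y = Finsupp.lapply (x, y) ∘ₗ (finsuppTensorFinsupp' ℝ S T).toLinearMap :=
    TensorProduct.ext' fun f g => by simp
  rw [this]
  rfl

theorem coeff₂_symm (x : S) (y : T) (f : S × T →₀ ℝ) :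
    coeff₂ x y ((finsuppTensorFinsupp' ℝ S T).symm f) = f (x, y) := by
  rw [coeff₂_eq, LinearEquiv.apply_symm_apply]

theorem ext_coeff₂ {t t' : (S →₀ ℝ) ⊗[ℝ] (T →₀ ℝ)} (h : ∀ x y, coeff₂ x y t = coeff₂ x y t') :
    t = t' := by
  refine (finsuppTensorFinsupp' ℝ S T).injective (Finsupp.ext fun p => ?_)
  rw [← coeff₂_eq, ← coeff₂_eq, h]

/-- The coefficient at a triple of basis elements. -/
def coeff₃ (x y z : S) : (S →₀ ℝ) ⊗[ℝ] ((S →₀ ℝ) ⊗[ℝ] (S →₀ ℝ)) →ₗ[ℝ] ℝ :=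
  LinearMap.mul' ℝ ℝ ∘ₗ TensorProduct.map (Finsupp.lapply x) (coeff₂ y z)

@[simp] theorem coeff₃_tmul (x y z : S) (f : S →₀ ℝ) (t : (S →₀ ℝ) ⊗[ℝ] (S →₀ ℝ)) :
    coeff₃ x y z (f ⊗ₜ t) = f x * coeff₂ y z t := rfl

theorem ext_coeff₃ {t t' : (S →₀ ℝ) ⊗[ℝ] ((S →₀ ℝ) ⊗[ℝ] (S →₀ ℝ))}
    (h : ∀ x y z, coeff₃ x y z t = coeff₃ x y z t') : t = t' := by
  refine (TensorProduct.congr (LinearEquiv.refl ℝ (S →₀ ℝ))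
    (finsuppTensorFinsupp' ℝ S S)).injective (ext_coeff₂ fun x p => ?_)
  have : ∀ t, coeff₂ x p ((TensorProduct.congr (LinearEquiv.refl ℝ (S →₀ ℝ))
      (finsuppTensorFinsupp' ℝ S S)) t) = coeff₃ x p.1 p.2 t := by
    intro t
    induction t with
    | zero => simp
    | add a b ha hb => rw [map_add, map_add, map_add, ha, hb]
    | tmul f t => simp [coeff₂_eq]
  rw [this, this, h]

end linear

namespace StructConst

variable {S : Type v} {K : Type u} [AddCommGroup K] {deg : S → K} {χ : K →+ K →+ ℤ} {q : ℝ}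
  (c : StructConst deg χ q)

/-- The multiplication. -/
def mulLin : (S →₀ ℝ) ⊗[ℝ] (S →₀ ℝ) →ₗ[ℝ] (S →₀ ℝ) :=
  Finsupp.linearCombination ℝ (fun p : S × S => c.m p.1 p.2) ∘ₗ
    (finsuppTensorFinsupp' ℝ S S).toLinearMap

/-- The comultiplication. -/
def comulLin : (S →₀ ℝ) →ₗ[ℝ] (S →₀ ℝ) ⊗[ℝ] (S →₀ ℝ) :=
  (finsuppTensorFinsupp' ℝ S S).symm.toLinearMap ∘ₗ Finsupp.linearCombination ℝ c.d

theorem mulLin_single (x y : S) :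
    c.mulLin (Finsupp.single x 1 ⊗ₜ Finsupp.single y 1) = c.m x y := by
  simp [mulLin]

theorem comulLin_single (z : S) :
    c.comulLin (Finsupp.single z 1) = (finsuppTensorFinsupp' ℝ S S).symm (c.d z) := by
  simp [comulLin]

theorem mulLin_assoc :
    c.mulLin ∘ₗ TensorProduct.map c.mulLin LinearMap.id =
      c.mulLin ∘ₗ TensorProduct.map LinearMap.id c.mulLin ∘ₗ
        (TensorProduct.assoc ℝ (S →₀ ℝ) (S →₀ ℝ) (S →₀ ℝ)).toLinearMap := by
  refine TensorProduct.ext_threefold fun f g h => ?_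
  induction f using Finsupp.induction_linear with
  | zero => simp
  | add f f' hf hf' => simp only [TensorProduct.add_tmul, map_add, hf, hf']
  | single x r =>
  induction g using Finsupp.induction_linear with
  | zero => simp
  | add f f' hf hf' => simp only [TensorProduct.add_tmul, TensorProduct.tmul_add, map_add, hf, hf']
  | single y s =>
  induction h using Finsupp.induction_linear with
  | zero => simp
  | add f f' hf hf' => simp only [TensorProduct.tmul_add, map_add, hf, hf']
  | single z t =>
  rw [← Finsupp.smul_single_one x r, ← Finsupp.smul_single_one y s, ← Finsupp.smul_single_one z t]
  simp only [TensorProduct.tmul_smul, ← TensorProduct.smul_tmul', map_smul]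
  congr 3
  simp only [LinearMap.comp_apply, TensorProduct.map_tmul, LinearMap.id_apply, mulLin_single,
    LinearEquiv.coe_coe, TensorProduct.assoc_tmul]
  ext w
  have h₁ := Finsupp.linearMap_apply_eq_tsum (Finsupp.lapply w ∘ₗ c.mulLin ∘ₗ
    (TensorProduct.mk ℝ (S →₀ ℝ) (S →₀ ℝ)).flip (Finsupp.single z 1)) (c.m x y)
  have h₂ := Finsupp.linearMap_apply_eq_tsum (Finsupp.lapply w ∘ₗ c.mulLin ∘ₗ
    TensorProduct.mk ℝ (S →₀ ℝ) (S →₀ ℝ) (Finsupp.single x 1)) (c.m y z)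
  simp only [LinearMap.comp_apply, LinearMap.flip_apply, TensorProduct.mk_apply, mulLin_single,
    Finsupp.lapply_apply] at h₁ h₂
  rw [h₁, h₂, c.mul_assoc]

theorem comulLin_assoc :
    TensorProduct.map LinearMap.id c.comulLin ∘ₗ c.comulLin =
      (TensorProduct.assoc ℝ (S →₀ ℝ) (S →₀ ℝ) (S →₀ ℝ)).toLinearMap ∘ₗ
        TensorProduct.map c.comulLin LinearMap.id ∘ₗ c.comulLin := by
  classical
  refine Finsupp.lhom_ext' fun z => LinearMap.ext_ring (ext_coeff₃ fun x y w => ?_)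
  simp only [LinearMap.comp_apply, Finsupp.lsingle_apply, comulLin_single]
  have h₁ := Finsupp.linearMap_symm_eq_tsum (coeff₃ x y w ∘ₗ
    TensorProduct.map LinearMap.id c.comulLin) (c.d z)
  have h₂ := Finsupp.linearMap_symm_eq_tsum (coeff₃ x y w ∘ₗ
    (TensorProduct.assoc ℝ (S →₀ ℝ) (S →₀ ℝ) (S →₀ ℝ)).toLinearMap ∘ₗ
    TensorProduct.map c.comulLin LinearMap.id) (c.d z)
  have h₃ : ∀ (t : (S →₀ ℝ) ⊗[ℝ] (S →₀ ℝ)) (f : S →₀ ℝ), coeff₃ x y w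
      (TensorProduct.assoc ℝ (S →₀ ℝ) (S →₀ ℝ) (S →₀ ℝ) (t ⊗ₜ f)) = coeff₂ x y t * f w := by
    intro t f
    induction t with
    | zero => simp
    | add a b ha hb => rw [TensorProduct.add_tmul, map_add, map_add, map_add, ha, hb, add_mul]
    | tmul f t => simp [_root_.mul_assoc]
  simp only [LinearMap.comp_apply, TensorProduct.map_tmul, LinearMap.id_apply, coeff₃_tmul,
    comulLin_single, coeff₂_symm, LinearEquiv.coe_coe, h₃] at h₁ h₂
  simp only [LinearEquiv.coe_coe]
  rw [h₁, h₂]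
  -- The identity factor contributes a Kronecker delta, which leaves only pairs with first entry
  -- `x`, and on the other side only pairs with second entry `w`.
  trans ∑' t, c.d z (x, t) * c.d t (y, w)
  · rw [← (Prod.mk_right_injective x).tsum_eq]
    · simp
    · rintro ⟨a, b⟩ h
      by_contra hab
      have : x ≠ a := fun h' => hab ⟨b, by rw [h']⟩
      exact h (by simp [this.symm])
  · rw [c.comul_assoc, ← (Prod.mk_left_injective w).tsum_eq (f := fun p : S × S =>
      c.d z p * (c.d p.1 (x, y) * Finsupp.single p.2 (1 : ℝ) w))]
    · simp
    · rintro ⟨a, b⟩ h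
      by_contra hab
      have : w ≠ b := fun h' => hab ⟨a, by rw [h']⟩
      exact h (by simp [this.symm])

end StructConst

end

/-! ### Units, counits, compatibility, and the bialgebra object -/

noncomputable section

theorem Finsupp.tensor_lhom_ext {S T W : Type*} [AddCommGroup W] [Module ℝ W]
    {f g : (S →₀ ℝ) ⊗[ℝ] (T →₀ ℝ) →ₗ[ℝ] W}
    (h : ∀ x y, f (Finsupp.single x 1 ⊗ₜ Finsupp.single y 1) =
      g (Finsupp.single x 1 ⊗ₜ Finsupp.single y 1)) : f = g :=
  TensorProduct.ext (Finsupp.lhom_ext' fun x => LinearMap.ext_ring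
    (Finsupp.lhom_ext' fun y => LinearMap.ext_ring (h x y)))

/-- The map `(a ⊗ b) ⊗ (c ⊗ d) ↦ (a ⊗ c) ⊗ (b ⊗ d)`, where the two inner factors are interchanged
by `β`. -/
def TensorProduct.interchange {W X Y Z : Type*} [AddCommGroup W] [Module ℝ W] [AddCommGroup X]
    [Module ℝ X] [AddCommGroup Y] [Module ℝ Y] [AddCommGroup Z] [Module ℝ Z]
    (β : X ⊗[ℝ] Y →ₗ[ℝ] Y ⊗[ℝ] X) :
    (W ⊗[ℝ] X) ⊗[ℝ] (Y ⊗[ℝ] Z) →ₗ[ℝ] (W ⊗[ℝ] Y) ⊗[ℝ] (X ⊗[ℝ] Z) :=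
  (TensorProduct.assoc ℝ W Y (X ⊗[ℝ] Z)).symm.toLinearMap ∘ₗ
    TensorProduct.map LinearMap.id (TensorProduct.assoc ℝ Y X Z).toLinearMap ∘ₗ
    TensorProduct.map LinearMap.id (TensorProduct.map β LinearMap.id) ∘ₗ
    TensorProduct.map LinearMap.id (TensorProduct.assoc ℝ X Y Z).symm.toLinearMap ∘ₗ
    (TensorProduct.assoc ℝ W X (Y ⊗[ℝ] Z)).toLinearMap

theorem TensorProduct.interchange_tmul {W X Y Z : Type*} [AddCommGroup W] [Module ℝ W]
    [AddCommGroup X] [Module ℝ X] [AddCommGroup Y] [Module ℝ Y] [AddCommGroup Z] [Module ℝ Z]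
    (β : X ⊗[ℝ] Y →ₗ[ℝ] Y ⊗[ℝ] X) {r : ℝ} {w : W} {x : X} {y : Y} {z : Z}
    (h : β (x ⊗ₜ y) = r • (y ⊗ₜ x)) :
    TensorProduct.interchange β ((w ⊗ₜ x) ⊗ₜ (y ⊗ₜ z)) = r • ((w ⊗ₜ y) ⊗ₜ (x ⊗ₜ z)) := by
  simp only [interchange, LinearMap.comp_apply, LinearEquiv.coe_coe, TensorProduct.assoc_tmul,
    TensorProduct.map_tmul, LinearMap.id_apply, TensorProduct.assoc_symm_tmul, h,
    ← TensorProduct.smul_tmul', TensorProduct.tmul_smul, map_smul]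

namespace StructConst

variable {S : Type v} {K : Type u} [AddCommGroup K] {deg : S → K} {χ : K →+ K →+ ℤ} {q : ℝ}
  (c : StructConst deg χ q)

/-- The unit. -/
def oneLin : ULift.{v} ℝ →ₗ[ℝ] (S →₀ ℝ) :=
  Finsupp.lsingle c.e ∘ₗ ULift.moduleEquiv.toLinearMap

/-- The counit. -/
def counitLin : (S →₀ ℝ) →ₗ[ℝ] ULift.{v} ℝ :=
  ULift.moduleEquiv.symm.toLinearMap ∘ₗ Finsupp.lapply c.e

theorem oneLin_mulLin :
    c.mulLin ∘ₗ TensorProduct.map c.oneLin LinearMap.id =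
      (TensorProduct.congr ULift.moduleEquiv (LinearEquiv.refl ℝ (S →₀ ℝ)) ≪≫ₗ
        TensorProduct.lid ℝ (S →₀ ℝ)).toLinearMap := by
  refine TensorProduct.ext (LinearMap.ext fun r => Finsupp.lhom_ext' fun x =>
    LinearMap.ext_ring ?_)
  change c.mulLin (Finsupp.single c.e r.down ⊗ₜ Finsupp.single x 1) = r.down • Finsupp.single x 1
  rw [← Finsupp.smul_single_one c.e r.down, ← TensorProduct.smul_tmul', map_smul, mulLin_single,
    c.one_mul]

theorem mulLin_oneLin :
    c.mulLin ∘ₗ TensorProduct.map LinearMap.id c.oneLin =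
      (TensorProduct.congr (LinearEquiv.refl ℝ (S →₀ ℝ)) ULift.moduleEquiv ≪≫ₗ
        TensorProduct.rid ℝ (S →₀ ℝ)).toLinearMap := by
  refine TensorProduct.ext (Finsupp.lhom_ext' fun x => LinearMap.ext_ring <|
    LinearMap.ext fun r => ?_)
  change c.mulLin (Finsupp.single x 1 ⊗ₜ Finsupp.single c.e r.down) = r.down • Finsupp.single x 1
  rw [← Finsupp.smul_single_one c.e r.down, TensorProduct.tmul_smul, map_smul, mulLin_single,
    c.mul_one]

theorem counitLin_comulLin :
    (TensorProduct.congr ULift.moduleEquiv (LinearEquiv.refl ℝ (S →₀ ℝ)) ≪≫ₗ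
      TensorProduct.lid ℝ (S →₀ ℝ)).toLinearMap ∘ₗ
      TensorProduct.map c.counitLin LinearMap.id ∘ₗ c.comulLin = LinearMap.id := by
  refine Finsupp.lhom_ext' fun z => LinearMap.ext_ring (Finsupp.ext fun y => ?_)
  have h : Finsupp.lapply y ∘ₗ
      (TensorProduct.congr ULift.moduleEquiv (LinearEquiv.refl ℝ (S →₀ ℝ)) ≪≫ₗ
        TensorProduct.lid ℝ (S →₀ ℝ)).toLinearMap ∘ₗ
      TensorProduct.map c.counitLin LinearMap.id = coeff₂ c.e y :=
    TensorProduct.ext' fun f g => rfl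
  refine (LinearMap.congr_fun h (c.comulLin (Finsupp.single z 1))).trans ?_
  rw [comulLin_single, coeff₂_symm, c.counit_comul]
  rfl

theorem comulLin_counitLin :
    (TensorProduct.congr (LinearEquiv.refl ℝ (S →₀ ℝ)) ULift.moduleEquiv ≪≫ₗ
      TensorProduct.rid ℝ (S →₀ ℝ)).toLinearMap ∘ₗ
      TensorProduct.map LinearMap.id c.counitLin ∘ₗ c.comulLin = LinearMap.id := by
  refine Finsupp.lhom_ext' fun z => LinearMap.ext_ring (Finsupp.ext fun y => ?_)
  have h : Finsupp.lapply y ∘ₗ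
      (TensorProduct.congr (LinearEquiv.refl ℝ (S →₀ ℝ)) ULift.moduleEquiv ≪≫ₗ
        TensorProduct.rid ℝ (S →₀ ℝ)).toLinearMap ∘ₗ
      TensorProduct.map LinearMap.id c.counitLin = coeff₂ y c.e :=
    TensorProduct.ext' fun f g => mul_comm (g c.e) (f y)
  refine (LinearMap.congr_fun h (c.comulLin (Finsupp.single z 1))).trans ?_
  rw [comulLin_single, coeff₂_symm, c.comul_counit]
  rfl

theorem comulLin_oneLin (r : ULift.{v} ℝ) :
    c.comulLin (c.oneLin r) = c.oneLin (ULift.up 1) ⊗ₜ c.oneLin r := by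
  change c.comulLin (Finsupp.single c.e r.down) = Finsupp.single c.e 1 ⊗ₜ Finsupp.single c.e r.down
  rw [← Finsupp.smul_single_one c.e r.down, map_smul, comulLin_single, c.one_comul,
    TensorProduct.tmul_smul, finsuppTensorFinsupp'_symm_single_eq_single_one_tmul]

theorem counitLin_mulLin :
    c.counitLin ∘ₗ c.mulLin =
      (TensorProduct.congr ULift.moduleEquiv (LinearEquiv.refl ℝ (ULift.{v} ℝ)) ≪≫ₗ
        TensorProduct.lid ℝ (ULift.{v} ℝ)).toLinearMap ∘ₗ
        TensorProduct.map c.counitLin c.counitLin := by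
  classical
  refine Finsupp.tensor_lhom_ext fun x y => ?_
  change ULift.up (c.mulLin (Finsupp.single x 1 ⊗ₜ Finsupp.single y 1) c.e) =
    ULift.up ((Finsupp.single x (1 : ℝ) c.e) * Finsupp.single y (1 : ℝ) c.e)
  rw [mulLin_single, c.mul_counit]
  simp only [Finsupp.single_apply, eq_comm]

theorem comulLin_mulLin (β : (S →₀ ℝ) ⊗[ℝ] (S →₀ ℝ) →ₗ[ℝ] (S →₀ ℝ) ⊗[ℝ] (S →₀ ℝ))
    (hβ : ∀ x y, β (Finsupp.single x 1 ⊗ₜ Finsupp.single y 1) =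
      q ^ (-χ (deg x) (deg y)) • (Finsupp.single y 1 ⊗ₜ Finsupp.single x 1)) :
    c.comulLin ∘ₗ c.mulLin = TensorProduct.map c.mulLin c.mulLin ∘ₗ
      TensorProduct.interchange β ∘ₗ TensorProduct.map c.comulLin c.comulLin := by
  refine Finsupp.tensor_lhom_ext fun x y => ext_coeff₂ fun u v => ?_
  have h₁ := Finsupp.linearMap_apply_eq_tsum (coeff₂ u v ∘ₗ c.comulLin) (c.m x y)
  have h₂ := Finsupp.linearMap_tmul_eq_tsum (coeff₂ u v ∘ₗ TensorProduct.map c.mulLin c.mulLin ∘ₗ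
    TensorProduct.interchange β ∘ₗ TensorProduct.map (finsuppTensorFinsupp' ℝ S S).symm.toLinearMap
      (finsuppTensorFinsupp' ℝ S S).symm.toLinearMap) (c.d x) (c.d y)
  simp only [LinearMap.comp_apply, TensorProduct.map_tmul, LinearEquiv.coe_coe,
    finsuppTensorFinsupp'_symm_single_eq_single_one_tmul, comulLin_single, coeff₂_symm,
    TensorProduct.interchange_tmul β (hβ _ _), map_smul, mulLin_single, coeff₂_tmul,
    smul_eq_mul] at h₁ h₂
  simp only [LinearMap.comp_apply, TensorProduct.map_tmul, comulLin_single, mulLin_single]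
  rw [h₁, h₂, c.mul_comul]

theorem single_mem (deg : S → K) (x : S) :
    (Finsupp.single x 1 : S →₀ ℝ) ∈ Finsupp.supported ℝ ℝ (deg ⁻¹' {deg x}) :=
  Finsupp.single_mem_supported ℝ 1 rfl

/-- A graded piece of the tensor square is spanned by tensors of basis elements, so preservation of
degrees by `mulLin` can be tested on those. -/
theorem tensorPiece_free_le (deg : S → K) (d : K) (p : Submodule ℝ ((S →₀ ℝ) ⊗[ℝ] (S →₀ ℝ)))
    (h : ∀ x y, deg x + deg y = d → Finsupp.single x 1 ⊗ₜ Finsupp.single y 1 ∈ p) :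
    GrVect.tensorPiece (GrVect.free deg) (GrVect.free deg) d ≤ p := by
  refine GrVect.tensorPiece_le (X := GrVect.free deg) (Y := GrVect.free deg)
    fun a b f g hab hf hg => ?_
  have hfa : f ∈ Submodule.span ℝ ((fun i => Finsupp.single i (1 : ℝ)) '' (deg ⁻¹' {a})) := by
    rw [← Finsupp.supported_eq_span_single]
    exact hf
  have hgb : g ∈ Submodule.span ℝ ((fun i => Finsupp.single i (1 : ℝ)) '' (deg ⁻¹' {b})) := by
    rw [← Finsupp.supported_eq_span_single]
    exact hg
  have key : ∀ f ∈ Submodule.span ℝ ((fun i => Finsupp.single i (1 : ℝ)) '' (deg ⁻¹' {a})),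
      ∀ g ∈ Submodule.span ℝ ((fun i => Finsupp.single i (1 : ℝ)) '' (deg ⁻¹' {b})),
      f ⊗ₜ[ℝ] g ∈ p := by
    intro f hf g hg
    have h₁ : Submodule.span ℝ ((fun i => Finsupp.single i (1 : ℝ)) '' (deg ⁻¹' {a})) ≤
        p.comap ((TensorProduct.mk ℝ _ _).flip g) := by
      refine Submodule.span_le.2 ?_
      rintro _ ⟨x, rfl, rfl⟩
      have h₂ : Submodule.span ℝ ((fun i => Finsupp.single i (1 : ℝ)) '' (deg ⁻¹' {b})) ≤
          p.comap (TensorProduct.mk ℝ _ _ (Finsupp.single x 1)) := by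
        refine Submodule.span_le.2 ?_
        rintro _ ⟨y, rfl, rfl⟩
        exact h x y hab
      exact h₂ hg
    exact h₁ hf
  exact key f hfa g hgb

/-- The multiplication as a morphism of graded vector spaces. -/
def mulHom : GrVect.free deg ⊗ GrVect.free deg ⟶ GrVect.free deg where
  toLin := c.mulLin
  map_piece d := by
    refine tensorPiece_free_le deg d
      ((Finsupp.supported ℝ ℝ (deg ⁻¹' {d})).comap c.mulLin) fun x y hxy => ?_
    rw [Submodule.mem_comap, mulLin_single, Finsupp.mem_supported]
    intro z hz
    exact (c.deg_m x y z (Finsupp.mem_support_iff.1 hz)).trans hxy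

/-- The comultiplication as a morphism of graded vector spaces. -/
def comulHom : GrVect.free deg ⟶ GrVect.free deg ⊗ GrVect.free deg where
  toLin := c.comulLin
  map_piece d := by
    have : Finsupp.supported ℝ ℝ (deg ⁻¹' {d}) ≤
        Submodule.comap c.comulLin (GrVect.tensorPiece (GrVect.free deg) (GrVect.free deg) d) := by
      rw [Finsupp.supported_eq_span_single, Submodule.span_le]
      rintro _ ⟨z, rfl, rfl⟩
      refine Submodule.mem_comap.2 ?_
      rw [comulLin_single, ← Finsupp.sum_single (c.d z), Finsupp.sum, map_sum]
      refine Submodule.sum_mem _ fun p hp => ?_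
      rw [finsuppTensorFinsupp'_symm_single_eq_tmul_single_one,
        ← Finsupp.smul_single_one p.1, ← TensorProduct.smul_tmul']
      refine Submodule.smul_mem _ _ (GrVect.tmul_mem (X := GrVect.free deg) (Y := GrVect.free deg)
        (c.deg_d z p.1 p.2 (Finsupp.mem_support_iff.1 hp)) ?_ ?_)
      · exact single_mem deg p.1
      · exact single_mem deg p.2
    exact fun x hx => this hx

/-- The unit as a morphism of graded vector spaces. -/
def oneHom : 𝟙_ (GrVect.{v} K) ⟶ GrVect.free deg where
  toLin := c.oneLin
  map_piece d r hr := by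
    rcases GrVect.unit_piece_induction hr with rfl | rfl
    · exact Finsupp.single_mem_supported ℝ _ c.deg_e
    · have h : c.oneLin 0 ∈ Finsupp.supported ℝ ℝ (deg ⁻¹' {d}) := by
        rw [map_zero]
        exact Submodule.zero_mem _
      exact h

/-- The counit as a morphism of graded vector spaces. -/
def counitHom : GrVect.free deg ⟶ 𝟙_ (GrVect.{v} K) where
  toLin := c.counitLin
  map_piece d f hf := by
    by_cases h : d = 0
    · subst h
      exact GrVect.mem_unit_zero _
    · have : c.counitLin f = 0 := by
        have h0 : (show S →₀ ℝ from f) c.e = 0 := by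
          by_contra hne
          have : c.e ∈ deg ⁻¹' {d} := (Finsupp.mem_supported ℝ _).1 hf (Finsupp.mem_support_iff.2 hne)
          exact h (this.symm.trans c.deg_e)
        exact congrArg ULift.up h0
      have h0 : ∀ r : (GrVect.unit : GrVect.{v} K), r = 0 →
          r ∈ (GrVect.unit : GrVect.{v} K).piece d := by
        rintro _ rfl
        exact Submodule.zero_mem _
      exact h0 _ this

/-- The algebra object given by structure constants. -/
@[reducible]
def monObj : MonObj (GrVect.free deg) where
  one := c.oneHom
  mul := c.mulHom
  one_mul := GrVect.hom_ext c.oneLin_mulLin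
  mul_one := GrVect.hom_ext c.mulLin_oneLin
  mul_assoc := GrVect.hom_ext c.mulLin_assoc

/-- The coalgebra object given by structure constants. -/
@[reducible]
def comonObj : ComonObj (GrVect.free deg) where
  counit := c.counitHom
  comul := c.comulHom
  counit_comul := by
    rw [← Category.id_comp (λ_ (GrVect.free deg)).inv, Iso.eq_comp_inv]
    exact GrVect.hom_ext c.counitLin_comulLin
  comul_counit := by
    rw [← Category.id_comp (ρ_ (GrVect.free deg)).inv, Iso.eq_comp_inv]
    exact GrVect.hom_ext c.comulLin_counitLin
  comul_assoc := GrVect.hom_ext c.comulLin_assoc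

/-- The bialgebra object given by structure constants. -/
@[reducible]
def bimonObj (hq : q ≠ 0) :
    letI := GrVect.braided.{v} χ q hq
    BimonObj (GrVect.free deg) :=
  letI := GrVect.braided.{v} χ q hq
  { c.monObj, c.comonObj with
    mul_comul := GrVect.hom_ext (c.comulLin_mulLin
      (GrVect.braidLin χ q (GrVect.free deg) (GrVect.free deg)) fun x y =>
        GrVect.braidLin_tmul χ q (X := GrVect.free deg) (Y := GrVect.free deg)
          (single_mem deg x) (single_mem deg y))
    one_comul := GrVect.hom_ext (LinearMap.ext c.comulLin_oneLin)
    mul_counit := GrVect.hom_ext c.counitLin_mulLin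
    one_counit := GrVect.hom_ext (LinearMap.ext fun r =>
      congrArg ULift.up (Finsupp.single_eq_same (a := c.e) (b := r.down))) }

end StructConst

end

noncomputable section

open Limits
open scoped ENNReal

/-! ### Structure constants of the Hall algebra -/

section

variable {C : Type u} [Category.{v} C] [Abelian C]

theorem K₀.of_eq_add {N E M : C} {f : N ⟶ E} {g : E ⟶ M} (h : IsSes f g) :
    K₀.of E = K₀.of M + K₀.of N := by
  rw [add_comm]
  refine (QuotientAddGroup.eq_iff_sub_mem).2 (AddSubgroup.subset_closure ?_)
  exact ⟨ShortComplex.mk f g h.1, h.2, rfl⟩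

theorem K₀.of_out (x : IsoClass C) : K₀.of x.out = K₀.ofClass x := by
  rw [K₀.of, isoClass_out]

theorem K₀.ofClass_eq_add {x y z : IsoClass C} (h : hallP x.out y.out z.out ≠ 0) :
    K₀.ofClass z = K₀.ofClass x + K₀.ofClass y := by
  obtain ⟨s⟩ : Nonempty (Ses y.out z.out x.out) := (Nat.card_ne_zero.1 h).1
  rw [← K₀.of_out, ← K₀.of_out, ← K₀.of_out]
  exact K₀.of_eq_add s.2

theorem isZero_out_iff {x : IsoClass C} : IsZero x.out ↔ x = isoClass 0 := by
  constructor
  · intro h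
    rw [← isoClass_out x]
    exact isoClass_eq_iff.2 ⟨h.isoZero⟩
  · rintro rfl
    exact (isZero_zero C).of_iso (nonempty_iso_out (0 : C)).some

theorem K₀.ofClass_zero : K₀.ofClass (isoClass (0 : C)) = 0 := by
  have h := K₀.of_eq_add (IsSes.cokernel (𝟙 (0 : C)))
  have h' : K₀.of (cokernel (𝟙 (0 : C))) = K₀.of (0 : C) :=
    congrArg K₀.ofClass (isoClass_eq_iff.2 ⟨(isZero_cokernel_of_epi _).isoZero⟩)
  rw [h'] at h
  exact left_eq_add.1 h

theorem hallP_of_isZero_left {M : C} (hM : IsZero M) (N E : C) :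
    hallP M N E = Nat.card (N ≅ E) := by
  refine Nat.card_congr ⟨fun s => ?_, fun e => ⟨(e.hom, 0), ?_⟩, fun s => ?_, fun e => ?_⟩
  · have h : IsSes s.1.1 s.1.2 := s.2
    have := h.mono
    have : Epi s.1.1 := h.2.exact.epi_f (hM.eq_zero_of_tgt _)
    have := isIso_of_mono_of_epi s.1.1
    exact asIso s.1.1
  · exact IsSes.of_lift (hM.eq_zero_of_tgt _) inferInstance ⟨fun _ _ _ => hM.eq_of_src _ _⟩
      fun t _ => ⟨t ≫ e.inv, by simp⟩
  · exact Subtype.ext (Prod.ext rfl (hM.eq_of_tgt _ _))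
  · exact Iso.ext rfl

theorem hallP_of_isZero_right {N : C} (hN : IsZero N) (M E : C) :
    hallP M N E = Nat.card (E ≅ M) := by
  refine Nat.card_congr ⟨fun s => ?_, fun e => ⟨(0, e.hom), ?_⟩, fun s => ?_, fun e => ?_⟩
  · have h : IsSes s.1.1 s.1.2 := s.2
    have := h.epi
    have : Mono s.1.2 := h.2.exact.mono_g (hN.eq_zero_of_src _)
    have := isIso_of_mono_of_epi s.1.2
    exact asIso s.1.2
  · exact IsSes.of_desc (hN.eq_of_src _ _) ⟨fun _ _ _ => hN.eq_of_tgt _ _⟩ inferInstance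
      fun t _ => ⟨e.inv ≫ t, by simp⟩
  · exact Subtype.ext (Prod.ext (hN.eq_of_src _ _) rfl)
  · exact Iso.ext rfl

theorem aut_of_isZero {M : C} (hM : IsZero M) : aut M = 1 :=
  Nat.card_eq_one_iff_exists.2 ⟨Iso.refl M, fun _ => Iso.ext (hM.eq_of_src _ _)⟩

variable [∀ X Y : C, Finite (X ⟶ Y)]

theorem card_iso_out_div (x z : IsoClass C) :
    (Nat.card (x.out ≅ z.out) : ℝ) / aut x.out = Finsupp.single x 1 z := by
  classical
  by_cases h : x = z
  · subst h
    rw [card_iso_eq_aut (Iso.refl _), div_self (by exact_mod_cast (aut_pos _).ne'),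
      Finsupp.single_eq_same]
  · have : IsEmpty (x.out ≅ z.out) :=
      ⟨fun e => h (by rw [← isoClass_out x, ← isoClass_out z, isoClass_eq_iff.2 ⟨e⟩])⟩
    rw [Finsupp.single_eq_of_ne (Ne.symm h)]
    simp

theorem card_iso_symm (X Y : C) : Nat.card (X ≅ Y) = Nat.card (Y ≅ X) :=
  Nat.card_congr ⟨Iso.symm, Iso.symm, fun _ => rfl, fun _ => rfl⟩

theorem hallP_zero (x y : IsoClass C) :
    (hallP x.out y.out (isoClass (0 : C)).out : ℝ) =
      Finsupp.single (isoClass (0 : C)) 1 x * Finsupp.single (isoClass (0 : C)) 1 y := by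
  have h0 : IsZero (isoClass (0 : C)).out := isZero_out_iff.2 rfl
  by_cases hx : x = isoClass (0 : C)
  · subst hx
    rw [hallP_of_isZero_left h0, card_iso_symm, Finsupp.single_eq_same, one_mul,
      ← card_iso_out_div, aut_of_isZero h0, Nat.cast_one, div_one]
  · rw [Finsupp.single_eq_of_ne hx, zero_mul, Nat.cast_eq_zero]
    by_contra h
    obtain ⟨s⟩ : Nonempty (Ses y.out (isoClass (0 : C)).out x.out) := (Nat.card_ne_zero.1 h).1
    have := s.2.epi
    exact hx (isZero_out_iff.1 (h0.of_epi s.1.2))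

theorem toReal_autWeight (x : IsoClass C) : (autWeight x).toReal = (aut x.out : ℝ)⁻¹ := by
  simp [autWeight]

theorem autWeight_ne_top (x : IsoClass C) : autWeight x ≠ ∞ :=
  ENNReal.inv_ne_top.2 (by exact_mod_cast (aut_pos _).ne')

theorem tsum_hallP_mul_hallP_real (L M N E : C) :
    ∑' x : IsoClass C, (hallP L M x.out : ℝ) * hallP x.out N E * (aut x.out : ℝ)⁻¹ =
      ∑' y : IsoClass C, (hallP M N y.out : ℝ) * hallP L y.out E * (aut y.out : ℝ)⁻¹ := by
  have h := congrArg ENNReal.toReal (tsum_hallP_mul_hallP L M N E)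
  rw [ENNReal.tsum_toReal_eq fun x =>
      ENNReal.mul_ne_top (ENNReal.natCast_ne_top _) (autWeight_ne_top x),
    ENNReal.tsum_toReal_eq fun x =>
      ENNReal.mul_ne_top (ENNReal.natCast_ne_top _) (autWeight_ne_top x)] at h
  simpa only [ENNReal.toReal_mul, ENNReal.toReal_natCast, toReal_autWeight, Nat.cast_mul] using h

/-- Reordering of the four isomorphism classes in Green's formula. -/
def prodReorder (I : Type*) : (I × I) × (I × I) ≃ ((I × I) × I) × I where
  toFun p := (((p.1.2, p.1.1), p.2.2), p.2.1)
  invFun p := ((p.1.1.2, p.1.1.1), (p.2, p.1.2))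
  left_inv _ := rfl
  right_inv _ := rfl

/-- Every summand of `tsum_cross` is finite, so `toReal` can be applied term by term. The index is
reordered to `((B, A), (D, X))`, matching the two coproducts in `StructConst.mul_comul`. -/
theorem tsum_cross_real (c : C → C → ℝ) (hc₀ : ∀ A D, 0 ≤ c A D) {M N M' N' : C}
    (hc : ∀ {A B X D : C} (F : Frame M N M' N' A B X D),
      ∑' e : IsoClass C, (Nat.card {K : Cross M N M' N' e.out // K.Fits F} : ℝ≥0∞) * autWeight e =
        ENNReal.ofReal (c A D)) :
    ∑' e : IsoClass C, (hallP M N e.out : ℝ) * hallP M' N' e.out * (aut e.out : ℝ)⁻¹ =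
      ∑' p : (IsoClass C × IsoClass C) × (IsoClass C × IsoClass C),
        (hallP p.1.2.out p.1.1.out M : ℝ) * hallP p.2.2.out p.2.1.out N *
          (hallP p.1.1.out p.2.1.out N' * hallP p.1.2.out p.2.2.out M') *
          c p.1.2.out p.2.1.out * ((aut p.1.2.out : ℝ)⁻¹ * (aut p.1.1.out : ℝ)⁻¹ *
            (aut p.2.2.out : ℝ)⁻¹ * (aut p.2.1.out : ℝ)⁻¹) := by
  have h := congrArg ENNReal.toReal
    (tsum_cross (M := M) (N := N) (M' := M') (N' := N') (fun A D => ENNReal.ofReal (c A D)) hc)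
  rw [ENNReal.tsum_toReal_eq fun x =>
      ENNReal.mul_ne_top (ENNReal.natCast_ne_top _) (autWeight_ne_top x),
    ENNReal.tsum_toReal_eq fun x => ENNReal.mul_ne_top
      (ENNReal.mul_ne_top (ENNReal.natCast_ne_top _) ENNReal.ofReal_ne_top)
      (ENNReal.mul_ne_top (ENNReal.mul_ne_top (ENNReal.mul_ne_top (autWeight_ne_top _)
        (autWeight_ne_top _)) (autWeight_ne_top _)) (autWeight_ne_top _)),
    ← (prodReorder (IsoClass C)).tsum_eq] at h
  simpa only [ENNReal.toReal_mul, ENNReal.toReal_natCast, toReal_autWeight, Nat.cast_mul,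
    ENNReal.toReal_ofReal (hc₀ _ _), prodReorder, Equiv.coe_fn_mk] using h

/-- The structure constants of the Hall algebra of a category in which Green's formula holds. -/
def hallStructConst (h₁ : ∀ M N : C, {x : IsoClass C | hallP M N x.out ≠ 0}.Finite)
    (h₂ : ∀ E : C, {p : IsoClass C × IsoClass C | hallP p.1.out p.2.out E ≠ 0}.Finite)
    (χ : K₀ C →+ K₀ C →+ ℤ) (q : ℝ) (hq : 0 < q)
    (hG : ∀ {M N M' N' A B X D : C} (F : Frame M N M' N' A B X D),
      ∑' e : IsoClass C, (Nat.card {K : Cross M N M' N' e.out // K.Fits F} : ℝ≥0∞) * autWeight e =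
        ENNReal.ofReal (q ^ (-χ (K₀.of A) (K₀.of D)))) :
    StructConst (K₀.ofClass (C := C)) χ q where
  m x y := Finsupp.ofSupportFinite
    (fun z => (hallP x.out y.out z.out : ℝ) / (aut x.out * aut y.out))
    ((h₁ x.out y.out).subset fun z hz h => hz (by simp [h]))
  d z := Finsupp.ofSupportFinite (fun p => (hallP p.2.out p.1.out z.out : ℝ) / aut z.out)
    (((h₂ z.out).preimage Prod.swap_injective.injOn).subset fun p hp h => hp (by
      simp only [Prod.fst_swap, Prod.snd_swap] at h
      simp [h]))
  e := isoClass 0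
  deg_m x y z h := K₀.ofClass_eq_add fun h' => h (by simp [Finsupp.ofSupportFinite_coe, h'])
  deg_d z x y h := by
    rw [add_comm]
    exact (K₀.ofClass_eq_add fun h' => h (by simp [Finsupp.ofSupportFinite_coe, h'])).symm
  deg_e := K₀.ofClass_zero
  one_mul x := Finsupp.ext fun z => by
    have h0 : IsZero (isoClass (0 : C)).out := isZero_out_iff.2 rfl
    rw [Finsupp.ofSupportFinite_coe, hallP_of_isZero_left h0, aut_of_isZero h0, Nat.cast_one,
      one_mul, card_iso_out_div]
  mul_one x := Finsupp.ext fun z => by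
    have h0 : IsZero (isoClass (0 : C)).out := isZero_out_iff.2 rfl
    rw [Finsupp.ofSupportFinite_coe, hallP_of_isZero_right h0, aut_of_isZero h0, Nat.cast_one,
      mul_one, card_iso_symm, card_iso_out_div]
  mul_assoc x y z w := by
    have h := congrArg (fun r : ℝ => (aut x.out * aut y.out * aut z.out : ℝ)⁻¹ * r)
      (tsum_hallP_mul_hallP_real x.out y.out z.out w.out)
    simp only [← tsum_mul_left] at h
    simp only [Finsupp.ofSupportFinite_coe]
    refine Eq.trans (tsum_congr fun t => ?_) (h.trans (tsum_congr fun t => ?_))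
    · simp only [div_eq_mul_inv, mul_inv]
      ring
    · simp only [div_eq_mul_inv, mul_inv]
      ring
  counit_comul z y := by
    have h0 : IsZero (isoClass (0 : C)).out := isZero_out_iff.2 rfl
    rw [Finsupp.ofSupportFinite_coe, hallP_of_isZero_right h0, card_iso_out_div]
  comul_counit z y := by
    have h0 : IsZero (isoClass (0 : C)).out := isZero_out_iff.2 rfl
    rw [Finsupp.ofSupportFinite_coe, hallP_of_isZero_left h0, card_iso_symm, card_iso_out_div]
  comul_assoc z x y w := by
    -- The filtration count is used with `x`, `y`, `w` from the bottom up, because `Δ` writes the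
    -- subobject before the quotient.
    have h := congrArg (fun r : ℝ => (aut z.out : ℝ)⁻¹ * r)
      (tsum_hallP_mul_hallP_real w.out y.out x.out z.out)
    simp only [← tsum_mul_left] at h
    simp only [Finsupp.ofSupportFinite_coe]
    refine Eq.trans (tsum_congr fun t => ?_) (h.trans (tsum_congr fun t => ?_))
    · simp only [div_eq_mul_inv]
      ring
    · simp only [div_eq_mul_inv]
      ring
  one_comul := Finsupp.ext fun p => by
    classical
    have h0 : IsZero (isoClass (0 : C)).out := isZero_out_iff.2 rfl
    rw [Finsupp.ofSupportFinite_coe, hallP_zero, aut_of_isZero h0, Nat.cast_one, div_one]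
    obtain ⟨a, b⟩ := p
    simp only [Finsupp.single_apply, Prod.ext_iff]
    by_cases ha : isoClass (0 : C) = a <;> by_cases hb : isoClass (0 : C) = b <;> simp [ha, hb]
  mul_counit x y := by
    have h0 : IsZero (isoClass (0 : C)).out := isZero_out_iff.2 rfl
    rw [Finsupp.ofSupportFinite_coe, hallP_zero]
    by_cases hx : x = isoClass (0 : C)
    · by_cases hy : y = isoClass (0 : C)
      · rw [hx, hy, aut_of_isZero h0]
        simp
      · rw [Finsupp.single_eq_of_ne hy, mul_zero, zero_div]
    · rw [Finsupp.single_eq_of_ne hx, zero_mul, zero_div]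
  mul_comul x y u v := by
    -- The coefficient of `u ⊗ v` in `Δ` has subobject `u` and quotient `v`, hence `N' = u`, `M' =
    -- v`. In `Δ x ⊗ Δ y` the tensor factors are `B`, `A`, `D`, `X`, so the braiding exchanges `A`
    -- and `D` and contributes the weight in `hG`.
    have h := congrArg (fun r : ℝ => (aut x.out * aut y.out : ℝ)⁻¹ * r)
      (tsum_cross_real (M := x.out) (N := y.out) (M' := v.out) (N' := u.out)
        (fun A D => q ^ (-χ (K₀.of A) (K₀.of D))) (fun A D => (zpow_pos hq _).le) hG)
    simp only [← tsum_mul_left] at h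
    simp only [Finsupp.ofSupportFinite_coe]
    refine Eq.trans (tsum_congr fun t => ?_) (h.trans (tsum_congr fun t => ?_))
    · simp only [div_eq_mul_inv, mul_inv]
      ring
    · simp only [div_eq_mul_inv, mul_inv, K₀.of_out]
      ring

end

end

noncomputable section

open Limits
open scoped ENNReal

/-! ### Finite-dimensional vector spaces over a finite field -/

section FGModuleCat

variable {k : Type u} [Field k]

instance (X : FGModuleCat.{u} k) : Projective X where
  factors {E Y} f e _ := by
    let F := forget₂ (FGModuleCat.{u} k) (ModuleCat.{u} k)
    have : Projective (F.obj X) :=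
      (IsProjective.iff_projective (R := k) (P := X)).1 inferInstance
    have : Epi (F.map e) := inferInstance
    refine ⟨F.preimage (Projective.factorThru (F.map f) (F.map e)), F.map_injective ?_⟩
    rw [F.map_comp, F.map_preimage, Projective.factorThru_comp]

instance (X : FGModuleCat.{u} k) : Injective X where
  factors {E Y} f e _ := by
    let F := forget₂ (FGModuleCat.{u} k) (ModuleCat.{u} k)
    have : Injective (F.obj X) :=
      Module.injective_object_of_injective_module (inj := Module.injective_of_isSemisimpleRing k X)
    have : Mono (F.map e) := inferInstance
    refine ⟨F.preimage (Injective.factorThru (F.map f) (F.map e)), F.map_injective ?_⟩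
    rw [F.map_comp, F.map_preimage, Injective.comp_factorThru]

instance [Finite k] (X Y : FGModuleCat.{u} k) : Finite (X ⟶ Y) :=
  Module.finite_of_finite k

theorem FGModuleCat.finrank_hom (X Y : FGModuleCat.{u} k) :
    Module.finrank k (X ⟶ Y) = Module.finrank k X * Module.finrank k Y := by
  rw [← Module.finrank_linearMap k k X Y]
  exact LinearEquiv.finrank_eq
    { toFun := fun f => f.hom.hom
      invFun := fun f => FGModuleCat.ofHom f
      map_add' := fun _ _ => rfl
      map_smul' := fun _ _ => rfl
      left_inv := fun _ => rfl
      right_inv := fun _ => rfl }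

theorem FGModuleCat.finrank_eq_add {N E M : FGModuleCat.{u} k} {f : N ⟶ E} {g : E ⟶ M}
    (h : IsSes f g) : Module.finrank k E = Module.finrank k N + Module.finrank k M :=
  have : Module.Finite k (((ShortComplex.mk f g h.1).map
      (forget₂ (FGModuleCat.{u} k) (ModuleCat.{u} k))).X₁) :=
    inferInstanceAs (Module.Finite k N)
  have : Module.Finite k (((ShortComplex.mk f g h.1).map
      (forget₂ (FGModuleCat.{u} k) (ModuleCat.{u} k))).X₃) :=
    inferInstanceAs (Module.Finite k M)
  ModuleCat.free_shortExact_finrank_add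
    (h.2.map_of_exact (forget₂ (FGModuleCat.{u} k) (ModuleCat.{u} k))) rfl rfl

end FGModuleCat

/-! ### The Euler form through dimension vectors -/

namespace QRep

variable {V : Type v} [Quiver.{w} V] {k : Type u} [Field k]

/-- The dimension at a vertex, as a function on the Grothendieck group. -/
def dimAt (i : V) : K₀ (QuiverRep V k) →+ ℤ :=
  QuotientAddGroup.lift _ (FreeAbelianGroup.lift fun x : IsoClass (QuiverRep V k) =>
    (Module.finrank k (at' x.out i : FGModuleCat.{u} k) : ℤ)) <| (AddSubgroup.closure_le _).2 <| by
      have hc : ∀ M : QuiverRep V k,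
          Module.finrank k (at' (isoClass M).out i : FGModuleCat.{u} k) =
            Module.finrank k (at' M i : FGModuleCat.{u} k) := fun M =>
        (FGModuleCat.isoToLinearEquiv
          ((nonempty_iso_out M).some.app ((Paths.of V).obj i))).finrank_eq
      rintro _ ⟨S, hS, rfl⟩
      have h : IsSes S.f S.g := ⟨S.zero, hS⟩
      simp only [SetLike.mem_coe, AddMonoidHom.mem_ker, map_sub, map_add,
        FreeAbelianGroup.lift_apply_of, hc]
      rw [FGModuleCat.finrank_eq_add (isSes_iff.1 h i)]
      push_cast
      ring

theorem dimAt_of (i : V) (M : QuiverRep V k) :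
    dimAt i (K₀.of M) = Module.finrank k (at' M i : FGModuleCat.{u} k) := by
  have : dimAt i (K₀.of M) =
      Module.finrank k (at' (isoClass M).out i : FGModuleCat.{u} k) :=
    FreeAbelianGroup.lift_apply_of _ _
  rw [this, (FGModuleCat.isoToLinearEquiv
    ((nonempty_iso_out M).some.app ((Paths.of V).obj i))).finrank_eq]

variable [Fintype V] [Fintype (QArrow V)]

variable (V k) in
/-- The Euler form. -/
def eulerForm : K₀ (QuiverRep V k) →+ K₀ (QuiverRep V k) →+ ℤ :=
  ∑ i : V, (AddMonoidHom.mul.comp (dimAt i)).compl₂ (dimAt i) -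
    ∑ p : QArrow V, (AddMonoidHom.mul.comp (dimAt p.1)).compl₂ (dimAt p.2.1)

theorem eulerForm_of (M N : QuiverRep V k) :
    eulerForm V k (K₀.of M) (K₀.of N) =
      ∑ i : V, (Module.finrank k (at' M i ⟶ at' N i) : ℤ) -
        ∑ p : QArrow V, (Module.finrank k (at' M p.1 ⟶ at' N p.2.1) : ℤ) := by
  simp [eulerForm, AddMonoidHom.finsetSum_apply, dimAt_of, FGModuleCat.finrank_hom]

theorem finrank_repExt_zero (M N : QuiverRep V k) :
    Module.finrank k (repExt M N 0) = Module.finrank k (M ⟶ N) :=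
  (Abelian.Ext.linearEquiv₀ (R := k)).finrank_eq

theorem eulerForm_eq_eulerChar (M N : QuiverRep V k) :
    eulerForm V k (K₀.of M) (K₀.of N) = eulerChar M N := by
  have h : (Module.finrank k (M ⟶ N) : ℤ) - Module.finrank k (repExt M N 1) = _ :=
    finrank_hom_sub_finrank_ext k M N
  rw [eulerForm_of, eulerChar, Finset.sum_range_succ, Finset.sum_range_one, finrank_repExt_zero,
    ← h]
  ring

theorem finite_repExt (M N : QuiverRep V k) : ∀ i : ℕ, Module.Finite k (repExt M N i) ∧
    (2 ≤ i → Subsingleton (repExt M N i))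
  | 0 => ⟨have := finite_hom k M N
      Module.Finite.equiv (Abelian.Ext.linearEquiv₀ (R := k)).symm, fun h => by omega⟩
  | 1 => ⟨finite_ext_one k M N, fun h => by omega⟩
  | i + 2 => by
    have : Subsingleton (repExt M N (i + 2)) :=
      ⟨fun x y => (ext_eq_zero i x).trans (ext_eq_zero i y).symm⟩
    exact ⟨inferInstance, fun _ => this⟩

/-- A `Hom` space between vector spaces has `q ^ dim` elements, so the quotient of products in
`tsum_cross_fits` is a power of `q`. Its exponent is minus the dimension formula for the Euler form.
-/
theorem tsum_cross_fits_eq_zpow [∀ i j : V, Finite (i ⟶ j)] [Finite k]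
    {M N M' N' A B X D : QuiverRep V k}
    (F : Frame M N M' N' A B X D) :
    ∑' e : IsoClass (QuiverRep V k),
        (Nat.card {K : Cross M N M' N' e.out // K.Fits F} : ℝ≥0∞) * autWeight e =
      ENNReal.ofReal ((Nat.card k : ℝ) ^ (-eulerForm V k (K₀.of A) (K₀.of D))) := by
  have hq : (0 : ℝ) < Nat.card k := by exact_mod_cast Nat.card_pos
  have hcard : ∀ X Y : FGModuleCat.{u} k,
      Nat.card (X ⟶ Y) = Nat.card k ^ Module.finrank k (X ⟶ Y) :=
    fun X Y => Module.natCard_eq_pow_finrank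
  rw [tsum_cross_fits, eulerForm_of, neg_sub, zpow_sub₀ hq.ne',
    ENNReal.ofReal_div_of_pos (zpow_pos hq _), ← Nat.cast_sum, ← Nat.cast_sum, zpow_natCast,
    zpow_natCast, ENNReal.ofReal_pow hq.le, ENNReal.ofReal_pow hq.le, ENNReal.ofReal_natCast,
    ← Finset.prod_pow_eq_pow_sum, ← Finset.prod_pow_eq_pow_sum]
  simp only [hcard, Nat.cast_pow]

end QRep

end

/-! ### Assembly for the quiver -/

noncomputable section

theorem IsSimplyLacedDynkin.finite {V : Type v} [Quiver.{w} V] (hQ : IsSimplyLacedDynkin V) :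
    Finite V := by
  obtain ⟨_, _, r, t, e, _⟩ := hQ
  exact Finite.of_equiv _ e.symm

theorem hallP_out {C : Type u} [Category.{v} C] [Abelian C] (M N E : C) :
    hallP (isoClass M).out (isoClass N).out (isoClass E).out = hallP M N E :=
  hallP_congr (nonempty_iso_out M).some (nonempty_iso_out N).some (nonempty_iso_out E).some

theorem aut_out {C : Type u} [Category.{v} C] (M : C) : aut (isoClass M).out = aut M :=
  aut_congr (nonempty_iso_out M).some

end

theorem mainTheorem2 {V : Type v} [Quiver.{w} V] (hQ : IsSimplyLacedDynkin V)
    {k : Type u} [Field k] [Finite k] :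
    (∀ (M N : QuiverRep V k) (i : ℕ), Module.Finite k (repExt M N i) ∧
      (2 ≤ i → Subsingleton (repExt M N i))) ∧
    ∃ χ : K₀ (QuiverRep V k) →+ K₀ (QuiverRep V k) →+ ℤ,
      (∀ M N : QuiverRep V k, χ (K₀.of M) (K₀.of N) = eulerChar M N) ∧
      letI : BraidedCategory (GrVect (K₀ (QuiverRep V k))) :=
        GrVect.braided χ (Nat.card k : ℝ) (Nat.cast_ne_zero.2 Nat.card_pos.ne')
      ∃ _ : BimonObj (hall (QuiverRep V k)),
        (∀ M N E : QuiverRep V k,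
          hallCoeff E (μ[hall (QuiverRep V k)].toLin (hallBasis M ⊗ₜ[ℝ] hallBasis N)) =
            (hallP M N E : ℝ) / (aut M * aut N)) ∧
        (∀ M N E : QuiverRep V k,
          hallCoeff₂ N M (Δ[hall (QuiverRep V k)].toLin (hallBasis E)) =
            (hallP M N E : ℝ) / aut E) ∧
        η[hall (QuiverRep V k)].toLin (ULift.up 1) = hallBasis 0 ∧
        (∀ M : QuiverRep V k, (Limits.IsZero M →
            ε[hall (QuiverRep V k)].toLin (hallBasis M) = ULift.up 1) ∧
          (¬ Limits.IsZero M → ε[hall (QuiverRep V k)].toLin (hallBasis M) = ULift.up 0)) := by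
  have := hQ.finite
  have := hQ.1
  have := Fintype.ofFinite V
  have := Fintype.ofFinite (QArrow V)
  have hq : (0 : ℝ) < Nat.card k := by exact_mod_cast Nat.card_pos
  refine ⟨QRep.finite_repExt, QRep.eulerForm V k, QRep.eulerForm_eq_eulerChar, ?_⟩
  let c := hallStructConst QRep.finite_hallP_ne_zero QRep.finite_hallP_out_ne_zero
    (QRep.eulerForm V k) (Nat.card k : ℝ) hq QRep.tsum_cross_fits_eq_zpow
  refine ⟨c.bimonObj hq.ne', fun M N E => ?_, fun M N E => ?_, rfl, fun M => ⟨fun h => ?_,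
    fun h => ?_⟩⟩
  -- The structure constants are computed on chosen representatives of classes; isomorphism
  -- invariance of `hallP` and `aut` returns them to the given objects.
  · refine (DFunLike.congr_fun (c.mulLin_single (isoClass M) (isoClass N)) (isoClass E)).trans ?_
    change (hallP (isoClass M).out (isoClass N).out (isoClass E).out : ℝ) /
      (aut (isoClass M).out * aut (isoClass N).out) = _
    rw [hallP_out, aut_out, aut_out]
  · refine (congrArg (coeff₂ (isoClass N) (isoClass M))
      (c.comulLin_single (isoClass E))).trans ((coeff₂_symm _ _ _).trans ?_)
    change (hallP (isoClass M).out (isoClass N).out (isoClass E).out : ℝ) /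
      aut (isoClass E).out = _
    rw [hallP_out, aut_out]
  · have h' : isoClass M = isoClass 0 := isoClass_eq_iff.2 ⟨h.isoZero⟩
    refine congrArg ULift.up (?_ : Finsupp.single (isoClass M) (1 : ℝ) (isoClass 0) = 1)
    rw [h', Finsupp.single_eq_same]
  · refine congrArg ULift.up (Finsupp.single_eq_of_ne fun h' => h ?_)
    exact (Limits.isZero_zero _).of_iso (isoClass_eq_iff.1 h'.symm).some
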